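/- Let $g,\mu,L>0$ and $\Omega=(2\pi L\mathbb{T})^2\times\mathbb{R}$, and let $\bar\rho:\mathbb{R}\to\mathbb{R}$ be a bounded smooth function with $\bar\rho'\in C_0^\infty(\mathbb{R})$, $\inf\bar\rho>0$ and $\bar\rho'(x_3^0)>0$ for some $x_3^0$. Put $$M_{\mathrm c}=\Big(\sup_{0\ne\psi\in H^1(\mathbb{R})}\frac{\int_{\mathbb R} g\bar\rho'\psi^2\,dx}{\int_{\mathbb R}|\psi'|^2\,dx}\Big)^{1/2}\in(0,\infty],$$ and let $\bar{\mathbf M}=M\mathbf e_1$ with $M\ne0$ (horizontal case) or $\bar{\mathbf M}=M\mathbf e_3$ with $0<|M|<M_{\mathrm c}$ (vertical case). The solvable domain $\mathbb{A}^{\mathrm g}\subset\mathbb{R}^2$ is, in the horizontal case, $$\big(\{\xi: 0<|M\xi_1|/|\xi|<M_{\mathrm c},\ |\xi|<S(\xi)\}\cup\{\xi_1=0\}\big)\setminus\{0\},\qquad S(\xi)^2=\sup_{0\ne\psi\in H^1(\mathbb{R})}\frac{\frac{g|\xi|^2}{(M\xi_1)^2}\int\bar\rho'\psi^2-\int|\psi'|^2}{\int\psi^2},$$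 and, in the vertical case, $\{\xi:|\xi|>|\xi|_{\mathrm{vc}}\}$, where $$|\xi|_{\mathrm{vc}}^2=\inf\Big\{\frac{M^2\int|\psi''|^2}{\int(g\bar\rho'\psi^2-M^2|\psi'|^2)}:\ \psi\in H^2(\mathbb{R}),\ \int(g\bar\rho'\psi^2-M^2|\psi'|^2)>0\Big\}.$$ For $\xi\neq 0$ and $s>0$ let $$\alpha(\xi,s)=\inf\Big\{|\xi|^2E_0(\psi)+sE_1(\psi):\ \psi\in H^2(\mathbb{R}),\ \int\bar\rho(|\xi|^2\psi^2+|\psi'|^2)=1\Big\},\qquad E_1(\psi)=\mu\int\big(4|\xi|^2|\psi'|^2+(|\xi|^2\psi+\psi'')^2\big),$$ where $E_0(\psi)=\int\big(M^2\xi_1^2(\psi^2+|\psi'|^2/|\xi|^2)-g\bar\rho'\psi^2\big)$ in the horizontal case and $E_0(\psi)=\int\big(M^2(|\psi'|^2+|\psi''|^2/|\xi|^2)-g\bar\rho'\psi^2\big)$ in the vertical case. Let $\mathfrak S_\xi=\sup\{s>0:\alpha(\xi,\tau)<0\ \forall\tau\in(0,s)\}$. Then for every $\xi\in\mathbb{A}^{\mathrm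 g}$ there is exactly one $s\in(0,\mathfrak S_\xi)$ with $s=\sqrt{-\alpha(\xi,s)}$; call it the growth rate $\lambda(\xi)$. The set $\mathbb{A}^{\mathrm g}\cap(L^{-1}\mathbb{Z})^2$ is nonempty, and $$\Lambda:=\sup_{\xi\in\mathbb{A}^{\mathrm g}\cap(L^{-1}\mathbb{Z})^2}\lambda(\xi)$$ is finite and positive. Moreover, there are $\Lambda^*>0$ with $\Lambda^*\in(2\Lambda/3,\Lambda]$ and a smooth real-valued solution $(\varrho,\mathbf u,\mathbf N,q)$, horizontally periodic (i.e. defined on $\Omega$), for $t\ge0$, of the linearized problem $$\varrho_t+\bar\rho'u_3=0,\quad \bar\rho\,\mathbf u_t+\nabla q+g\varrho\,\mathbf e_3=\mu\Delta\mathbf u+(\nabla\times\mathbf N)\times\bar{\mathbf M},\quad \mathbf N_t=\nabla\times(\mathbf u\times\bar{\mathbf M}),\quad \operatorname{div}\mathbf u=\operatorname{div}\mathbf N=0,$$ $$\lim_{|x_3|\to\infty}(\varrho,\mathbf u,\mathbf N)(t,x_1,x_2,x_3)=0\quad(t>0),$$ such that: 1. for every integer $k\ge0$, $\|(\varrho,\mathbf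 u,\mathbf N,q)(0)\|_{H^k(\Omega)}<\infty$; 2. for every integer $k\ge0$ and every $t>0$, $(\varrho,\mathbf u,\mathbf N,q)(t)\in H^k(\Omega)$ and $$\|(\varrho,\mathbf N,q)(t)\|_{H^k(\Omega)}=e^{\Lambda^*t}\|(\varrho,\mathbf N,q)(0)\|_{H^k(\Omega)},$$ and likewise $\|f(t)\|_{H^k(\Omega)}=e^{\Lambda^*t}\|f(0)\|_{H^k(\Omega)}$ for each single scalar component $f\in\{\varrho,u_1,u_2,u_3,N_1,N_2,N_3,q\}$; 3. $\operatorname{div}\mathbf u(0)=\operatorname{div}\mathbf N(0)=0$ and $\|(u_1,u_2)(0)\|_{L^2(\Omega)}\,\|u_3(0)\|_{L^2(\Omega)}>0$; 4. in the vertical case, $\|N_3(0)\|_{L^2(\Omega)}>0$. -/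

import Mathlib

open MeasureTheory Filter Topology
open scoped ContDiff ENNReal Matrix

noncomputable section

namespace RTMHD

/-! ### Sobolev functions on the line -/

/-- `f'` is a weak derivative of `f` on `ℝ`. -/
def HasWeakDeriv (f f' : ℝ → ℝ) : Prop :=
  ∀ η : ℝ → ℝ, ContDiff ℝ ∞ η → HasCompactSupport η →
    ∫ x, f x * deriv η x = -∫ x, f' x * η x

/-- An element of `H¹(ℝ)`, together with (a representative of) its weak derivative. -/
structure H1R where
  f : ℝ → ℝ
  d1 : ℝ → ℝ
  memLp_f : MemLp f 2 volume
  memLp_d1 : MemLp d1 2 volume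
  weak_d1 : HasWeakDeriv f d1

/-- An element of `H²(ℝ)`, together with its first two weak derivatives. -/
structure H2R extends H1R where
  d2 : ℝ → ℝ
  memLp_d2 : MemLp d2 2 volume
  weak_d2 : HasWeakDeriv d1 d2

/-! ### The data of the problem -/

/-- The steady magnetic field is `M e₁` (horizontal) or `M e₃` (vertical). -/
inductive FieldDir
  | horizontal
  | vertical

/-- Gravity `g`, viscosity `μ`, horizontal period `2πL`, field strength `M`, field direction, and
density profile `ρ`. -/
structure RTData where
  g : ℝ
  μ : ℝ
  L : ℝ
  M : ℝ
  dir : FieldDir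
  ρ : ℝ → ℝ

/-- Horizontal frequencies, with the Euclidean norm. -/
abbrev Freq := EuclideanSpace ℝ (Fin 2)

namespace RTData

variable (D : RTData)

/-- The steady magnetic field. -/
def Mbar : Fin 3 → ℝ :=
  match D.dir with
  | .horizontal => ![D.M, 0, 0]
  | .vertical => ![0, 0, D.M]

/-- The critical number `M_c`, possibly infinite: the square root of the supremum of
`∫ g ρ' ψ² / ∫ ψ'²` over nonzero `ψ ∈ H¹(ℝ)`. (Truncating negative quotients at `0` does not change
a supremum that is positive.) -/
def Mc : ℝ≥0∞ :=
  (⨆ (ψ : H1R) (_ : ¬ ψ.f =ᵐ[volume] 0),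
    ENNReal.ofReal ((∫ x, D.g * deriv D.ρ x * ψ.f x ^ 2) / ∫ x, ψ.d1 x ^ 2)) ^ (1 / 2 : ℝ)

/-- The standing assumptions: positive constants, a smooth bounded Rayleigh-Taylor density profile,
and a magnetic field that is horizontal and nonzero, or vertical, nonzero and below `M_c`. -/
structure Admissible : Prop where
  g_pos : 0 < D.g
  μ_pos : 0 < D.μ
  L_pos : 0 < D.L
  ρ_smooth : ContDiff ℝ ∞ D.ρ
  ρ_bdd : ∃ C : ℝ, ∀ x, |D.ρ x| ≤ C
  ρ'_supp : HasCompactSupport (deriv D.ρ)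
  ρ_pos : ∃ c : ℝ, 0 < c ∧ ∀ x, c ≤ D.ρ x
  ρ'_pos : ∃ x₀ : ℝ, 0 < deriv D.ρ x₀
  M_ne : D.M ≠ 0
  M_lt : D.dir = .vertical → ENNReal.ofReal |D.M| < D.Mc

/-! ### The variational problem and the growth rate -/

/-- The critical frequency function `S(ξ)` (used for the horizontal field, where
`0 < |M ξ₁| / |ξ| < M_c`). -/
def S (ξ : Freq) : ℝ :=
  √(sSup {r : ℝ | ∃ ψ : H1R, (¬ ψ.f =ᵐ[volume] 0) ∧
    r = (D.g * ‖ξ‖ ^ 2 * (∫ x, deriv D.ρ x * ψ.f x ^ 2) / (D.M * ξ 0) ^ 2 - ∫ x, ψ.d1 x ^ 2)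
      / ∫ x, ψ.f x ^ 2})

/-- The denominator `∫ (g ρ' ψ² - M² ψ'²)` in the critical frequency constant. -/
def vcDenom (ψ : H2R) : ℝ :=
  ∫ x, (D.g * deriv D.ρ x * ψ.f x ^ 2 - D.M ^ 2 * ψ.d1 x ^ 2)

/-- The critical frequency constant `|ξ|_vc` (used for the vertical field). -/
def xiVc : ℝ :=
  √(sInf {r : ℝ | ∃ ψ : H2R, 0 < D.vcDenom ψ ∧
    r = D.M ^ 2 * (∫ x, ψ.d2 x ^ 2) / D.vcDenom ψ})

/-- The solvable domain `𝔸^g`. -/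
def solvable : Set Freq :=
  match D.dir with
  | .horizontal =>
      ({ξ | 0 < |ξ 0 * D.M| / ‖ξ‖ ∧ ENNReal.ofReal (|ξ 0 * D.M| / ‖ξ‖) < D.Mc ∧ ‖ξ‖ < D.S ξ}
        ∪ {ξ | ξ 0 = 0}) \ {0}
  | .vertical => {ξ | D.xiVc < ‖ξ‖}

/-- The lattice `(L⁻¹ ℤ)²`. -/
def lattice : Set Freq := {ξ | ∀ i, ∃ n : ℤ, ξ i = n / D.L}

def E0 (ξ : Freq) (ψ : H2R) : ℝ :=
  match D.dir with
  | .horizontal =>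
      ∫ x, (D.M ^ 2 * ξ 0 ^ 2 * (ψ.f x ^ 2 + ψ.d1 x ^ 2 / ‖ξ‖ ^ 2)
        - D.g * deriv D.ρ x * ψ.f x ^ 2)
  | .vertical =>
      ∫ x, (D.M ^ 2 * (ψ.d1 x ^ 2 + ψ.d2 x ^ 2 / ‖ξ‖ ^ 2) - D.g * deriv D.ρ x * ψ.f x ^ 2)

def E1 (ξ : Freq) (ψ : H2R) : ℝ :=
  D.μ * ∫ x, (4 * ‖ξ‖ ^ 2 * ψ.d1 x ^ 2 + (‖ξ‖ ^ 2 * ψ.f x + ψ.d2 x) ^ 2)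

/-- The energy `E(ψ, s) = |ξ|² E₀(ψ) + s E₁(ψ)`. -/
def E (ξ : Freq) (s : ℝ) (ψ : H2R) : ℝ := ‖ξ‖ ^ 2 * D.E0 ξ ψ + s * D.E1 ξ ψ

def J (ξ : Freq) (ψ : H2R) : ℝ :=
  ∫ x, D.ρ x * (‖ξ‖ ^ 2 * ψ.f x ^ 2 + ψ.d1 x ^ 2)

/-- `α(s) = inf {E(ψ, s) : ψ ∈ H²(ℝ), J(ψ) = 1}`. -/
def α (ξ : Freq) (s : ℝ) : ℝ := sInf {r : ℝ | ∃ ψ : H2R, D.J ξ ψ = 1 ∧ r = D.E ξ s ψ}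

/-- The interval `(0, 𝔖)` with `𝔖 = sup {s : α(τ) < 0 for all τ ∈ (0, s)}`. -/
def sInterval (ξ : Freq) : Set ℝ :=
  {s | 0 < s ∧ ∃ s' : ℝ, s < s' ∧ ∀ τ ∈ Set.Ioo 0 s', D.α ξ τ < 0}

/-- `s` is the growth rate at `ξ`: a fixed point `s = λ(ξ, s) = √(-α(s))` in `(0, 𝔖)`. -/
def IsGrowthRate (ξ : Freq) (s : ℝ) : Prop := s ∈ D.sInterval ξ ∧ s = √(-D.α ξ s)

/-- The growth rate `λ(ξ)`, i.e. the fixed point above (which is unique for `ξ ∈ 𝔸^g`). -/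
def growthRate (ξ : Freq) : ℝ := Classical.epsilon (D.IsGrowthRate ξ)

/-- The values of `λ` at the lattice frequencies of the solvable domain. -/
def latticeRates : Set ℝ := D.growthRate '' (D.solvable ∩ D.lattice)

/-- `Λ = sup λ(ξ)` over the lattice frequencies of the solvable domain. -/
def Lam : ℝ := sSup D.latticeRates

end RTData

/-! ### Vector calculus and Sobolev norms on `Ω = (2πL𝕋)² × ℝ`

Functions on `Ω` are functions on `ℝ³` that are `2πL`-periodic in the first two variables. -/

/-- The partial derivative `∂ᵢ`. -/
def pd (i : Fin 3) (f : (Fin 3 → ℝ) → ℝ) (x : Fin 3 → ℝ) : ℝ := fderiv ℝ f x (Pi.single i 1)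

def grad (f : (Fin 3 → ℝ) → ℝ) (x : Fin 3 → ℝ) : Fin 3 → ℝ := fun i => pd i f x

def lap (f : (Fin 3 → ℝ) → ℝ) (x : Fin 3 → ℝ) : ℝ := ∑ i, pd i (pd i f) x

def div (F : (Fin 3 → ℝ) → Fin 3 → ℝ) (x : Fin 3 → ℝ) : ℝ := ∑ i, pd i (fun y => F y i) x

def curl (F : (Fin 3 → ℝ) → Fin 3 → ℝ) (x : Fin 3 → ℝ) : Fin 3 → ℝ :=
  ![pd 1 (fun y => F y 2) x - pd 2 (fun y => F y 1) x,
    pd 2 (fun y => F y 0) x - pd 0 (fun y => F y 2) x,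
    pd 0 (fun y => F y 1) x - pd 1 (fun y => F y 0) x]

/-- `f` is `2πL`-periodic in `x₁` and `x₂`. -/
def HorPeriodic (L : ℝ) (f : (Fin 3 → ℝ) → ℝ) : Prop :=
  ∀ x, f (x + Pi.single 0 (2 * Real.pi * L)) = f x ∧ f (x + Pi.single 1 (2 * Real.pi * L)) = f x

/-- The period cell `(0, 2πL)² × ℝ`. -/
def cell (L : ℝ) : Set (Fin 3 → ℝ) :=
  {x | x 0 ∈ Set.Ioo 0 (2 * Real.pi * L) ∧ x 1 ∈ Set.Ioo 0 (2 * Real.pi * L)}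

/-- The partial derivative `∂₁^{a₁} ∂₂^{a₂} ∂₃^{a₃}`. -/
def mpd (a : Fin 3 → ℕ) (f : (Fin 3 → ℝ) → ℝ) : (Fin 3 → ℝ) → ℝ :=
  (pd 0)^[a 0] ((pd 1)^[a 1] ((pd 2)^[a 2] f))

/-- The norm of `Hᵏ(Ω)` of a tuple `F` of smooth horizontally periodic functions: the square root of
the sum of the squared `L²(Ω)` norms of all partial derivatives of order at most `k` of all
components. It is finite exactly when all components lie in `Hᵏ(Ω)`. It is only used for smooth
functions, whose weak derivatives are the classical ones. -/
def hNorm (L : ℝ) (k : ℕ) {n : ℕ} (F : Fin n → (Fin 3 → ℝ) → ℝ) : ℝ≥0∞ :=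
  (∑ i, ∑ j ∈ Finset.range (k + 1), ∑ a ∈ Finset.Nat.antidiagonalTuple 3 j,
    ∫⁻ x in cell L, ENNReal.ofReal (mpd a (F i) x ^ 2)) ^ (1 / 2 : ℝ)

/-! ### The linearized problem -/

/-- `(ϱ, u, N, q)` is a smooth real-valued horizontally periodic solution, for times `t ≥ 0`, of the
linearized equations, with `(ϱ, u, N) → 0` as `|x₃| → ∞`. -/
structure IsSolution (D : RTData) (ϱ : ℝ → (Fin 3 → ℝ) → ℝ) (u N : ℝ → (Fin 3 → ℝ) → Fin 3 → ℝ)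
    (q : ℝ → (Fin 3 → ℝ) → ℝ) : Prop where
  smooth_ϱ : ContDiffOn ℝ ∞ (fun p : ℝ × (Fin 3 → ℝ) => ϱ p.1 p.2) (Set.Ici 0 ×ˢ Set.univ)
  smooth_u : ContDiffOn ℝ ∞ (fun p : ℝ × (Fin 3 → ℝ) => u p.1 p.2) (Set.Ici 0 ×ˢ Set.univ)
  smooth_N : ContDiffOn ℝ ∞ (fun p : ℝ × (Fin 3 → ℝ) => N p.1 p.2) (Set.Ici 0 ×ˢ Set.univ)
  smooth_q : ContDiffOn ℝ ∞ (fun p : ℝ × (Fin 3 → ℝ) => q p.1 p.2) (Set.Ici 0 ×ˢ Set.univ)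
  periodic_ϱ : ∀ t, 0 ≤ t → HorPeriodic D.L (ϱ t)
  periodic_u : ∀ t, 0 ≤ t → ∀ i, HorPeriodic D.L (fun x => u t x i)
  periodic_N : ∀ t, 0 ≤ t → ∀ i, HorPeriodic D.L (fun x => N t x i)
  periodic_q : ∀ t, 0 ≤ t → HorPeriodic D.L (q t)
  continuity : ∀ t, 0 < t → ∀ x,
    deriv (fun s => ϱ s x) t + deriv D.ρ (x 2) * u t x 2 = 0
  momentum : ∀ t, 0 < t → ∀ x,
    D.ρ (x 2) • deriv (fun s => u s x) t + grad (q t) x + (D.g * ϱ t x) • ![0, 0, 1]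
      = D.μ • (fun i => lap (fun y => u t y i) x) + curl (N t) x ⨯₃ D.Mbar
  induction : ∀ t, 0 < t → ∀ x,
    deriv (fun s => N s x) t = curl (fun y => u t y ⨯₃ D.Mbar) x
  div_u : ∀ t, 0 < t → ∀ x, div (u t) x = 0
  div_N : ∀ t, 0 < t → ∀ x, div (N t) x = 0
  decay_ϱ : ∀ t, 0 < t → ∀ x₁ x₂,
    Tendsto (fun x₃ => ϱ t ![x₁, x₂, x₃]) (cocompact ℝ) (𝓝 0)
  decay_u : ∀ t, 0 < t → ∀ x₁ x₂,
    Tendsto (fun x₃ => u t ![x₁, x₂, x₃]) (cocompact ℝ) (𝓝 0)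
  decay_N : ∀ t, 0 < t → ∀ x₁ x₂,
    Tendsto (fun x₃ => N t ![x₁, x₂, x₃]) (cocompact ℝ) (𝓝 0)

/-- The tuple `(ϱ, u₁, u₂, u₃, N₁, N₂, N₃, q)` at one time. -/
def allComp (ϱ : (Fin 3 → ℝ) → ℝ) (u N : (Fin 3 → ℝ) → Fin 3 → ℝ) (q : (Fin 3 → ℝ) → ℝ) :
    Fin 8 → (Fin 3 → ℝ) → ℝ :=
  ![ϱ, fun x => u x 0, fun x => u x 1, fun x => u x 2,
    fun x => N x 0, fun x => N x 1, fun x => N x 2, q]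

/-- The tuple `(ϱ, N₁, N₂, N₃, q)` at one time. -/
def rhoNq (ϱ : (Fin 3 → ℝ) → ℝ) (N : (Fin 3 → ℝ) → Fin 3 → ℝ) (q : (Fin 3 → ℝ) → ℝ) :
    Fin 5 → (Fin 3 → ℝ) → ℝ :=
  ![ϱ, fun x => N x 0, fun x => N x 1, fun x => N x 2, q]

end RTMHD

end

noncomputable section

namespace RTMHD

open scoped InnerProductSpace

/-! ### Weak derivatives on the line -/

/-! The growing solution is `exp (s * t)` times a normal mode with a single horizontal frequency
`ξ`. Prescribe `u₃ = y(x₃) cos(ξ·x + c)`; incompressibility, the continuity and induction equations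
and the horizontal momentum balance then determine the remaining fields and the pressure, and the
vertical momentum balance becomes one fourth-order equation for `y`. That equation is the
Euler-Lagrange equation of the form `E(·, s) + s² J`. `isEigenmode_horizontal` and
`isEigenmode_vertical` verify this reduction.

The rate `s` comes from `existsUnique_growthRate`. As an infimum of affine functions of `s`, `α(ξ,
·)` is concave, hence continuous; it is nondecreasing, bounded below uniformly in `ξ`, and negative
for small `s` once `E₀` is negative somewhere. The last point is what membership in the solvable
domain means, after passing from `H¹` to `H²` by density where needed (`exists_E0_neg`). So `s² +
α(ξ, s)` has exactly one positive zero.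

At that zero `E + s² J` is nonnegative, with infimum `0` on `J = 1`. Instead of extracting a
minimising sequence, the form is written as `A - K`: viscosity and `s > 0` make `A` coercive on
`H²`, while `K`, multiplication by `g|ξ|²ρ'`, is compact because `ρ'` has compact support
(`isCompactOperator_mulL`). A nonnegative, non-coercive `A - K` has a kernel by the Fredholm
alternative (`exists_ker_of_not_coercive`). Kernel elements are weak solutions of an ordinary
differential equation with smooth bounded coefficients, so they are smooth with all derivatives in
`L²` (`exists_smooth_kernel`, `exists_eigenfunction`).

The lattice rates form a nonempty bounded set of positive numbers, so some lattice frequency has a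
rate above `2Λ/3`. Its mode has finite Sobolev norms of every order, and every norm is multiplied by
exactly `exp (s * t)`. The phase `c` is chosen so that the required components are visibly nonzero
at the centre line of the period cell (`exists_eigenmode`). -/

lemma hasCompactSupport_subset_Icc {φ : ℝ → ℝ} (h : HasCompactSupport φ) :
    ∃ R : ℝ, 0 < R ∧ ∀ x, x ∉ Set.Ioo (-R) R → φ x = 0 := by
  obtain ⟨R, hR⟩ := h.isCompact.isBounded.subset_ball 0
  refine ⟨max R 1, by positivity, fun x hx => ?_⟩
  by_contra hne
  have h1 := hR (subset_tsupport φ hne)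
  rw [Metric.mem_ball, Real.dist_eq, sub_zero, abs_lt] at h1
  exact hx ⟨by linarith [le_max_left R 1], by linarith [le_max_left R 1]⟩

lemma integral_eq_intervalIntegral_of_support {f : ℝ → ℝ} {R : ℝ} (hR : 0 < R)
    (h : ∀ x, x ∉ Set.Ioo (-R) R → f x = 0) : ∫ x, f x = ∫ x in (-R)..R, f x := by
  rw [intervalIntegral.integral_of_le (by linarith), setIntegral_eq_integral_of_forall_compl_eq_zero]
  intro x hx
  exact h x fun h' => hx ⟨h'.1, h'.2.le⟩

/-- A test function of integral zero is the derivative of a test function. -/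
lemma exists_testFunction_deriv_eq {φ : ℝ → ℝ} (hφ : ContDiff ℝ ∞ φ) (hc : HasCompactSupport φ)
    (h0 : ∫ x, φ x = 0) :
    ∃ η : ℝ → ℝ, ContDiff ℝ ∞ η ∧ HasCompactSupport η ∧ deriv η = φ := by
  obtain ⟨R, hR, hsupp⟩ := hasCompactSupport_subset_Icc hc
  have hd : ∀ x, HasDerivAt (fun x => ∫ t in (-R)..x, φ t) (φ x) x := fun x =>
    intervalIntegral.integral_hasDerivAt_right (hφ.continuous.intervalIntegrable _ _)
      (hφ.continuous.stronglyMeasurableAtFilter _ _) hφ.continuous.continuousAt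
  have hde : deriv (fun x => ∫ t in (-R)..x, φ t) = φ := funext fun x => (hd x).deriv
  refine ⟨fun x => ∫ t in (-R)..x, φ t, ?_, ?_, hde⟩
  · rw [contDiff_infty_iff_deriv, hde]
    exact ⟨fun x => (hd x).differentiableAt, hφ⟩
  · refine HasCompactSupport.intro (isCompact_Icc (a := -R) (b := R)) fun x hx => ?_
    rcases lt_or_ge x (-R) with hx1 | hx1
    · refine intervalIntegral.integral_zero_ae (Eventually.of_forall fun t ht => hsupp t ?_)
      rw [Set.uIoc_of_ge hx1.le] at ht
      exact fun h => by linarith [h.1, ht.2]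
    · have hx2 : R < x := by
        by_contra h
        exact hx ⟨hx1, not_lt.1 h⟩
      rw [← intervalIntegral.integral_add_adjacent_intervals
        (hφ.continuous.intervalIntegrable (-R) R) (hφ.continuous.intervalIntegrable R x),
        ← integral_eq_intervalIntegral_of_support hR hsupp, h0, zero_add]
      refine intervalIntegral.integral_zero_ae (Eventually.of_forall fun t ht => hsupp t ?_)
      rw [Set.uIoc_of_le hx2.le] at ht
      exact fun h => by linarith [h.2, ht.1]

lemma exists_testFunction_integral_one :
    ∃ θ : ℝ → ℝ, ContDiff ℝ ∞ θ ∧ HasCompactSupport θ ∧ ∫ x, θ x = 1 := by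
  let b : ContDiffBump (0 : ℝ) := ⟨1, 2, by norm_num, by norm_num⟩
  exact ⟨b.normed volume, b.contDiff_normed, b.hasCompactSupport_normed, b.integral_normed⟩

lemma integrable_mul_testFunction {f η : ℝ → ℝ} (hf : LocallyIntegrable f)
    (hη : Continuous η) (hc : HasCompactSupport η) : Integrable (fun x => f x * η x) := by
  have := hf.integrable_smul_right_of_hasCompactSupport hη hc
  simpa [mul_comm] using this

/-- The du Bois-Reymond lemma. -/
lemma ae_eq_const_of_hasWeakDeriv_zero {f : ℝ → ℝ} (hf : LocallyIntegrable f)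
    (h : HasWeakDeriv f 0) : ∃ c : ℝ, f =ᵐ[volume] fun _ => c := by
  obtain ⟨θ, hθ, hθc, hθ1⟩ := exists_testFunction_integral_one
  refine ⟨∫ x, f x * θ x, ?_⟩
  refine ae_eq_of_integral_contDiff_smul_eq hf (locallyIntegrable_const _) fun φ hφ hφc => ?_
  have iφ : Integrable φ := hφ.continuous.integrable_of_hasCompactSupport hφc
  have iθ : Integrable θ := hθ.continuous.integrable_of_hasCompactSupport hθc
  -- Subtracting `(∫ φ) θ` makes the integral zero, so the difference is the derivative of a test
  -- function and `f` annihilates it.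
  obtain ⟨η, hη, hηc, hηd⟩ := exists_testFunction_deriv_eq
    (φ := fun x => φ x - (∫ y, φ y) * θ x) (hφ.sub (contDiff_const.mul hθ))
    (hφc.sub (hθc.mul_left (f := fun _ => ∫ y, φ y)))
    (by rw [integral_sub iφ (iθ.const_mul _), integral_const_mul, hθ1, mul_one, sub_self])
  have h1 := h η hη hηc
  rw [hηd] at h1
  simp only [Pi.zero_apply, zero_mul, integral_zero, neg_zero] at h1
  have h2 : ∫ x, f x * (φ x - (∫ y, φ y) * θ x)
      = (∫ x, f x * φ x) - (∫ y, φ y) * ∫ x, f x * θ x := by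
    rw [← integral_const_mul, ← integral_sub (integrable_mul_testFunction hf hφ.continuous hφc)
      ((integrable_mul_testFunction hf hθ.continuous hθc).const_mul _)]
    exact integral_congr_ae (Eventually.of_forall fun x => by ring)
  rw [h2] at h1
  simp only [smul_eq_mul]
  rw [integral_mul_const]
  simp_rw [mul_comm (φ _)]
  linarith

/-! ### Primitives of locally integrable functions -/

lemma LocallyIntegrable.intervalIntegrable_of {f : ℝ → ℝ} (hf : LocallyIntegrable f) (a b : ℝ) :
    IntervalIntegrable f volume a b :=
  intervalIntegrable_iff.mpr
    ((hf.integrableOn_isCompact isCompact_uIcc).mono_set Set.uIoc_subset_uIcc)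

/-- The primitive of `g` that takes the value `c` at `0`. -/
def prim (c : ℝ) (g : ℝ → ℝ) (x : ℝ) : ℝ := c + ∫ t in (0 : ℝ)..x, g t

section prim

variable {f g : ℝ → ℝ}

lemma prim_sub_prim (hg : LocallyIntegrable g) (c a b : ℝ) :
    prim c g b - prim c g a = ∫ t in a..b, g t := by
  rw [prim, prim, add_sub_add_left_eq_sub, intervalIntegral.integral_interval_sub_left
    (LocallyIntegrable.intervalIntegrable_of hg _ _)
    (LocallyIntegrable.intervalIntegrable_of hg _ _)]

lemma continuous_prim (hg : LocallyIntegrable g) (c : ℝ) : Continuous (prim c g) :=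
  continuous_const.add
    (intervalIntegral.continuous_primitive (LocallyIntegrable.intervalIntegrable_of hg) 0)

/-- Absolute continuity is what allows integration by parts when the derivatives exist only almost
everywhere. -/
lemma absolutelyContinuous_prim (hg : LocallyIntegrable g) (c a b : ℝ) :
    AbsolutelyContinuousOnInterval (prim c g) a b := by
  have h1 := (LocallyIntegrable.intervalIntegrable_of hg a b
    ).absolutelyContinuousOnInterval_intervalIntegral (c := a) Set.left_mem_uIcc
  have h2 : AbsolutelyContinuousOnInterval (fun _ : ℝ => prim c g a) a b :=
    (LipschitzWith.const _).lipschitzOnWith.absolutelyContinuousOnInterval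
  have h3 : prim c g = (fun _ : ℝ => prim c g a) + fun x => ∫ t in a..x, g t := by
    funext x
    rw [Pi.add_apply, ← prim_sub_prim hg c a x]
    ring
  rw [h3]
  exact h2.add h1

lemma ae_deriv_prim (hg : LocallyIntegrable g) (c : ℝ) : ∀ᵐ x, deriv (prim c g) x = g x := by
  filter_upwards [LocallyIntegrable.ae_hasDerivAt_integral hg] with x hx
  exact ((hx 0).const_add c).deriv

lemma hasDerivAt_prim (hg : Continuous g) (c x : ℝ) : HasDerivAt (prim c g) (g x) x :=
  (intervalIntegral.integral_hasDerivAt_right (hg.intervalIntegrable _ _)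
      (hg.stronglyMeasurableAtFilter _ _) hg.continuousAt).const_add c

lemma integral_prim_mul_prim (hf : LocallyIntegrable f) (hg : LocallyIntegrable g)
    (c d a b : ℝ) :
    ∫ x in a..b, (f x * prim d g x + prim c f x * g x)
      = prim c f b * prim d g b - prim c f a * prim d g a := by
  rw [← (absolutelyContinuous_prim hf c a b).integral_deriv_mul_eq_sub
    (absolutelyContinuous_prim hg d a b)]
  refine intervalIntegral.integral_congr_ae ?_
  filter_upwards [ae_deriv_prim hf c, ae_deriv_prim hg d] with x h1 h2 _
  rw [h1, h2]

lemma eq_prim_of_contDiff {η : ℝ → ℝ} (hη : ContDiff ℝ ∞ η) : η = prim (η 0) (deriv η) := by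
  funext x
  rw [prim, intervalIntegral.integral_deriv_eq_sub (fun y _ => (hη.differentiable (by simp)) y)
    ((hη.continuous_deriv (by simp)).intervalIntegrable _ _)]
  ring

/-- Primitives have the expected weak derivative. -/
lemma hasWeakDeriv_prim (hg : LocallyIntegrable g) (c : ℝ) : HasWeakDeriv (prim c g) g := by
  intro η hη hηc
  have hcd := hη.continuous_deriv (by simp)
  obtain ⟨R, hR, hsupp⟩ := hasCompactSupport_subset_Icc hηc
  have i1 := integrable_mul_testFunction hg hη.continuous hηc
  have i2 := integrable_mul_testFunction (continuous_prim hg c).locallyIntegrable hcd hηc.deriv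
  obtain ⟨R', hR', hsupp'⟩ := hasCompactSupport_subset_Icc hηc.deriv
  rw [eq_neg_iff_add_eq_zero, add_comm, ← integral_add i1 i2,
    integral_eq_intervalIntegral_of_support (R := max R R') (by positivity)]
  · have h := integral_prim_mul_prim hg hcd.locallyIntegrable c (η 0) (-max R R') (max R R')
    rw [← eq_prim_of_contDiff hη] at h
    rw [h, hsupp _ fun h => absurd h.2 (not_lt.2 (le_max_left _ _)),
      hsupp _ fun h => absurd (neg_lt_neg_iff.1 h.1) (not_lt.2 (le_max_left _ _))]
    ring
  · intro x hx
    rw [hsupp x fun h => hx ⟨(neg_le_neg (le_max_left _ _)).trans_lt h.1,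
        h.2.trans_le (le_max_left _ _)⟩,
      hsupp' x fun h => hx ⟨(neg_le_neg (le_max_right _ _)).trans_lt h.1,
        h.2.trans_le (le_max_right _ _)⟩]
    ring

/-- A function with a locally integrable weak derivative is a primitive of it. -/
lemma HasWeakDeriv.ae_eq_prim (hf : LocallyIntegrable f) (hg : LocallyIntegrable g)
    (h : HasWeakDeriv f g) : ∃ c : ℝ, f =ᵐ[volume] prim c g := by
  have hp := (continuous_prim hg 0).locallyIntegrable (μ := volume)
  obtain ⟨c, hc⟩ := ae_eq_const_of_hasWeakDeriv_zero (hf.sub hp) (by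
    intro η hη hηc
    have hcd := hη.continuous_deriv (by simp)
    have e : ∀ x, (f - prim 0 g) x * deriv η x = f x * deriv η x - prim 0 g x * deriv η x :=
      fun x => by rw [Pi.sub_apply]; ring
    simp_rw [e]
    rw [integral_sub (integrable_mul_testFunction hf hcd hηc.deriv)
      (integrable_mul_testFunction hp hcd hηc.deriv), h η hη hηc, hasWeakDeriv_prim hg 0 η hη hηc]
    simp)
  refine ⟨c, ?_⟩
  filter_upwards [hc] with x hx
  rw [Pi.sub_apply] at hx
  simp only [prim] at hx ⊢
  linarith

lemma HasWeakDeriv.congr {f₁ g₁ : ℝ → ℝ} (h : HasWeakDeriv f g) (hf : f =ᵐ[volume] f₁)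
    (hg : g =ᵐ[volume] g₁) : HasWeakDeriv f₁ g₁ := by
  intro η hη hηc
  have e1 : (fun x => f₁ x * deriv η x) =ᵐ[volume] fun x => f x * deriv η x := by
    filter_upwards [hf] with x hx
    rw [hx]
  have e2 : (fun x => g₁ x * η x) =ᵐ[volume] fun x => g x * η x := by
    filter_upwards [hg] with x hx
    rw [hx]
  rw [integral_congr_ae e1, integral_congr_ae e2, h η hη hηc]

lemma hasWeakDeriv_of_hasDerivAt (h : ∀ x, HasDerivAt f (g x) x) (hg : Continuous g) :
    HasWeakDeriv f g := by
  have h1 : f = prim (f 0) g := by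
    funext x
    rw [prim, intervalIntegral.integral_eq_sub_of_hasDerivAt (fun y _ => h y)
      (hg.intervalIntegrable _ _)]
    ring
  rw [h1]
  exact hasWeakDeriv_prim hg.locallyIntegrable _

end prim

/-! ### Square integrable functions and integration by parts -/

lemma locallyIntegrable_of_memLp_two {f : ℝ → ℝ} (hf : MemLp f 2 volume) : LocallyIntegrable f :=
  hf.locallyIntegrable (by norm_num)

lemma integrable_mul_of_memLp_two {f g : ℝ → ℝ} (hf : MemLp f 2 volume) (hg : MemLp g 2 volume) :
    Integrable fun x => f x * g x :=
  hf.integrable_mul hg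

namespace H1R

variable (u v : H1R)

lemma locInt_f : LocallyIntegrable u.f := locallyIntegrable_of_memLp_two u.memLp_f

lemma locInt_d1 : LocallyIntegrable u.d1 := locallyIntegrable_of_memLp_two u.memLp_d1

lemma exists_ae_eq_prim : ∃ c : ℝ, u.f =ᵐ[volume] prim c u.d1 :=
  HasWeakDeriv.ae_eq_prim u.locInt_f u.locInt_d1 u.weak_d1

/-- Integration by parts in `H¹(ℝ)`. -/
lemma integral_mul_d1 : ∫ x, u.f x * v.d1 x = -∫ x, u.d1 x * v.f x := by
  obtain ⟨c, hc⟩ := u.exists_ae_eq_prim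
  obtain ⟨d, hd⟩ := v.exists_ae_eq_prim
  have i1 := integrable_mul_of_memLp_two u.memLp_d1 v.memLp_f
  have i2 := integrable_mul_of_memLp_two u.memLp_f v.memLp_d1
  -- `w` is the derivative of the product `P` of the continuous representatives. Both are
  -- integrable, so `P` has limits at both ends, these limits vanish, and `∫ w = 0`.
  set w : ℝ → ℝ := fun x => u.d1 x * v.f x + u.f x * v.d1 x with hw
  have iw : Integrable w := i1.add i2
  set P : ℝ → ℝ := fun x => prim c u.d1 x * prim d v.d1 x with hP
  have iP : Integrable P := by
    refine (integrable_mul_of_memLp_two u.memLp_f v.memLp_f).congr ?_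
    filter_upwards [hc, hd] with x h1 h2
    rw [h1, h2]
  have key : ∀ a b, ∫ t in a..b, w t = P b - P a := by
    intro a b
    rw [hP, ← integral_prim_mul_prim u.locInt_d1 v.locInt_d1 c d a b]
    refine intervalIntegral.integral_congr_ae ?_
    filter_upwards [hc, hd] with x h1 h2 _
    rw [hw]
    simp only [h1, h2]
  have hP' : ∀ x, P x = P 0 + ∫ t in (0 : ℝ)..x, w t := fun x => by rw [key]; ring
  have htop : Tendsto P atTop (𝓝 (P 0 + ∫ t in Set.Ioi 0, w t)) := by
    rw [funext hP']
    simpa using (intervalIntegral_tendsto_integral_Ioi 0 iw.integrableOn tendsto_id).const_add (P 0)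
  have hbot : Tendsto P atBot (𝓝 (P 0 - ∫ t in Set.Iic 0, w t)) := by
    have h1 := (intervalIntegral_tendsto_integral_Iic (0 : ℝ) (f := w) (μ := volume)
      iw.integrableOn tendsto_id).const_sub (P 0)
    refine h1.congr fun x => ?_
    rw [id, hP' x, intervalIntegral.integral_symm]
    ring
  -- An integrable function cannot have a nonzero limit at infinity, because half-lines have
  -- infinite measure.
  have e1 := IntegrableAtFilter.eq_zero_of_tendsto (iP.integrableAtFilter atTop)
    (fun s hs => by
      obtain ⟨b, hb⟩ := mem_atTop_sets.1 hs
      rw [← top_le_iff, ← Real.volume_Ici (a := b)]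
      exact measure_mono hb) htop
  have e2 := IntegrableAtFilter.eq_zero_of_tendsto (iP.integrableAtFilter atBot)
    (fun s hs => by
      obtain ⟨b, hb⟩ := mem_atBot_sets.1 hs
      rw [← top_le_iff, ← Real.volume_Iic (a := b)]
      exact measure_mono hb) hbot
  have e3 : (∫ t in Set.Iic 0, w t) + ∫ t in Set.Ioi 0, w t = ∫ t, w t :=
    intervalIntegral.integral_Iic_add_Ioi iw.integrableOn iw.integrableOn
  have e4 : ∫ t, w t = 0 := by linarith
  rw [hw, integral_add i1 i2] at e4
  linarith

end H1R

/-! ### Sobolev spaces on the line as Hilbert spaces -/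

/-- The Hilbert space `L²(ℝ)`. -/
abbrev L2R := Lp ℝ 2 (volume : Measure ℝ)

lemma inner_L2R (f g : L2R) : ⟪f, g⟫_ℝ = ∫ x, f x * g x := by
  rw [L2.inner_def]
  exact integral_congr_ae (Eventually.of_forall fun x => by simp [mul_comm])

lemma inner_toLp {f g : ℝ → ℝ} (hf : MemLp f 2 volume) (hg : MemLp g 2 volume) :
    ⟪hf.toLp f, hg.toLp g⟫_ℝ = ∫ x, f x * g x := by
  rw [inner_L2R]
  refine integral_congr_ae ?_
  filter_upwards [hf.coeFn_toLp, hg.coeFn_toLp] with x h1 h2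
  rw [h1, h2]

lemma inner_toLp_left {f : ℝ → ℝ} (hf : MemLp f 2 volume) (g : L2R) :
    ⟪hf.toLp f, g⟫_ℝ = ∫ x, f x * g x := by
  rw [inner_L2R]
  refine integral_congr_ae ?_
  filter_upwards [hf.coeFn_toLp] with x h1
  rw [h1]

/-- Multiplication by a bounded function on `L²(ℝ)`. -/
def mulL (c : ℝ → ℝ) (hc : MemLp c ∞ volume) : L2R →L[ℝ] L2R :=
  (ContinuousLinearMap.mul ℝ ℝ).holderL volume ∞ 2 2 (hc.toLp c)

lemma coeFn_mulL {c : ℝ → ℝ} (hc : MemLp c ∞ volume) (f : L2R) :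
    mulL c hc f =ᵐ[volume] fun x => c x * f x := by
  have h := (ContinuousLinearMap.mul ℝ ℝ).coeFn_holder (r := 2) (hc.toLp c) f
  filter_upwards [h, hc.coeFn_toLp] with x h1 h2
  rw [mulL, ContinuousLinearMap.holderL_apply_apply, h1, h2, ContinuousLinearMap.mul_apply']

lemma inner_mulL {c : ℝ → ℝ} (hc : MemLp c ∞ volume) (f g : L2R) :
    ⟪mulL c hc f, g⟫_ℝ = ∫ x, c x * f x * g x := by
  rw [inner_L2R]
  refine integral_congr_ae ?_
  filter_upwards [coeFn_mulL hc f] with x h1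
  rw [h1]

lemma memLp_two_of_testFunction {η : ℝ → ℝ} (h : Continuous η) (hc : HasCompactSupport η) :
    MemLp η 2 volume :=
  h.memLp_of_hasCompactSupport hc

/-- Test functions on the line. -/
abbrev TestFun := {η : ℝ → ℝ // ContDiff ℝ ∞ η ∧ HasCompactSupport η}

lemma TestFun.memLp (η : TestFun) : MemLp η.1 2 volume :=
  memLp_two_of_testFunction η.2.1.continuous η.2.2

lemma TestFun.memLp_deriv (η : TestFun) : MemLp (deriv η.1) 2 volume :=
  memLp_two_of_testFunction (η.2.1.continuous_deriv (by simp)) η.2.2.deriv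

/-- The functional `v ↦ ∫ vᵢ η' + ∫ vᵢ₊₁ η`. -/
def weakDefect (n : ℕ) (i : Fin n) (η : TestFun) :
    PiLp 2 (fun _ : Fin (n + 1) => L2R) →L[ℝ] ℝ :=
  innerSL ℝ (η.memLp_deriv.toLp _) ∘L PiLp.proj 2 (fun _ : Fin (n + 1) => L2R) i.castSucc
    + innerSL ℝ (η.memLp.toLp _) ∘L PiLp.proj 2 (fun _ : Fin (n + 1) => L2R) i.succ

/-- The space `Hⁿ(ℝ)`, as the space of tuples of an `L²` function and its weak derivatives. -/
def Hsob (n : ℕ) : Submodule ℝ (PiLp 2 (fun _ : Fin (n + 1) => L2R)) :=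
  ⨅ i : Fin n, ⨅ η : TestFun, LinearMap.ker (weakDefect n i η).toLinearMap

/-- The kernels of the continuous functionals `weakDefect` encode the weak derivative relations;
defining the space as their intersection makes it closed, hence complete. -/
lemma mem_Hsob {n : ℕ} {v : PiLp 2 (fun _ : Fin (n + 1) => L2R)} :
    v ∈ Hsob n ↔ ∀ i : Fin n, HasWeakDeriv (v i.castSucc) (v i.succ) := by
  simp only [Hsob, Submodule.mem_iInf, LinearMap.mem_ker]
  refine forall_congr' fun i => ?_
  have key : ∀ η : TestFun, weakDefect n i η v
      = (∫ x, v i.castSucc x * deriv η.1 x) + ∫ x, v i.succ x * η.1 x := by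
    intro η
    simp only [weakDefect, add_apply, ContinuousLinearMap.comp_apply,
      innerSL_apply_apply, PiLp.proj_apply, inner_toLp_left, mul_comm]
  refine ⟨fun h η hη hc => ?_, fun h η => ?_⟩
  · have := h ⟨η, hη, hc⟩
    rw [ContinuousLinearMap.coe_coe, key] at this
    linarith
  · have := h η.1 η.2.1 η.2.2
    rw [ContinuousLinearMap.coe_coe, key]
    linarith

lemma isClosed_Hsob (n : ℕ) : IsClosed (Hsob n : Set (PiLp 2 (fun _ : Fin (n + 1) => L2R))) := by
  simp only [Hsob, Submodule.coe_iInf]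
  exact isClosed_iInter fun i => isClosed_iInter fun η => (weakDefect n i η).isClosed_ker

instance (n : ℕ) : CompleteSpace (Hsob n) := (isClosed_Hsob n).completeSpace_coe

/-- The `i`-th derivative of an element of `Hⁿ(ℝ)`. -/
def Hsob.coord (n : ℕ) (i : Fin (n + 1)) : Hsob n →L[ℝ] L2R :=
  PiLp.proj 2 (fun _ : Fin (n + 1) => L2R) i ∘L (Hsob n).subtypeL

lemma Hsob.inner_eq {n : ℕ} (v w : Hsob n) :
    ⟪v, w⟫_ℝ = ∑ i, ⟪Hsob.coord n i v, Hsob.coord n i w⟫_ℝ := by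
  rw [Submodule.coe_inner, PiLp.inner_apply]
  rfl

lemma Hsob.weak {n : ℕ} (v : Hsob n) (i : Fin n) :
    HasWeakDeriv (Hsob.coord n i.castSucc v) (Hsob.coord n i.succ v) :=
  mem_Hsob.1 v.2 i

/-- An element of the Hilbert space `H¹(ℝ)`, unbundled. -/
def Hsob.toH1R (v : Hsob 1) : H1R where
  f := Hsob.coord 1 0 v
  d1 := Hsob.coord 1 1 v
  memLp_f := Lp.memLp _
  memLp_d1 := Lp.memLp _
  weak_d1 := Hsob.weak v 0

/-- An element of the Hilbert space `H²(ℝ)`, unbundled. -/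
def Hsob.toH2R (v : Hsob 2) : H2R where
  f := Hsob.coord 2 0 v
  d1 := Hsob.coord 2 1 v
  d2 := Hsob.coord 2 2 v
  memLp_f := Lp.memLp _
  memLp_d1 := Lp.memLp _
  memLp_d2 := Lp.memLp _
  weak_d1 := Hsob.weak v 0
  weak_d2 := Hsob.weak v 1

/-- An element of `H¹(ℝ)` as an element of the Hilbert space. -/
def H1R.toHsob (u : H1R) : Hsob 1 :=
  ⟨WithLp.toLp 2 ![u.memLp_f.toLp u.f, u.memLp_d1.toLp u.d1], mem_Hsob.2 fun i => by
    fin_cases i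
    exact u.weak_d1.congr u.memLp_f.coeFn_toLp.symm u.memLp_d1.coeFn_toLp.symm⟩

/-- An element of `H²(ℝ)` as an element of the Hilbert space. -/
def H2R.toHsob (u : H2R) : Hsob 2 :=
  ⟨WithLp.toLp 2 ![u.memLp_f.toLp u.f, u.memLp_d1.toLp u.d1, u.memLp_d2.toLp u.d2],
    mem_Hsob.2 fun i => by
      fin_cases i
      · exact u.weak_d1.congr u.memLp_f.coeFn_toLp.symm u.memLp_d1.coeFn_toLp.symm
      · exact u.weak_d2.congr u.memLp_d1.coeFn_toLp.symm u.memLp_d2.coeFn_toLp.symm⟩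

lemma H1R.coord_toHsob_zero (u : H1R) :
    Hsob.coord 1 0 u.toHsob = u.memLp_f.toLp u.f := rfl
lemma H1R.coord_toHsob_one (u : H1R) :
    Hsob.coord 1 1 u.toHsob = u.memLp_d1.toLp u.d1 := rfl
lemma H2R.coord_toHsob_zero (u : H2R) :
    Hsob.coord 2 0 u.toHsob = u.memLp_f.toLp u.f := rfl
lemma H2R.coord_toHsob_one (u : H2R) :
    Hsob.coord 2 1 u.toHsob = u.memLp_d1.toLp u.d1 := rfl
lemma H2R.coord_toHsob_two (u : H2R) :
    Hsob.coord 2 2 u.toHsob = u.memLp_d2.toLp u.d2 := rfl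

/-- A test function as an element of `H²(ℝ)`. -/
def TestFun.toH2R (η : TestFun) : H2R where
  f := η.1
  d1 := deriv η.1
  d2 := deriv (deriv η.1)
  memLp_f := η.memLp
  memLp_d1 := η.memLp_deriv
  memLp_d2 := TestFun.memLp_deriv ⟨deriv η.1, (contDiff_infty_iff_deriv.1 η.2.1).2, η.2.2.deriv⟩
  weak_d1 := hasWeakDeriv_of_hasDerivAt
    (fun x => (η.2.1.differentiable (by simp) x).hasDerivAt) (η.2.1.continuous_deriv (by simp))
  weak_d2 := by
    have h := (contDiff_infty_iff_deriv.1 η.2.1).2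
    exact hasWeakDeriv_of_hasDerivAt (fun x => (h.differentiable (by simp) x).hasDerivAt)
      (h.continuous_deriv (by simp))

/-- Every `f ∈ L²(ℝ)` is `v - v''` for some `v ∈ H²(ℝ)`. -/
lemma exists_H2R_sub_d2_eq {f : ℝ → ℝ} (hf : MemLp f 2 volume) :
    ∃ v : H2R, v.d2 =ᵐ[volume] fun x => v.f x - f x := by
  let ℓ : Hsob 1 →L[ℝ] ℝ := innerSL ℝ (hf.toLp f) ∘L Hsob.coord 1 0
  -- The Riesz representer of `z ↦ ∫ f z` for the `H¹` inner product: `∫ w z + ∫ w' z' = ∫ f z`,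
  -- which for test functions `z` says `w'' = w - f` weakly.
  let w : Hsob 1 := (InnerProductSpace.toDual ℝ (Hsob 1)).symm ℓ
  have hw : ∀ z : Hsob 1, ⟪w, z⟫_ℝ = ℓ z := fun z =>
    InnerProductSpace.toDual_symm_apply
  refine ⟨{ Hsob.toH1R w with
    d2 := fun x => (Hsob.toH1R w).f x - f x
    memLp_d2 := (Hsob.toH1R w).memLp_f.sub hf
    weak_d2 := ?_ }, Eventually.of_forall fun x => rfl⟩
  intro η hη hηc
  have h1 := hw (TestFun.toH2R ⟨η, hη, hηc⟩).toH1R.toHsob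
  rw [Hsob.inner_eq, Fin.sum_univ_two] at h1
  simp only [ℓ, ContinuousLinearMap.comp_apply, innerSL_apply_apply] at h1
  rw [H1R.coord_toHsob_zero, H1R.coord_toHsob_one, real_inner_comm, real_inner_comm (MemLp.toLp _ _),
    inner_toLp_left, inner_toLp_left, inner_toLp] at h1
  simp only [TestFun.toH2R] at h1
  have i1 := integrable_mul_of_memLp_two (Hsob.toH1R w).memLp_f (TestFun.memLp ⟨η, hη, hηc⟩)
  have i2 := integrable_mul_of_memLp_two hf (TestFun.memLp ⟨η, hη, hηc⟩)
  simp_rw [sub_mul]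
  rw [integral_sub i1 i2]
  simp only [Hsob.toH1R] at *
  simp only [mul_comm (η _), mul_comm (deriv η _)] at h1
  linarith

/-- The inclusion of `H²(ℝ)` into `H¹(ℝ)`. -/
def Hsob.incl : Hsob 2 →ₗ[ℝ] Hsob 1 where
  toFun v := ⟨WithLp.toLp 2 ![Hsob.coord 2 0 v, Hsob.coord 2 1 v], mem_Hsob.2 fun i => by
    fin_cases i
    exact Hsob.weak v 0⟩
  map_add' v w := by
    ext1
    ext1 i
    fin_cases i <;> simp
  map_smul' c v := by
    ext1
    ext1 i
    fin_cases i <;> simp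

/-- `H²(ℝ)` is dense in `H¹(ℝ)`. -/
lemma Hsob.dense_range_incl : Dense (LinearMap.range Hsob.incl : Set (Hsob 1)) := by
  rw [Submodule.dense_iff_topologicalClosure_eq_top, Submodule.topologicalClosure_eq_top_iff,
    Submodule.eq_bot_iff]
  intro u hu
  rw [Submodule.mem_orthogonal] at hu
  -- Orthogonality to test functions says `u'' = u` weakly. Hence `u` itself lies in `H²`, so it is
  -- orthogonal to itself.
  let v : H2R := { Hsob.toH1R u with
    d2 := (Hsob.toH1R u).f
    memLp_d2 := (Hsob.toH1R u).memLp_f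
    weak_d2 := by
      intro η hη hηc
      have h1 := hu _ ⟨(TestFun.toH2R ⟨η, hη, hηc⟩).toHsob, rfl⟩
      rw [Hsob.inner_eq, Fin.sum_univ_two] at h1
      have e0 : Hsob.coord 1 0 (Hsob.incl (TestFun.toH2R ⟨η, hη, hηc⟩).toHsob)
        = (TestFun.memLp ⟨η, hη, hηc⟩).toLp _ := rfl
      have e1 : Hsob.coord 1 1 (Hsob.incl (TestFun.toH2R ⟨η, hη, hηc⟩).toHsob)
        = (TestFun.memLp_deriv ⟨η, hη, hηc⟩).toLp _ := rfl
      rw [e0, e1, inner_toLp_left, inner_toLp_left] at h1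
      simp only [Hsob.toH1R]
      simp only [mul_comm (η _), mul_comm (deriv η _)] at h1
      linarith }
  have hv : Hsob.incl v.toHsob = u := by
    ext1
    ext1 i
    fin_cases i
    · exact Lp.toLp_coeFn (u.1 0) (Lp.memLp _)
    · exact Lp.toLp_coeFn (u.1 1) (Lp.memLp _)
  have := hu u ⟨_, hv⟩
  exact inner_self_eq_zero.1 this

/-- A quadratic form on `H¹(ℝ)` that is positive somewhere is positive somewhere on `H²(ℝ)`. -/
lemma exists_H2R_form_pos {c : ℝ → ℝ} (hc : MemLp c ∞ volume) (b : ℝ) (u : H1R)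
    (h : 0 < (∫ x, c x * u.f x ^ 2) - b * ∫ x, u.d1 x ^ 2) :
    ∃ v : H2R, 0 < (∫ x, c x * v.f x ^ 2) - b * ∫ x, v.d1 x ^ 2 := by
  let F : Hsob 1 → ℝ := fun w => ⟪mulL c hc (Hsob.coord 1 0 w), Hsob.coord 1 0 w⟫_ℝ
    - b * ⟪Hsob.coord 1 1 w, Hsob.coord 1 1 w⟫_ℝ
  have hF : Continuous F := by fun_prop
  have hFu : 0 < F u.toHsob := by
    convert h using 1
    simp only [F, H1R.coord_toHsob_zero, H1R.coord_toHsob_one, inner_toLp, inner_mulL]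
    have e : (∫ x, c x * (u.memLp_f.toLp u.f : L2R) x * (u.memLp_f.toLp u.f : L2R) x)
        = ∫ x, c x * u.f x ^ 2 := by
      refine integral_congr_ae ?_
      filter_upwards [u.memLp_f.coeFn_toLp] with x hx
      rw [hx]
      ring
    rw [e]
    simp_rw [sq]
  -- Positivity of the form is an open condition in `H¹`, so it meets the dense subspace `H²`.
  obtain ⟨w, hw, v, rfl⟩ := Hsob.dense_range_incl.inter_open_nonempty _
    (isOpen_lt continuous_const hF) ⟨_, hFu⟩
  refine ⟨Hsob.toH2R v, ?_⟩
  have hw' : 0 < F (Hsob.incl v) := hw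
  convert hw' using 1
  simp only [F]
  rw [inner_mulL, inner_L2R]
  simp_rw [sq, ← mul_assoc]
  rfl

/-! ### Point evaluation and compactness -/

lemma memLp_indicator_Ioc {φ : ℝ → ℝ} (hφ : Continuous φ) (a b : ℝ) :
    MemLp ((Set.Ioc a b).indicator φ) 2 volume := by
  rw [memLp_indicator_iff_restrict measurableSet_Ioc]
  obtain ⟨C, hC⟩ := (isCompact_Icc (a := a) (b := b)).exists_bound_of_continuousOn hφ.continuousOn
  refine MemLp.of_bound hφ.aestronglyMeasurable C ?_
  filter_upwards [ae_restrict_mem measurableSet_Ioc] with x hx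
  exact hC x ⟨hx.1.le, hx.2⟩

lemma inner_indicator_Ioc {φ : ℝ → ℝ} (hφ : Continuous φ) {a b : ℝ} (hab : a ≤ b) (g : L2R) :
    ⟪(memLp_indicator_Ioc hφ a b).toLp _, g⟫_ℝ = ∫ x in a..b, φ x * g x := by
  rw [inner_toLp_left, intervalIntegral.integral_of_le hab, ← integral_indicator measurableSet_Ioc]
  refine integral_congr_ae (Eventually.of_forall fun x => ?_)
  by_cases hx : x ∈ Set.Ioc a b <;> simp [hx]

/-- The representer of point evaluation at `x` on `H²(ℝ)`. -/
def evalVec (x : ℝ) : Hsob 2 :=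
  (Hsob.coord 2 0).adjoint ((memLp_indicator_Ioc (φ := fun _ => 1) (by fun_prop) x (x + 1)).toLp _)
    + (Hsob.coord 2 1).adjoint
      ((memLp_indicator_Ioc (φ := fun y => y - (1 + x)) (by fun_prop) x (x + 1)).toLp _)

/-- Integrating by parts against the weight `y - (1 + x)`, which is `-1` at `x` and `0` at `x + 1`,
gives `v(x) = ∫_x^{x+1} (v + (y - (1 + x)) v')`. The constant `c` depends on `v` only, so one
continuous representative serves all `x`. -/
lemma inner_evalVec (v : Hsob 2) :
    ∃ c : ℝ, Hsob.coord 2 0 v =ᵐ[volume] prim c (Hsob.coord 2 1 v) ∧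
      ∀ x, ⟪evalVec x, v⟫_ℝ = prim c (Hsob.coord 2 1 v) x := by
  obtain ⟨c, hc⟩ := (Hsob.toH2R v).toH1R.exists_ae_eq_prim
  refine ⟨c, hc, fun x => ?_⟩
  rw [evalVec, inner_add_left, ContinuousLinearMap.adjoint_inner_left,
    ContinuousLinearMap.adjoint_inner_left, inner_indicator_Ioc (by fun_prop) (by linarith),
    inner_indicator_Ioc (by fun_prop) (by linarith)]
  have hloc := (Hsob.toH2R v).toH1R.locInt_d1
  have h := integral_prim_mul_prim hloc (g := fun _ => 1) (locallyIntegrable_const _)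
    c (-(1 + x)) x (x + 1)
  have e : ∀ y, prim (-(1 + x)) (fun _ => 1) y = y - (1 + x) := by
    intro y
    simp [prim]
    ring
  simp only [e] at h
  rw [← intervalIntegral.integral_add]
  · have h2 : (∫ y in x..(x + 1), 1 * (Hsob.coord 2 0 v) y + (y - (1 + x)) * (Hsob.coord 2 1 v) y)
        = ∫ y in x..(x + 1), (Hsob.toH2R v).d1 y * (y - (1 + x)) + prim c (Hsob.toH2R v).d1 y * 1 := by
      refine intervalIntegral.integral_congr_ae ?_
      filter_upwards [hc] with y hy _
      have hy' : (Hsob.coord 2 0 v) y = prim c (Hsob.toH2R v).d1 y := hy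
      rw [hy']
      simp only [Hsob.toH2R]
      ring
    rw [h2, h]
    simp only [Hsob.toH2R]
    ring
  · simp only [one_mul]
    exact LocallyIntegrable.intervalIntegrable_of (Hsob.toH2R v).toH1R.locInt_f x (x + 1)
  · exact (LocallyIntegrable.intervalIntegrable_of hloc x (x + 1)).continuousOn_mul
      (by fun_prop)

lemma Hsob.norm_coord_le {n : ℕ} (i : Fin (n + 1)) (v : Hsob n) : ‖Hsob.coord n i v‖ ≤ ‖v‖ :=
  PiLp.norm_apply_le v.1 i

/-- For `w` the difference of the two evaluation vectors, `‖w‖² = w(y) - w(x) = ∫_x^y w'`, and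
Cauchy-Schwarz bounds this by `√(y - x) ‖w‖`. This is the Hölder-1/2 embedding read on the
representers, and it gives their norm continuity. -/
lemma norm_evalVec_sub_le {x y : ℝ} (hxy : x ≤ y) : ‖evalVec y - evalVec x‖ ≤ √(y - x) := by
  set w := evalVec y - evalVec x with hw
  obtain ⟨c, -, hc⟩ := inner_evalVec w
  have hloc : LocallyIntegrable (Hsob.coord 2 1 w) := (Hsob.toH2R w).toH1R.locInt_d1
  have h1 : ‖w‖ ^ 2 = ⟪(memLp_indicator_Ioc (φ := fun _ => 1) (by fun_prop) x y).toLp _,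
      Hsob.coord 2 1 w⟫_ℝ := by
    rw [← real_inner_self_eq_norm_sq]
    nth_rw 1 [hw]
    rw [inner_sub_left, hc, hc, prim_sub_prim hloc, inner_indicator_Ioc (by fun_prop) hxy]
    simp
  have h2 : ‖(memLp_indicator_Ioc (φ := fun _ => 1) (by fun_prop) x y).toLp _‖ = √(y - x) := by
    rw [← Real.sqrt_sq (norm_nonneg _), ← real_inner_self_eq_norm_sq, inner_indicator_Ioc (by fun_prop) hxy]
    congr 1
    have : ∫ t in x..y, (1 : ℝ) *
        ((memLp_indicator_Ioc (φ := fun _ => 1) (by fun_prop) x y).toLp _ : L2R) t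
        = ∫ t in x..y, (1 : ℝ) := by
      refine intervalIntegral.integral_congr_ae ?_
      filter_upwards [(memLp_indicator_Ioc (φ := fun _ => (1 : ℝ))
        (by fun_prop) x y).coeFn_toLp] with t ht htm
      rw [Set.uIoc_of_le hxy] at htm
      rw [ht]
      simp [htm]
    rw [this]
    simp
  have h3 := real_inner_le_norm
    ((memLp_indicator_Ioc (φ := fun _ => 1) (by fun_prop) x y).toLp _) (Hsob.coord 2 1 w)
  rw [← h1, h2] at h3
  have h4 := Hsob.norm_coord_le 1 w
  rcases (norm_nonneg w).eq_or_lt with h0 | h0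
  · rw [← h0]
    positivity
  · have : ‖w‖ * ‖w‖ ≤ √(y - x) * ‖w‖ := by
      calc ‖w‖ * ‖w‖ = ‖w‖ ^ 2 := (sq _).symm
        _ ≤ _ := h3
        _ ≤ _ := by gcongr
    exact le_of_mul_le_mul_right this h0

lemma continuous_evalVec : Continuous evalVec := by
  rw [continuous_iff_continuousAt]
  intro x
  rw [ContinuousAt, tendsto_iff_norm_sub_tendsto_zero]
  have h : Tendsto (fun y => √|y - x|) (𝓝 x) (𝓝 0) := by
    have : Continuous fun y => √|y - x| := by fun_prop
    simpa using this.tendsto x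
  refine squeeze_zero (fun _ => norm_nonneg _) (fun y => ?_) h
  rcases le_total x y with hxy | hxy
  · rw [abs_of_nonneg (by linarith)]
    exact norm_evalVec_sub_le hxy
  · rw [abs_of_nonpos (by linarith), neg_sub, norm_sub_rev]
    exact norm_evalVec_sub_le hxy

lemma isCompactOperator_rankOne {H : Type*} [NormedAddCommGroup H] [InnerProductSpace ℝ H]
    (v w : H) : IsCompactOperator (InnerProductSpace.rankOne ℝ v w) := by
  rw [InnerProductSpace.rankOne_def']
  exact (isCompactOperator_of_locallyCompactSpace_dom (innerSL ℝ w)).clm_comp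
    (ContinuousLinearMap.toSpanSingleton ℝ v)

/-- A closed subspace is a Banach space in its own right; integrating there and including the result
gives the same vector. -/
lemma integral_mem_of_isClosed {E : Type*} [NormedAddCommGroup E] [NormedSpace ℝ E]
    [CompleteSpace E] {S : Submodule ℝ E} (hS : IsClosed (S : Set E)) {T : ℝ → E}
    (hT : ∀ x, T x ∈ S) (hc : Continuous T) (hs : HasCompactSupport T) : ∫ x, T x ∈ S := by
  have : CompleteSpace S := hS.completeSpace_coe
  let T' : ℝ → S := fun x => ⟨T x, hT x⟩
  have hc' : Continuous T' := hc.subtype_mk _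
  have hs' : HasCompactSupport T' := hs.mono fun x hx h0 => hx (Subtype.ext h0)
  have h := S.subtypeL.integral_comp_comm (hc'.integrable_of_hasCompactSupport (μ := volume) hs')
  have h2 : ∫ x, T x = S.subtypeL (∫ x, T' x) := h
  rw [h2]
  exact (∫ x, T' x).2

lemma isCompactOperator_integral {H : Type*} [NormedAddCommGroup H] [NormedSpace ℝ H]
    [CompleteSpace H] {T : ℝ → H →L[ℝ] H} (hT : ∀ x, IsCompactOperator (T x))
    (hc : Continuous T) (hs : HasCompactSupport T) :
    IsCompactOperator ((∫ x, T x : H →L[ℝ] H)) :=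
  integral_mem_of_isClosed (S := compactOperator (RingHom.id ℝ) H H)
    isClosed_setOfPred_isCompactOperator hT hc hs

/-- The operator is the Bochner integral of `V(x) k(x) ⊗ k(x)`, a norm-continuous, compactly
supported family of rank-one operators; compact operators form a closed subspace. With `k` the
evaluation vectors this yields compactness of a multiplication form. -/
lemma exists_compact_integral_rankOne {H : Type*} [NormedAddCommGroup H] [InnerProductSpace ℝ H]
    [CompleteSpace H] {V : ℝ → ℝ} (hV : Continuous V) (hVc : HasCompactSupport V) {k : ℝ → H}
    (hk : Continuous k) :
    ∃ T : H →L[ℝ] H, IsCompactOperator T ∧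
      ∀ v w, ⟪T v, w⟫_ℝ = ∫ x, V x * (⟪k x, v⟫_ℝ * ⟪k x, w⟫_ℝ) := by
  let T : ℝ → H →L[ℝ] H := fun x => V x • InnerProductSpace.rankOne ℝ (k x) (k x)
  have hcont : Continuous T := by
    refine hV.smul ?_
    exact ((InnerProductSpace.rankOne ℝ).continuous.comp hk).clm_apply hk
  have hint : Integrable T := hcont.integrable_of_hasCompactSupport (hVc.smul_right)
  refine ⟨∫ x, T x, isCompactOperator_integral
    (fun x => (isCompactOperator_rankOne _ _).smul (V x)) hcont hVc.smul_right, fun v w => ?_⟩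
  rw [ContinuousLinearMap.integral_apply hint, real_inner_comm,
    ← integral_inner (hint.apply_continuousLinearMap v) w]
  refine integral_congr_ae (Eventually.of_forall fun x => ?_)
  simp only [T, smul_apply, InnerProductSpace.rankOne_apply, inner_smul_right]
  rw [real_inner_comm (k x) w]

/-- Multiplication by a continuous function of compact support, as an operator on `H²(ℝ)`, is
compact. -/
lemma isCompactOperator_mulL {V : ℝ → ℝ} (hV : Continuous V) (hVc : HasCompactSupport V)
    (hV' : MemLp V ∞ volume) :
    IsCompactOperator ((Hsob.coord 2 0).adjoint ∘L mulL V hV' ∘L Hsob.coord 2 0) := by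
  obtain ⟨T, hT, h⟩ := exists_compact_integral_rankOne hV hVc continuous_evalVec
  -- Both operators have the form `∫ V v w`, since pairing with `evalVec x` is point evaluation of
  -- the continuous representatives.
  have key : (Hsob.coord 2 0).adjoint ∘L mulL V hV' ∘L Hsob.coord 2 0 = T := by
    refine ContinuousLinearMap.ext fun v => ext_inner_right ℝ fun w => ?_
    rw [h, ContinuousLinearMap.comp_apply, ContinuousLinearMap.adjoint_inner_left,
      ContinuousLinearMap.comp_apply, inner_mulL]
    obtain ⟨c, hc, hc'⟩ := inner_evalVec v
    obtain ⟨d, hd, hd'⟩ := inner_evalVec w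
    refine integral_congr_ae ?_
    filter_upwards [hc, hd] with x h1 h2
    rw [hc', hd', h1, h2, mul_assoc]
  rw [key]
  exact hT

/-! ### A positive form with a non-coercive compact perturbation has a kernel -/

section kernel

variable {H : Type*} [NormedAddCommGroup H] [InnerProductSpace ℝ H]

/-- Evaluating the nonnegative form at `v - N⁻¹ Q v`, one gradient step, gives the bound. The `+ 1`
keeps `N` positive when `Q = 0`. -/
lemma norm_sq_le_of_nonneg {Q : H →L[ℝ] H} (hsymm : ∀ v w, ⟪Q v, w⟫_ℝ = ⟪v, Q w⟫_ℝ)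
    (hpos : ∀ v, 0 ≤ ⟪Q v, v⟫_ℝ) (v : H) : ‖Q v‖ ^ 2 ≤ (‖Q‖ + 1) * ⟪Q v, v⟫_ℝ := by
  set N := ‖Q‖ + 1 with hN
  have hN0 : 0 < N := by positivity
  have h1 := hpos (v - N⁻¹ • Q v)
  have h2 : ⟪Q (Q v), Q v⟫_ℝ ≤ N * ‖Q v‖ ^ 2 := by
    calc ⟪Q (Q v), Q v⟫_ℝ ≤ ‖Q (Q v)‖ * ‖Q v‖ := real_inner_le_norm _ _
      _ ≤ (‖Q‖ * ‖Q v‖) * ‖Q v‖ := by gcongr; exact Q.le_opNorm _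
      _ ≤ N * ‖Q v‖ ^ 2 := by nlinarith [sq_nonneg ‖Q v‖]
  have h3 : ⟪Q (v - N⁻¹ • Q v), v - N⁻¹ • Q v⟫_ℝ
      = ⟪Q v, v⟫_ℝ - 2 * N⁻¹ * ‖Q v‖ ^ 2 + N⁻¹ ^ 2 * ⟪Q (Q v), Q v⟫_ℝ := by
    rw [map_sub, map_smul, inner_sub_left, inner_sub_right, inner_sub_right, inner_smul_left,
      inner_smul_left, inner_smul_right, inner_smul_right, hsymm (Q v) v,
      real_inner_self_eq_norm_sq]
    simp only [conj_trivial]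
    ring
  have h4 : N⁻¹ ^ 2 * ⟪Q (Q v), Q v⟫_ℝ ≤ N⁻¹ * ‖Q v‖ ^ 2 := by
    calc N⁻¹ ^ 2 * ⟪Q (Q v), Q v⟫_ℝ ≤ N⁻¹ ^ 2 * (N * ‖Q v‖ ^ 2) := by gcongr
      _ = N⁻¹ * ‖Q v‖ ^ 2 := by field_simp
  have h5 : N⁻¹ * ‖Q v‖ ^ 2 ≤ ⟪Q v, v⟫_ℝ := by linarith
  calc ‖Q v‖ ^ 2 = N * (N⁻¹ * ‖Q v‖ ^ 2) := by field_simp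
    _ ≤ _ := by gcongr

/-- By Lax-Milgram `A` is invertible, and a kernel vector of `A - K` is an eigenvector of the
compact operator `A⁻¹ K` for the eigenvalue `1`. If `1` is not an eigenvalue, `A⁻¹ K - 1` is bounded
below, so `‖v‖ ≤ B ‖Q v‖` for `Q = A - K`. Together with `norm_sq_le_of_nonneg` this makes the form
of `Q` coercive, contrary to `hinf`. -/
lemma exists_ker_of_not_coercive [CompleteSpace H] {A K : H →L[ℝ] H} (hK : IsCompactOperator K)
    {c : ℝ} (hc : 0 < c) (hA : ∀ v, c * ‖v‖ ^ 2 ≤ ⟪A v, v⟫_ℝ)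
    (hsymm : ∀ v w, ⟪(A - K) v, w⟫_ℝ = ⟪v, (A - K) w⟫_ℝ) (hpos : ∀ v, 0 ≤ ⟪(A - K) v, v⟫_ℝ)
    (hinf : ∀ ε > 0, ∃ v, ⟪(A - K) v, v⟫_ℝ < ε * ‖v‖ ^ 2) : ∃ v ≠ 0, A v = K v := by
  have hco : IsCoercive (innerSL ℝ ∘L A) := ⟨c, hc, fun v => by
    rw [mul_assoc, ← sq]
    exact hA v⟩
  let e := hco.continuousLinearEquivOfBilin
  have he : ∀ v, e v = A v := fun v => ext_inner_right ℝ fun w => by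
    rw [hco.continuousLinearEquivOfBilin_apply]
    rfl
  let T : H →L[ℝ] H := (e.symm : H →L[ℝ] H) ∘L K
  have hT : IsCompactOperator T := hK.clm_comp (e.symm : H →L[ℝ] H)
  by_cases hev : Module.End.HasEigenvalue (T : Module.End ℝ H) 1
  · obtain ⟨v, hv⟩ := hev.exists_hasEigenvector
    refine ⟨v, hv.2, ?_⟩
    have h1 : T v = v := by simpa using hv.apply_eq_smul
    rw [← he]
    nth_rw 1 [← h1]
    simp [T]
  · exfalso
    obtain ⟨C, hC⟩ := hT.antilipschitz_of_not_hasEigenvalue one_ne_zero hev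
    set Q := A - K with hQ
    have h1 : ∀ v, ‖v‖ ≤ C * ‖(e.symm : H →L[ℝ] H)‖ * ‖Q v‖ := by
      intro v
      have h2 := hC.le_mul_dist v 0
      rw [map_zero, dist_zero_right, dist_zero_right] at h2
      have h3 : (T - (1 : ℝ) • 1) v = -(e.symm : H →L[ℝ] H) (Q v) := by
        have : (e.symm : H →L[ℝ] H) (A v) = v := by rw [← he]; simp
        simp only [hQ, sub_apply, map_sub, this, T, ContinuousLinearMap.comp_apply]
        simp
      rw [h3, norm_neg] at h2
      calc ‖v‖ ≤ C * ‖(e.symm : H →L[ℝ] H) (Q v)‖ := h2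
        _ ≤ C * (‖(e.symm : H →L[ℝ] H)‖ * ‖Q v‖) := by
          gcongr
          exact ContinuousLinearMap.le_opNorm _ _
        _ = _ := by ring
    set B := C * ‖(e.symm : H →L[ℝ] H)‖ with hB
    have hB0 : 0 ≤ B := by positivity
    have hD : 0 < B ^ 2 * (‖Q‖ + 1) + 1 := by positivity
    -- This `ε` is just below the coercivity constant of `Q` that the two bounds would imply; the `+
    -- 1` covers `B = 0`.
    obtain ⟨v, hv⟩ := hinf (B ^ 2 * (‖Q‖ + 1) + 1)⁻¹ (by positivity)
    have h4 : ‖v‖ ^ 2 ≤ B ^ 2 * ((‖Q‖ + 1) * ⟪Q v, v⟫_ℝ) := by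
      calc ‖v‖ ^ 2 ≤ (B * ‖Q v‖) ^ 2 := by gcongr; exact h1 v
        _ = B ^ 2 * ‖Q v‖ ^ 2 := by ring
        _ ≤ _ := by gcongr; exact norm_sq_le_of_nonneg hsymm hpos v
    rw [inv_mul_eq_div, lt_div_iff₀ hD] at hv
    nlinarith [hpos v]

end kernel

/-! ### Smooth functions with square integrable, or bounded, derivatives -/

/-- `y` is `n` times differentiable with continuous square integrable derivatives. -/
def Sob : ℕ → (ℝ → ℝ) → Prop
  | 0, y => Continuous y ∧ MemLp y 2 volume
  | n + 1, y => Differentiable ℝ y ∧ MemLp y 2 volume ∧ Sob n (deriv y)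

/-- `c` is `n` times differentiable with continuous bounded derivatives. -/
def Bdd : ℕ → (ℝ → ℝ) → Prop
  | 0, c => Continuous c ∧ ∃ C, ∀ x, |c x| ≤ C
  | n + 1, c => Differentiable ℝ c ∧ (∃ C, ∀ x, |c x| ≤ C) ∧ Bdd n (deriv c)

/-- `y` is smooth with square integrable derivatives. -/
def SobSmooth (y : ℝ → ℝ) : Prop := ∀ n, Sob n y

/-- `c` is smooth with bounded derivatives. -/
def BddSmooth (c : ℝ → ℝ) : Prop := ∀ n, Bdd n c

section

variable {n : ℕ} {y z c : ℝ → ℝ}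

lemma Bdd.continuous (h : Bdd n c) : Continuous c := by
  cases n with
  | zero => exact h.1
  | succ n => exact h.1.continuous

lemma Bdd.bound (h : Bdd n c) : ∃ C, ∀ x, |c x| ≤ C := by
  cases n with
  | zero => exact h.2
  | succ n => exact h.2.1

lemma Sob.of_succ (h : Sob (n + 1) y) : Sob n y := by
  induction n generalizing y with
  | zero => exact ⟨h.1.continuous, h.2.1⟩
  | succ n ih => exact ⟨h.1, h.2.1, ih h.2.2⟩

lemma Bdd.of_succ (h : Bdd (n + 1) c) : Bdd n c := by
  induction n generalizing c with
  | zero => exact ⟨h.1.continuous, h.2.1⟩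
  | succ n ih => exact ⟨h.1, h.2.1, ih h.2.2⟩

lemma Sob.add (hy : Sob n y) (hz : Sob n z) : Sob n (fun x => y x + z x) := by
  induction n generalizing y z with
  | zero => exact ⟨hy.1.add hz.1, hy.2.add hz.2⟩
  | succ n ih =>
    refine ⟨hy.1.add hz.1, hy.2.1.add hz.2.1, ?_⟩
    have : deriv (fun x => y x + z x) = fun x => deriv y x + deriv z x :=
      funext fun x => deriv_fun_add (hy.1 x) (hz.1 x)
    rw [this]
    exact ih hy.2.2 hz.2.2

lemma Bdd.add {d : ℝ → ℝ} (hy : Bdd n c) (hz : Bdd n d) : Bdd n (fun x => c x + d x) := by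
  have hb : ∃ C, ∀ x, |c x + d x| ≤ C := by
    obtain ⟨C, hC⟩ := hy.bound
    obtain ⟨D, hD⟩ := hz.bound
    exact ⟨C + D, fun x => (abs_add_le _ _).trans (add_le_add (hC x) (hD x))⟩
  induction n generalizing c d with
  | zero => exact ⟨hy.1.add hz.1, hb⟩
  | succ n ih =>
    refine ⟨hy.1.add hz.1, hb, ?_⟩
    have : deriv (fun x => c x + d x) = fun x => deriv c x + deriv d x :=
      funext fun x => deriv_fun_add (hy.1 x) (hz.1 x)
    rw [this]
    refine ih hy.2.2 hz.2.2 ?_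
    obtain ⟨C, hC⟩ := hy.2.2.bound
    obtain ⟨D, hD⟩ := hz.2.2.bound
    exact ⟨C + D, fun x => (abs_add_le _ _).trans (add_le_add (hC x) (hD x))⟩

lemma memLp_two_mul_of_bound (hc : Continuous c) (hb : ∃ C, ∀ x, |c x| ≤ C)
    (hy : MemLp y 2 volume) : MemLp (fun x => c x * y x) 2 volume := by
  obtain ⟨C, hC⟩ := hb
  refine MemLp.of_le_mul hy (hc.aestronglyMeasurable.mul hy.1) (c := C)
    (Eventually.of_forall fun x => ?_)
  rw [norm_mul]
  gcongr
  exact hC x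

/-- Leibniz rule and induction, the bounded factor absorbing each derivative. -/
lemma Sob.mul (hc : Bdd n c) (hy : Sob n y) : Sob n (fun x => c x * y x) := by
  induction n generalizing c y with
  | zero => exact ⟨hc.1.mul hy.1, memLp_two_mul_of_bound hc.1 hc.2 hy.2⟩
  | succ n ih =>
    refine ⟨hc.1.mul hy.1, memLp_two_mul_of_bound hc.1.continuous hc.2.1 hy.2.1, ?_⟩
    have : deriv (fun x => c x * y x) = fun x => deriv c x * y x + c x * deriv y x :=
      funext fun x => deriv_fun_mul (hc.1 x) (hy.1 x)
    rw [this]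
    exact (ih hc.2.2 hy.of_succ).add (ih hc.of_succ hy.2.2)

lemma Bdd.const (a : ℝ) : Bdd n (fun _ => a) := by
  induction n generalizing a with
  | zero => exact ⟨continuous_const, |a|, fun _ => le_rfl⟩
  | succ n ih =>
    refine ⟨differentiable_const _, ⟨|a|, fun _ => le_rfl⟩, ?_⟩
    rw [deriv_const']
    exact ih 0

lemma Bdd.const_mul (a : ℝ) (hc : Bdd n c) : Bdd n (fun x => a * c x) := by
  have hb : ∀ {d : ℝ → ℝ}, (∃ C, ∀ x, |d x| ≤ C) → ∃ C, ∀ x, |a * d x| ≤ C := by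
    rintro d ⟨C, hC⟩
    exact ⟨|a| * C, fun x => by rw [abs_mul]; exact mul_le_mul_of_nonneg_left (hC x) (abs_nonneg _)⟩
  induction n generalizing c with
  | zero => exact ⟨hc.1.const_mul a, hb hc.2⟩
  | succ n ih =>
    refine ⟨hc.1.const_mul a, hb hc.2.1, ?_⟩
    have : deriv (fun x => a * c x) = fun x => a * deriv c x :=
      funext fun x => deriv_const_mul a (hc.1 x)
    rw [this]
    exact ih hc.2.2

lemma Sob.contDiff (h : Sob n y) : ContDiff ℝ n y := by
  induction n generalizing y with
  | zero => exact_mod_cast contDiff_zero.2 h.1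
  | succ n ih =>
    push_cast
    rw [contDiff_succ_iff_deriv]
    exact ⟨h.1, by simp, ih h.2.2⟩

lemma Bdd.contDiff (h : Bdd n y) : ContDiff ℝ n y := by
  induction n generalizing y with
  | zero => exact_mod_cast contDiff_zero.2 h.1
  | succ n ih =>
    push_cast
    rw [contDiff_succ_iff_deriv]
    exact ⟨h.1, by simp, ih h.2.2⟩

lemma SobSmooth.contDiff (h : SobSmooth y) : ContDiff ℝ ∞ y :=
  contDiff_infty.2 fun n => (h n).contDiff

lemma BddSmooth.contDiff (h : BddSmooth y) : ContDiff ℝ ∞ y :=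
  contDiff_infty.2 fun n => (h n).contDiff

lemma SobSmooth.deriv (h : SobSmooth y) : SobSmooth (deriv y) := fun n => (h (n + 1)).2.2
lemma BddSmooth.deriv (h : BddSmooth y) : BddSmooth (deriv y) := fun n => (h (n + 1)).2.2
lemma SobSmooth.memLp (h : SobSmooth y) : MemLp y 2 volume := (h 0).2
lemma SobSmooth.hasDerivAt (h : SobSmooth y) (x : ℝ) : HasDerivAt y (_root_.deriv y x) x :=
  ((h 1).1 x).hasDerivAt

lemma SobSmooth.add (hy : SobSmooth y) (hz : SobSmooth z) : SobSmooth (fun x => y x + z x) :=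
  fun n => (hy n).add (hz n)

lemma SobSmooth.mul (hc : BddSmooth c) (hy : SobSmooth y) : SobSmooth (fun x => c x * y x) :=
  fun n => (hy n).mul (hc n)

lemma SobSmooth.const_mul (a : ℝ) (hy : SobSmooth y) : SobSmooth (fun x => a * y x) :=
  SobSmooth.mul (c := fun _ => a) (fun _ => Bdd.const a) hy

lemma BddSmooth.memLp_top (h : BddSmooth c) : MemLp c ∞ volume := by
  obtain ⟨C, hC⟩ := (h 0).bound
  exact memLp_top_of_bound (h 0).continuous.aestronglyMeasurable C (Eventually.of_forall hC)

lemma bddSmooth_of_hasCompactSupport (h : ContDiff ℝ ∞ c) (hs : HasCompactSupport c) :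
    BddSmooth c := by
  intro n
  have hb : ∀ {d : ℝ → ℝ}, Continuous d → HasCompactSupport d → ∃ C, ∀ x, |d x| ≤ C :=
    fun hd hds => hds.exists_bound_of_continuous hd
  induction n generalizing c with
  | zero => exact ⟨h.continuous, hb h.continuous hs⟩
  | succ n ih =>
    exact ⟨h.differentiable (by simp), hb h.continuous hs,
      ih (contDiff_infty_iff_deriv.1 h).2 hs.deriv⟩

lemma bddSmooth_of_deriv (h : ContDiff ℝ ∞ c) (hb : ∃ C, ∀ x, |c x| ≤ C)
    (hs : HasCompactSupport (deriv c)) : BddSmooth c := by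
  intro n
  cases n with
  | zero => exact ⟨h.continuous, hb⟩
  | succ n =>
    exact ⟨h.differentiable (by simp), hb,
      bddSmooth_of_hasCompactSupport (contDiff_infty_iff_deriv.1 h).2 hs n⟩

/-- Square integrable functions with square integrable derivatives vanish at infinity. -/
lemma SobSmooth.tendsto_zero (h : SobSmooth y) : Tendsto y (cocompact ℝ) (𝓝 0) := by
  have hd : ∀ x, HasDerivAt (fun x => y x * y x) (_root_.deriv y x * y x + y x * _root_.deriv y x) x :=
    fun x => (h.hasDerivAt x).mul (h.hasDerivAt x)
  have i0 := integrable_mul_of_memLp_two h.memLp h.memLp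
  have i1 := (integrable_mul_of_memLp_two h.deriv.memLp h.memLp).add
    (integrable_mul_of_memLp_two h.memLp h.deriv.memLp)
  -- Both `y²` and its derivative `2 y y'` are integrable, so `y²` tends to zero at each end.
  have htop := tendsto_zero_of_hasDerivAt_of_integrableOn_Ioi (a := 0) (fun x _ => hd x)
    i1.integrableOn i0.integrableOn
  have hbot := tendsto_zero_of_hasDerivAt_of_integrableOn_Iic (a := 0) (fun x _ => hd x)
    i1.integrableOn i0.integrableOn
  have hsq : Tendsto (fun x => y x * y x) (cocompact ℝ) (𝓝 0) := by
    rw [cocompact_eq_atBot_atTop]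
    exact hbot.sup htop
  have := hsq.sqrt
  simp only [Real.sqrt_mul_self_eq_abs, Real.sqrt_zero] at this
  exact (tendsto_zero_iff_abs_tendsto_zero _).2 this

end

/-- A linear fourth-order system with smooth bounded coefficients has smooth solutions. -/
lemma sobSmooth_of_system {y₀ y₁ y₂ y₃ a b c : ℝ → ℝ} (ha : BddSmooth a) (hb : BddSmooth b)
    (hc : BddSmooth c) (h₀ : ∀ x, HasDerivAt y₀ (y₁ x) x) (h₁ : ∀ x, HasDerivAt y₁ (y₂ x) x)
    (h₂ : ∀ x, HasDerivAt y₂ (y₃ x) x)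
    (h₃ : ∀ x, HasDerivAt y₃ (a x * y₂ x + b x * y₁ x + c x * y₀ x) x)
    (m₀ : MemLp y₀ 2 volume) (m₁ : MemLp y₁ 2 volume) (m₂ : MemLp y₂ 2 volume)
    (m₃ : MemLp y₃ 2 volume) : SobSmooth y₀ := by
  have d₀ : deriv y₀ = y₁ := funext fun x => (h₀ x).deriv
  have d₁ : deriv y₁ = y₂ := funext fun x => (h₁ x).deriv
  have d₂ : deriv y₂ = y₃ := funext fun x => (h₂ x).deriv
  have d₃ : deriv y₃ = fun x => a x * y₂ x + b x * y₁ x + c x * y₀ x :=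
    funext fun x => (h₃ x).deriv
  have f₀ : Differentiable ℝ y₀ := fun x => (h₀ x).differentiableAt
  have f₁ : Differentiable ℝ y₁ := fun x => (h₁ x).differentiableAt
  have f₂ : Differentiable ℝ y₂ := fun x => (h₂ x).differentiableAt
  have f₃ : Differentiable ℝ y₃ := fun x => (h₃ x).differentiableAt
  -- The four functions are treated together: the derivative of each is one of the others or a
  -- bounded combination of them, so each round gains one order for all.
  have key : ∀ n, Sob n y₀ ∧ Sob n y₁ ∧ Sob n y₂ ∧ Sob n y₃ := by
    intro n
    induction n with
    | zero => exact ⟨⟨f₀.continuous, m₀⟩, ⟨f₁.continuous, m₁⟩, ⟨f₂.continuous, m₂⟩,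
        ⟨f₃.continuous, m₃⟩⟩
    | succ n ih =>
      obtain ⟨i₀, i₁, i₂, i₃⟩ := ih
      refine ⟨⟨f₀, m₀, d₀ ▸ i₁⟩, ⟨f₁, m₁, d₁ ▸ i₂⟩, ⟨f₂, m₂, d₂ ▸ i₃⟩, ⟨f₃, m₃, ?_⟩⟩
      rw [d₃]
      exact ((i₂.mul (ha n)).add (i₁.mul (hb n))).add (i₀.mul (hc n))
  exact fun n => (key n).1

/-! ### Regularity of weak solutions -/

lemma prim_congr_ae {g h : ℝ → ℝ} (hgh : g =ᵐ[volume] h) (c : ℝ) : prim c g = prim c h := by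
  funext x
  rw [prim, prim, intervalIntegral.integral_congr_ae (hgh.mono fun _ hx _ => hx)]

/-- The product of a smooth bounded function and an element of `H¹(ℝ)`. -/
def H1R.mulBdd (u : H1R) (c : ℝ → ℝ) (hc : BddSmooth c) : H1R where
  f x := c x * u.f x
  d1 x := deriv c x * u.f x + c x * u.d1 x
  memLp_f := memLp_two_mul_of_bound (hc 0).1 (hc 0).2 u.memLp_f
  memLp_d1 := (memLp_two_mul_of_bound (hc.deriv 0).1 (hc.deriv 0).2 u.memLp_f).add
    (memLp_two_mul_of_bound (hc 0).1 (hc 0).2 u.memLp_d1)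
  weak_d1 := by
    intro η hη hηc
    have hs : HasCompactSupport fun x => c x * η x := hηc.mul_left
    have hs' : HasCompactSupport fun x => deriv c x * η x := hηc.mul_left
    have hcη : ContDiff ℝ ∞ fun x => c x * η x := hc.contDiff.mul hη
    have h := u.weak_d1 _ hcη hs
    have e : deriv (fun x => c x * η x) = fun x => deriv c x * η x + c x * deriv η x :=
      funext fun x => deriv_fun_mul ((hc 1).1 x) ((hη.differentiable (by simp)) x)
    rw [e] at h
    have i1 : Integrable fun x => u.f x * (deriv c x * η x) := integrable_mul_testFunction u.locInt_f
      ((hc.deriv 0).continuous.mul hη.continuous) hs'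
    have i2 : Integrable fun x => u.f x * (c x * deriv η x) := integrable_mul_testFunction u.locInt_f
      ((hc 0).continuous.mul (hη.continuous_deriv (by simp))) (hηc.deriv.mul_left)
    have i3 := integrable_mul_testFunction u.locInt_d1 hcη.continuous hs
    simp_rw [mul_add] at h
    rw [integral_add i1 i2] at h
    have e1 : ∀ x, c x * u.f x * deriv η x = u.f x * (c x * deriv η x) := fun x => by ring
    have e2 : ∀ x, (deriv c x * u.f x + c x * u.d1 x) * η x
        = u.f x * (deriv c x * η x) + u.d1 x * (c x * η x) := fun x => by ring
    simp_rw [e1, e2]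
    rw [integral_add i1 i3]
    linarith

/-- The derivative of an element of `H²(ℝ)`. -/
def H2R.derivH1 (u : H2R) : H1R where
  f := u.d1
  d1 := u.d2
  memLp_f := u.memLp_d1
  memLp_d1 := u.memLp_d2
  weak_d1 := u.weak_d2

lemma H2R.integral_mul_d2_comm (u v : H2R) : ∫ x, u.f x * v.d2 x = ∫ x, u.d2 x * v.f x := by
  have h1 := u.toH1R.integral_mul_d1 v.derivH1
  have h2 := v.toH1R.integral_mul_d1 u.derivH1
  simp only [H2R.derivH1] at h1 h2
  simp only [mul_comm (u.d2 _)]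
  rw [h1, h2]
  simp only [mul_comm]

/-- If `u ∈ L²` satisfies `∫ u φ'' = ∫ F φ` for all `φ ∈ H²`, then `u ∈ H²` and `u'' = F`. -/
lemma exists_H2R_of_weak_second {u F : ℝ → ℝ} (hu : MemLp u 2 volume) (hF : MemLp F 2 volume)
    (h : ∀ φ : H2R, ∫ x, u x * φ.d2 x = ∫ x, F x * φ.f x) :
    ∃ v : H2R, u =ᵐ[volume] v.f ∧ v.d2 =ᵐ[volume] F := by
  obtain ⟨v, hv⟩ := exists_H2R_sub_d2_eq (hu.sub hF)
  -- Transposition: `v` solves `v - v'' = u - F`, and the test element `φ` solves `φ - φ'' = u - v`.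
  -- Moving `1 - ∂²` from `φ` onto `u` and `v` gives `‖u - v‖² = ⟪(u - F) - (v - v''), φ⟫ = 0`.
  obtain ⟨φ, hφ⟩ := exists_H2R_sub_d2_eq (hu.sub v.memLp_f)
  let U := hu.toLp u
  let G := hF.toLp F
  let V0 := v.memLp_f.toLp v.f
  let V2 := v.memLp_d2.toLp v.d2
  let P0 := φ.memLp_f.toLp φ.f
  let P2 := φ.memLp_d2.toLp φ.d2
  have h1 : ⟪U, P2⟫_ℝ = ⟪G, P0⟫_ℝ := by simpa only [U, G, P0, P2, inner_toLp] using h φ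
  have h2 : ⟪V0, P2⟫_ℝ = ⟪V2, P0⟫_ℝ := by
    simpa only [V0, V2, P0, P2, inner_toLp] using v.integral_mul_d2_comm φ
  have h3 : V2 = V0 - (U - G) := by
    simp only [V2, V0, U, G, ← MemLp.toLp_sub]
    exact MemLp.toLp_congr _ _ hv
  have h4 : P2 = P0 - (U - V0) := by
    simp only [P2, V0, U, P0, ← MemLp.toLp_sub]
    exact MemLp.toLp_congr _ _ hφ
  have h5 : U - V0 = P0 - P2 := by rw [h4]; abel
  have h6 : ⟪U - V0, U - V0⟫_ℝ = 0 := by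
    nth_rw 2 [h5]
    rw [inner_sub_left, inner_sub_right, inner_sub_right, h1, h2, h3, inner_sub_left,
      inner_sub_left]
    ring
  have h7 : U = V0 := sub_eq_zero.1 (inner_self_eq_zero.1 h6)
  have h8 : u =ᵐ[volume] v.f := (MemLp.toLp_eq_toLp_iff _ _).1 h7
  refine ⟨v, h8, ?_⟩
  filter_upwards [hv, h8] with x e1 e2
  rw [e1, Pi.sub_apply, e2]
  ring

/-- Weak solutions of `(c₂ ψ'')'' - (c₁ ψ')' + b ψ = 0` are smooth. -/
lemma exists_sobSmooth_of_weak {c₂ : ℝ} (hc₂ : 0 < c₂) {c₁ b : ℝ → ℝ} (hc₁ : BddSmooth c₁)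
    (hb : BddSmooth b) (ψ : H2R)
    (h : ∀ φ : H2R, c₂ * (∫ x, ψ.d2 x * φ.d2 x) + (∫ x, c₁ x * ψ.d1 x * φ.d1 x)
      + ∫ x, b x * ψ.f x * φ.f x = 0) :
    ∃ y, SobSmooth y ∧ ψ.f =ᵐ[volume] y ∧
      ∀ x, c₂ * deriv (deriv (deriv (deriv y))) x
        = deriv c₁ x * deriv y x + c₁ x * deriv (deriv y) x - b x * y x := by
  let w : H1R := ψ.derivH1.mulBdd c₁ hc₁
  have mb : MemLp (fun x => b x * ψ.f x) 2 volume :=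
    memLp_two_mul_of_bound (hb 0).1 (hb 0).2 ψ.memLp_f
  -- One integration by parts puts the weak equation in the form `∫ ψ'' φ'' = ∫ F φ`, so `ψ''` has
  -- two further weak derivatives.
  obtain ⟨v, hv1, hv2⟩ := exists_H2R_of_weak_second (F := fun x => c₂⁻¹ * (w.d1 x - b x * ψ.f x))
    ψ.memLp_d2 ((w.memLp_d1.sub mb).const_mul c₂⁻¹) (by
      intro φ
      have h1 := h φ
      have h2 := w.integral_mul_d1 φ.toH1R
      have h3 : ∫ x, c₂⁻¹ * (w.d1 x - b x * ψ.f x) * φ.f x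
          = c₂⁻¹ * ((∫ x, w.d1 x * φ.f x) - ∫ x, b x * ψ.f x * φ.f x) := by
        rw [← integral_sub (integrable_mul_of_memLp_two w.memLp_d1 φ.memLp_f)
          (integrable_mul_of_memLp_two mb φ.memLp_f), ← integral_const_mul]
        exact integral_congr_ae (Eventually.of_forall fun x => by ring)
      have h4 : ∫ x, c₁ x * ψ.d1 x * φ.d1 x = ∫ x, w.f x * φ.d1 x := rfl
      rw [h4] at h1
      rw [h3, eq_inv_mul_iff_mul_eq₀ hc₂.ne']
      linarith)
  obtain ⟨k3, hk3⟩ := v.derivH1.exists_ae_eq_prim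
  obtain ⟨k2, hk2⟩ := v.toH1R.exists_ae_eq_prim
  obtain ⟨k1, hk1⟩ := ψ.derivH1.exists_ae_eq_prim
  obtain ⟨k0, hk0⟩ := ψ.toH1R.exists_ae_eq_prim
  -- Continuous representatives are chosen from the third derivative downwards, so that each is an
  -- exact primitive of the previous one and all derivatives become classical.
  set y₃ := prim k3 v.d2 with hy₃
  have e3 : v.d1 =ᵐ[volume] y₃ := hk3
  set y₂ := prim k2 y₃ with hy₂
  have e2 : ψ.d2 =ᵐ[volume] y₂ := by
    rw [prim_congr_ae e3] at hk2
    exact hv1.trans hk2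
  set y₁ := prim k1 y₂ with hy₁
  have e1 : ψ.d1 =ᵐ[volume] y₁ := by
    have : ψ.derivH1.d1 =ᵐ[volume] y₂ := e2
    rw [prim_congr_ae this] at hk1
    exact hk1
  set y₀ := prim k0 y₁ with hy₀
  have e0 : ψ.f =ᵐ[volume] y₀ := by
    rw [prim_congr_ae e1] at hk0
    exact hk0
  have k₃ : Continuous y₃ := continuous_prim v.derivH1.locInt_d1 k3
  have k₂ : Continuous y₂ := continuous_prim k₃.locallyIntegrable k2
  have k₁ : Continuous y₁ := continuous_prim k₂.locallyIntegrable k1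
  have k₀ : Continuous y₀ := continuous_prim k₁.locallyIntegrable k0
  let a' : ℝ → ℝ := fun x => c₂⁻¹ * c₁ x
  let b' : ℝ → ℝ := fun x => c₂⁻¹ * deriv c₁ x
  let c' : ℝ → ℝ := fun x => -c₂⁻¹ * b x
  have ha' : BddSmooth a' := fun n => (hc₁ n).const_mul _
  have hb' : BddSmooth b' := fun n => (hc₁.deriv n).const_mul _
  have hc' : BddSmooth c' := fun n => (hb n).const_mul _
  have e4 : v.d2 =ᵐ[volume] fun x => a' x * y₂ x + b' x * y₁ x + c' x * y₀ x := by
    filter_upwards [hv2, e0, e1, e2] with x f1 f2 f3 f4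
    rw [f1]
    simp only [w, a', b', c', H1R.mulBdd, H2R.derivH1, f2, f3, f4]
    ring
  have kG : Continuous fun x => a' x * y₂ x + b' x * y₁ x + c' x * y₀ x :=
    (((ha' 0).continuous.mul k₂).add ((hb' 0).continuous.mul k₁)).add ((hc' 0).continuous.mul k₀)
  rw [prim_congr_ae e4] at hy₃
  have h₀ : ∀ x, HasDerivAt y₀ (y₁ x) x := hasDerivAt_prim k₁ k0
  have h₁ : ∀ x, HasDerivAt y₁ (y₂ x) x := hasDerivAt_prim k₂ k1
  have h₂ : ∀ x, HasDerivAt y₂ (y₃ x) x := hasDerivAt_prim k₃ k2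
  have h₃ : ∀ x, HasDerivAt y₃ (a' x * y₂ x + b' x * y₁ x + c' x * y₀ x) x := by
    rw [hy₃]
    exact hasDerivAt_prim kG k3
  refine ⟨y₀, sobSmooth_of_system ha' hb' hc' h₀ h₁ h₂ h₃ (ψ.memLp_f.ae_eq e0)
    (ψ.memLp_d1.ae_eq e1) (ψ.memLp_d2.ae_eq e2) (v.memLp_d1.ae_eq e3), e0, fun x => ?_⟩
  have d₀ : deriv y₀ = y₁ := funext fun x => (h₀ x).deriv
  have d₁ : deriv y₁ = y₂ := funext fun x => (h₁ x).deriv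
  have d₂ : deriv y₂ = y₃ := funext fun x => (h₂ x).deriv
  rw [d₀, d₁, d₂, (h₃ x).deriv]
  simp only [a', b', c']
  field_simp
  ring

/-! ### Kernels of quadratic forms on `H²` -/

lemma H1R.d1_ae_eq_zero (u : H1R) (h : u.f =ᵐ[volume] 0) : u.d1 =ᵐ[volume] 0 := by
  refine ae_eq_zero_of_integral_contDiff_smul_eq_zero u.locInt_d1 fun η hη hηc => ?_
  have h1 := u.weak_d1 η hη hηc
  have e1 : (fun x => u.f x * deriv η x) =ᵐ[volume] fun _ => 0 := by
    filter_upwards [h] with x hx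
    rw [hx, Pi.zero_apply, zero_mul]
  rw [integral_congr_ae e1, integral_zero] at h1
  simp only [smul_eq_mul, mul_comm (η _)]
  linarith

/-- The quadratic form `∫ c₂ ψ''² + c₁ ψ'² + c₀ ψ² - V ψ²`. -/
def quadForm (c₂ : ℝ) (c₁ c₀ V : ℝ → ℝ) (ψ : H2R) : ℝ :=
  c₂ * (∫ x, ψ.d2 x ^ 2) + (∫ x, c₁ x * ψ.d1 x ^ 2) + (∫ x, c₀ x * ψ.f x ^ 2)
    - ∫ x, V x * ψ.f x ^ 2

/-- The operator on `H²(ℝ)` of the form `∫ c vᵢ wᵢ`. -/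
def formOp (i : Fin 3) (c : ℝ → ℝ) (hc : MemLp c ∞ volume) : Hsob 2 →L[ℝ] Hsob 2 :=
  (Hsob.coord 2 i).adjoint ∘L mulL c hc ∘L Hsob.coord 2 i

lemma inner_formOp (i : Fin 3) {c : ℝ → ℝ} (hc : MemLp c ∞ volume) (v w : Hsob 2) :
    ⟪formOp i c hc v, w⟫_ℝ = ∫ x, c x * Hsob.coord 2 i v x * Hsob.coord 2 i w x := by
  rw [formOp, ContinuousLinearMap.comp_apply, ContinuousLinearMap.adjoint_inner_left,
    ContinuousLinearMap.comp_apply, inner_mulL]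

lemma inner_formOp_symm (i : Fin 3) {c : ℝ → ℝ} (hc : MemLp c ∞ volume) (v w : Hsob 2) :
    ⟪formOp i c hc v, w⟫_ℝ = ⟪v, formOp i c hc w⟫_ℝ := by
  rw [← real_inner_comm v, inner_formOp, inner_formOp]
  exact integral_congr_ae (Eventually.of_forall fun x => mul_right_comm _ _ _)

lemma le_inner_formOp (i : Fin 3) {c : ℝ → ℝ} {m : ℝ} (hc : MemLp c ∞ volume)
    (hm : ∀ x, m ≤ c x) (v : Hsob 2) :
    m * ⟪Hsob.coord 2 i v, Hsob.coord 2 i v⟫_ℝ ≤ ⟪formOp i c hc v, v⟫_ℝ := by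
  set f := Hsob.coord 2 i v with hf
  rw [inner_formOp, ← hf, inner_L2R, ← integral_const_mul]
  have i1 := integrable_mul_of_memLp_two (Lp.memLp f) (Lp.memLp f)
  refine integral_mono_ae (i1.const_mul m) ?_ (Eventually.of_forall fun x => ?_)
  · refine (integrable_mul_of_memLp_two (Lp.memLp (mulL c hc f)) (Lp.memLp f)).congr ?_
    filter_upwards [coeFn_mulL hc f] with x hx
    rw [hx]
  · simp only [mul_assoc]
    exact mul_le_mul_of_nonneg_right (hm x) (mul_self_nonneg _)

lemma integral_mul_toLp {c g f : ℝ → ℝ} (hf : MemLp f 2 volume) :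
    ∫ x, c x * g x * hf.toLp f x = ∫ x, c x * g x * f x := by
  refine integral_congr_ae ?_
  filter_upwards [hf.coeFn_toLp] with x hx
  rw [hx]

lemma integral_mul_toLp_mul_toLp {c f : ℝ → ℝ} (hf : MemLp f 2 volume) :
    ∫ x, c x * hf.toLp f x * hf.toLp f x = ∫ x, c x * f x ^ 2 := by
  refine integral_congr_ae ?_
  filter_upwards [hf.coeFn_toLp] with x hx
  rw [hx]
  ring

/-- A nonnegative non-coercive form on `H²(ℝ)`, with `V` of compact support, has a kernel. -/
lemma exists_weak_kernel {c₂ : ℝ} {c₁ c₀ V : ℝ → ℝ} {m : ℝ} (hm : 0 < m) (hc₁ : MemLp c₁ ∞ volume)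
    (hc₀ : MemLp c₀ ∞ volume) (hV : Continuous V) (hVc : HasCompactSupport V)
    (hVb : MemLp V ∞ volume) (hm₂ : m ≤ c₂)
    (hm₁ : ∀ x, m ≤ c₁ x) (hm₀ : ∀ x, m ≤ c₀ x) (hpos : ∀ ψ, 0 ≤ quadForm c₂ c₁ c₀ V ψ)
    (hinf : ∀ ε > 0, ∃ ψ : H2R, quadForm c₂ c₁ c₀ V ψ
      < ε * ((∫ x, ψ.f x ^ 2) + (∫ x, ψ.d1 x ^ 2) + ∫ x, ψ.d2 x ^ 2)) :
    ∃ ψ : H2R, (¬ ψ.f =ᵐ[volume] 0) ∧ ∀ φ : H2R,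
      c₂ * (∫ x, ψ.d2 x * φ.d2 x) + (∫ x, c₁ x * ψ.d1 x * φ.d1 x)
        + (∫ x, c₀ x * ψ.f x * φ.f x) - ∫ x, V x * ψ.f x * φ.f x = 0 := by
  have hc₂ : MemLp (fun _ : ℝ => c₂) ∞ (volume : Measure ℝ) := memLp_top_const _
  let A : Hsob 2 →L[ℝ] Hsob 2 := formOp 0 c₀ hc₀ + formOp 1 c₁ hc₁ + formOp 2 (fun _ => c₂) hc₂
  let K : Hsob 2 →L[ℝ] Hsob 2 := formOp 0 V hVb
  have hA : ∀ v w, ⟪A v, w⟫_ℝ = ⟪formOp 0 c₀ hc₀ v, w⟫_ℝ + ⟪formOp 1 c₁ hc₁ v, w⟫_ℝ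
      + ⟪formOp 2 (fun _ => c₂) hc₂ v, w⟫_ℝ := fun v w => by
    simp only [A, add_apply, inner_add_left]
  have hQ : ∀ v w, ⟪(A - K) v, w⟫_ℝ
      = ⟪formOp 0 c₀ hc₀ v, w⟫_ℝ + ⟪formOp 1 c₁ hc₁ v, w⟫_ℝ
        + ⟪formOp 2 (fun _ => c₂) hc₂ v, w⟫_ℝ - ⟪formOp 0 V hVb v, w⟫_ℝ := fun v w => by
    rw [sub_apply, inner_sub_left, hA]
  obtain ⟨v, hv0, hv⟩ := exists_ker_of_not_coercive (A := A) (K := K)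
    (isCompactOperator_mulL hV hVc hVb) hm
    (fun v => by
      rw [hA, ← real_inner_self_eq_norm_sq, Hsob.inner_eq, Fin.sum_univ_three]
      have h0 := le_inner_formOp 0 hc₀ hm₀ v
      have h1 := le_inner_formOp 1 hc₁ hm₁ v
      have h2 := le_inner_formOp 2 hc₂ (fun _ => hm₂) v
      linarith)
    (fun v w => by
      rw [hQ, ← real_inner_comm v, hQ, inner_formOp_symm, inner_formOp_symm, inner_formOp_symm,
        inner_formOp_symm]
      simp only [real_inner_comm v])
    (fun v => by
      rw [hQ]
      simp only [inner_formOp]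
      have := hpos (Hsob.toH2R v)
      simp only [quadForm, Hsob.toH2R, sq, ← mul_assoc] at this
      simp only [mul_assoc c₂, integral_const_mul]
      linarith)
    (fun ε hε => by
      obtain ⟨ψ, hψ⟩ := hinf ε hε
      refine ⟨ψ.toHsob, ?_⟩
      rw [hQ, ← real_inner_self_eq_norm_sq, Hsob.inner_eq ψ.toHsob ψ.toHsob, Fin.sum_univ_three]
      simp only [inner_formOp]
      rw [H2R.coord_toHsob_zero, H2R.coord_toHsob_one, H2R.coord_toHsob_two, inner_toLp, inner_toLp,
        inner_toLp, integral_mul_toLp_mul_toLp, integral_mul_toLp_mul_toLp,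
        integral_mul_toLp_mul_toLp, integral_mul_toLp_mul_toLp, integral_const_mul]
      simp only [quadForm, sq, ← mul_assoc] at hψ ⊢
      linarith)
  refine ⟨Hsob.toH2R v, fun hψ => hv0 ?_, fun φ => ?_⟩
  · have f1 := H1R.d1_ae_eq_zero (Hsob.toH2R v).toH1R hψ
    have f2 := H1R.d1_ae_eq_zero (Hsob.toH2R v).derivH1 f1
    have e0 : Hsob.coord 2 0 v = 0 := (Lp.eq_zero_iff_ae_eq_zero).2 hψ
    have e1 : Hsob.coord 2 1 v = 0 := (Lp.eq_zero_iff_ae_eq_zero).2 f1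
    have e2 : Hsob.coord 2 2 v = 0 := (Lp.eq_zero_iff_ae_eq_zero).2 f2
    rw [← inner_self_eq_zero (𝕜 := ℝ), Hsob.inner_eq, Fin.sum_univ_three, e0, e1, e2]
    simp
  · have h1 := hQ v φ.toHsob
    rw [sub_apply, hv, sub_self, inner_zero_left] at h1
    simp only [inner_formOp] at h1
    rw [H2R.coord_toHsob_zero, H2R.coord_toHsob_one, H2R.coord_toHsob_two, integral_mul_toLp,
      integral_mul_toLp, integral_mul_toLp, integral_mul_toLp] at h1
    simp only [mul_assoc c₂, integral_const_mul] at h1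
    simp only [Hsob.toH2R]
    linarith

/-- A nonnegative non-coercive form `∫ c₂ ψ''² + c₁ ψ'² + (c₀ - V) ψ²` on `H²(ℝ)`, with `V` of
compact support, has a nonzero smooth kernel element. -/
theorem exists_smooth_kernel {c₂ : ℝ} {c₁ c₀ V : ℝ → ℝ} {m : ℝ} (hm : 0 < m) (hc₁ : BddSmooth c₁)
    (hc₀ : BddSmooth c₀) (hV : ContDiff ℝ ∞ V) (hVc : HasCompactSupport V) (hm₂ : m ≤ c₂)
    (hm₁ : ∀ x, m ≤ c₁ x) (hm₀ : ∀ x, m ≤ c₀ x) (hpos : ∀ ψ, 0 ≤ quadForm c₂ c₁ c₀ V ψ)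
    (hinf : ∀ ε > 0, ∃ ψ : H2R, quadForm c₂ c₁ c₀ V ψ
      < ε * ((∫ x, ψ.f x ^ 2) + (∫ x, ψ.d1 x ^ 2) + ∫ x, ψ.d2 x ^ 2)) :
    ∃ y, SobSmooth y ∧ y ≠ 0 ∧
      ∀ x, c₂ * deriv (deriv (deriv (deriv y))) x
        = deriv c₁ x * deriv y x + c₁ x * deriv (deriv y) x - (c₀ x - V x) * y x := by
  have hVb := bddSmooth_of_hasCompactSupport hV hVc
  obtain ⟨ψ, hψ0, hψ⟩ := exists_weak_kernel hm hc₁.memLp_top hc₀.memLp_top hV.continuous hVc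
    hVb.memLp_top hm₂ hm₁ hm₀ hpos hinf
  obtain ⟨y, hy, hψy, hode⟩ := exists_sobSmooth_of_weak (hm.trans_le hm₂) hc₁
    (b := fun x => c₀ x + (-1) * V x) (fun n => (hc₀ n).add ((hVb n).const_mul _)) ψ (by
      intro φ
      have i1 : Integrable fun x => c₀ x * ψ.f x * φ.f x := integrable_mul_of_memLp_two
        (memLp_two_mul_of_bound (hc₀ 0).1 (hc₀ 0).2 ψ.memLp_f) φ.memLp_f
      have i2 : Integrable fun x => V x * ψ.f x * φ.f x := integrable_mul_of_memLp_two
        (memLp_two_mul_of_bound (hVb 0).1 (hVb 0).2 ψ.memLp_f) φ.memLp_f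
      have e : ∀ x, (c₀ x + -1 * V x) * ψ.f x * φ.f x
          = c₀ x * ψ.f x * φ.f x - V x * ψ.f x * φ.f x := fun x => by ring
      simp_rw [e]
      rw [integral_sub i1 i2, ← hψ φ]
      ring)
  refine ⟨y, hy, ?_, fun x => ?_⟩
  · rintro rfl
    exact hψ0 hψy
  · rw [hode]
    ring

/-! ### The energies -/

/-- Scalar multiples in `H²(ℝ)`. -/
def H2R.smul (a : ℝ) (ψ : H2R) : H2R where
  f x := a * ψ.f x
  d1 x := a * ψ.d1 x
  d2 x := a * ψ.d2 x
  memLp_f := ψ.memLp_f.const_mul a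
  memLp_d1 := ψ.memLp_d1.const_mul a
  memLp_d2 := ψ.memLp_d2.const_mul a
  weak_d1 := fun η hη hc => by
    simp only [mul_assoc, integral_const_mul]
    rw [ψ.weak_d1 η hη hc, mul_neg]
  weak_d2 := fun η hη hc => by
    simp only [mul_assoc, integral_const_mul]
    rw [ψ.weak_d2 η hη hc, mul_neg]

lemma integrable_sq_of_memLp_two {f : ℝ → ℝ} (hf : MemLp f 2 volume) :
    Integrable fun x => f x ^ 2 := hf.integrable_sq

lemma integrable_bdd_mul_sq {c f : ℝ → ℝ} (hc : Continuous c) (hb : ∃ C, ∀ x, |c x| ≤ C)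
    (hf : MemLp f 2 volume) : Integrable fun x => c x * f x ^ 2 := by
  refine (integrable_mul_of_memLp_two (memLp_two_mul_of_bound hc hb hf) hf).congr
    (Eventually.of_forall fun x => ?_)
  ring

lemma H2R.integral_f_mul_d2 (ψ : H2R) : ∫ x, ψ.f x * ψ.d2 x = -∫ x, ψ.d1 x ^ 2 := by
  have := ψ.toH1R.integral_mul_d1 ψ.derivH1
  simpa only [H2R.derivH1, ← sq] using this

lemma integral_comb₂ {f₁ f₂ : ℝ → ℝ} (h₁ : Integrable f₁) (h₂ : Integrable f₂) (a b : ℝ) :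
    ∫ x, (a * f₁ x + b * f₂ x) = a * (∫ x, f₁ x) + b * ∫ x, f₂ x := by
  rw [integral_add (h₁.const_mul a) (h₂.const_mul b), integral_const_mul, integral_const_mul]

lemma integral_comb₄ {f₁ f₂ f₃ f₄ : ℝ → ℝ} (h₁ : Integrable f₁) (h₂ : Integrable f₂)
    (h₃ : Integrable f₃) (h₄ : Integrable f₄) (a b c d : ℝ) :
    ∫ x, (a * f₁ x + b * f₂ x + (c * f₃ x + d * f₄ x))
      = a * (∫ x, f₁ x) + b * (∫ x, f₂ x) + (c * (∫ x, f₃ x) + d * ∫ x, f₄ x) := by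
  rw [← integral_comb₂ h₁ h₂, ← integral_comb₂ h₃ h₄]
  exact integral_add ((h₁.const_mul a).add (h₂.const_mul b)) ((h₃.const_mul c).add (h₄.const_mul d))

namespace RTData

variable (D : RTData)

/-- The coefficient of `∫ ψ²` in `E₀`, apart from the gravity term. -/
def e0 (ξ : Freq) : ℝ :=
  match D.dir with
  | .horizontal => D.M ^ 2 * ξ 0 ^ 2
  | .vertical => 0

/-- The coefficient of `∫ ψ'²` in `E₀`. -/
def e1 (ξ : Freq) : ℝ :=
  match D.dir with
  | .horizontal => D.M ^ 2 * ξ 0 ^ 2 / ‖ξ‖ ^ 2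
  | .vertical => D.M ^ 2

/-- The coefficient of `∫ ψ''²` in `E₀`. -/
def e2 (ξ : Freq) : ℝ :=
  match D.dir with
  | .horizontal => 0
  | .vertical => D.M ^ 2 / ‖ξ‖ ^ 2

lemma e0_nonneg (ξ : Freq) : 0 ≤ D.e0 ξ := by
  unfold e0; split <;> positivity

lemma e1_nonneg (ξ : Freq) : 0 ≤ D.e1 ξ := by
  unfold e1; split <;> positivity

lemma e2_nonneg (ξ : Freq) : 0 ≤ D.e2 ξ := by
  unfold e2; split <;> positivity

namespace Admissible

variable {D}

lemma bddSmooth_ρ (hD : D.Admissible) : BddSmooth D.ρ := bddSmooth_of_deriv hD.ρ_smooth hD.ρ_bdd hD.ρ'_supp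

lemma contDiff_ρ' (hD : D.Admissible) : ContDiff ℝ ∞ (deriv D.ρ) := (contDiff_infty_iff_deriv.1 hD.ρ_smooth).2

lemma integrable_ρ_mul_sq (hD : D.Admissible) {f : ℝ → ℝ} (hf : MemLp f 2 volume) :
    Integrable fun x => D.ρ x * f x ^ 2 :=
  integrable_bdd_mul_sq hD.ρ_smooth.continuous hD.ρ_bdd hf

lemma integrable_ρ'_mul_sq (hD : D.Admissible) {f : ℝ → ℝ} (hf : MemLp f 2 volume) :
    Integrable fun x => deriv D.ρ x * f x ^ 2 :=
  integrable_bdd_mul_sq hD.contDiff_ρ'.continuous (hD.bddSmooth_ρ.deriv 0).2 hf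

lemma E0_eq (hD : D.Admissible) (ξ : Freq) (ψ : H2R) : D.E0 ξ ψ = D.e0 ξ * (∫ x, ψ.f x ^ 2)
    + D.e1 ξ * (∫ x, ψ.d1 x ^ 2) + D.e2 ξ * (∫ x, ψ.d2 x ^ 2)
    - D.g * ∫ x, deriv D.ρ x * ψ.f x ^ 2 := by
  have i0 := integrable_sq_of_memLp_two ψ.memLp_f
  have i1 := integrable_sq_of_memLp_two ψ.memLp_d1
  have i2 := integrable_sq_of_memLp_two ψ.memLp_d2
  have ir := hD.integrable_ρ'_mul_sq ψ.memLp_f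
  have h := integral_comb₄ i0 i1 i2 ir (D.e0 ξ) (D.e1 ξ) (D.e2 ξ) (-D.g)
  rw [sub_eq_add_neg, ← neg_mul, add_assoc, ← h]
  unfold E0 e0 e1 e2
  cases D.dir <;>
  · refine integral_congr_ae (Eventually.of_forall fun x => ?_)
    simp only
    ring

/-- Expanding the square produces `2|ξ|² ∫ ψ ψ'' = -2|ξ|² ∫ ψ'²`, which leaves all three
coefficients positive. This is the source of coercivity on `H²`. -/
lemma E1_eq (ξ : Freq) (ψ : H2R) : D.E1 ξ ψ = D.μ * (‖ξ‖ ^ 4 * (∫ x, ψ.f x ^ 2)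
    + 2 * ‖ξ‖ ^ 2 * (∫ x, ψ.d1 x ^ 2) + ∫ x, ψ.d2 x ^ 2) := by
  have i0 := integrable_sq_of_memLp_two ψ.memLp_f
  have i1 := integrable_sq_of_memLp_two ψ.memLp_d1
  have i2 := integrable_sq_of_memLp_two ψ.memLp_d2
  have i3 := integrable_mul_of_memLp_two ψ.memLp_f ψ.memLp_d2
  have h := integral_comb₄ i0 i1 i2 i3 (‖ξ‖ ^ 4) (4 * ‖ξ‖ ^ 2) 1 (2 * ‖ξ‖ ^ 2)
  have h' : ∫ x, (4 * ‖ξ‖ ^ 2 * ψ.d1 x ^ 2 + (‖ξ‖ ^ 2 * ψ.f x + ψ.d2 x) ^ 2)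
      = ∫ x, (‖ξ‖ ^ 4 * ψ.f x ^ 2 + 4 * ‖ξ‖ ^ 2 * ψ.d1 x ^ 2
        + (1 * ψ.d2 x ^ 2 + 2 * ‖ξ‖ ^ 2 * (ψ.f x * ψ.d2 x))) :=
    integral_congr_ae (Eventually.of_forall fun x => by ring)
  rw [E1, h', h, ψ.integral_f_mul_d2]
  ring

lemma J_eq (hD : D.Admissible) (ξ : Freq) (ψ : H2R) : D.J ξ ψ = ‖ξ‖ ^ 2 * (∫ x, D.ρ x * ψ.f x ^ 2)
    + ∫ x, D.ρ x * ψ.d1 x ^ 2 := by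
  have i0 := hD.integrable_ρ_mul_sq ψ.memLp_f
  have i1 := hD.integrable_ρ_mul_sq ψ.memLp_d1
  rw [← integral_const_mul, ← integral_add (i0.const_mul _) i1, J]
  exact integral_congr_ae (Eventually.of_forall fun x => by ring)

/-- Used with `t = s²` at the growth rate: all indefiniteness is in the `ρ'` term, which has compact
support, and every other coefficient is positive when `s > 0` and `ξ ≠ 0`. -/
lemma E_add_mul_J (hD : D.Admissible) (ξ : Freq) (s t : ℝ) (ψ : H2R) :
    D.E ξ s ψ + t * D.J ξ ψ = quadForm (‖ξ‖ ^ 2 * D.e2 ξ + s * D.μ)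
      (fun x => (‖ξ‖ ^ 2 * D.e1 ξ + 2 * s * D.μ * ‖ξ‖ ^ 2) + t * D.ρ x)
      (fun x => (‖ξ‖ ^ 2 * D.e0 ξ + s * D.μ * ‖ξ‖ ^ 4) + t * ‖ξ‖ ^ 2 * D.ρ x)
      (fun x => D.g * ‖ξ‖ ^ 2 * deriv D.ρ x) ψ := by
  have i0 := integrable_sq_of_memLp_two ψ.memLp_f
  have i1 := integrable_sq_of_memLp_two ψ.memLp_d1
  have j0 := hD.integrable_ρ_mul_sq ψ.memLp_f
  have j1 := hD.integrable_ρ_mul_sq ψ.memLp_d1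
  rw [E, hD.E0_eq, E1_eq, hD.J_eq, quadForm]
  have e1 : ∀ x, (‖ξ‖ ^ 2 * D.e1 ξ + 2 * s * D.μ * ‖ξ‖ ^ 2 + t * D.ρ x) * ψ.d1 x ^ 2
      = (‖ξ‖ ^ 2 * D.e1 ξ + 2 * s * D.μ * ‖ξ‖ ^ 2) * ψ.d1 x ^ 2
        + t * (D.ρ x * ψ.d1 x ^ 2) := fun x => by ring
  have e0 : ∀ x, (‖ξ‖ ^ 2 * D.e0 ξ + s * D.μ * ‖ξ‖ ^ 4 + t * ‖ξ‖ ^ 2 * D.ρ x) * ψ.f x ^ 2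
      = (‖ξ‖ ^ 2 * D.e0 ξ + s * D.μ * ‖ξ‖ ^ 4) * ψ.f x ^ 2
        + t * ‖ξ‖ ^ 2 * (D.ρ x * ψ.f x ^ 2) := fun x => by ring
  simp only [e0, e1, integral_comb₂ i1 j1, integral_comb₂ i0 j0, mul_assoc (D.g * _),
    integral_const_mul]
  ring

lemma J_nonneg (hD : D.Admissible) (ξ : Freq) (ψ : H2R) : 0 ≤ D.J ξ ψ := by
  obtain ⟨c, hc, hc'⟩ := hD.ρ_pos
  refine integral_nonneg fun x => ?_
  have := hc.trans_le (hc' x)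
  positivity

lemma integral_sq_nonneg (f : ℝ → ℝ) : 0 ≤ ∫ x, f x ^ 2 :=
  integral_nonneg fun _ => sq_nonneg _

lemma E1_nonneg (hD : D.Admissible) (ξ : Freq) (ψ : H2R) : 0 ≤ D.E1 ξ ψ := by
  rw [E1]
  exact mul_nonneg hD.μ_pos.le (integral_nonneg fun x => by positivity)

/-- The energy is bounded below in terms of `J`, uniformly in the frequency. -/
lemma exists_le_E (hD : D.Admissible) : ∃ C : ℝ, 0 < C ∧ ∀ (ξ : Freq) (ψ : H2R), -(C * D.J ξ ψ) ≤ ‖ξ‖ ^ 2 * D.E0 ξ ψ := by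
  obtain ⟨c, hc, hc'⟩ := hD.ρ_pos
  obtain ⟨B, hB⟩ := (hD.bddSmooth_ρ.deriv 0).2
  have hg := hD.g_pos
  have hB0 : 0 ≤ B := (abs_nonneg _).trans (hB 0)
  refine ⟨D.g * (B + 1) / c, by positivity, fun ξ ψ => ?_⟩
  have h1 : ∫ x, deriv D.ρ x * ψ.f x ^ 2 ≤ (B + 1) / c * ∫ x, D.ρ x * ψ.f x ^ 2 := by
    rw [← integral_const_mul]
    refine integral_mono (hD.integrable_ρ'_mul_sq ψ.memLp_f)
      ((hD.integrable_ρ_mul_sq ψ.memLp_f).const_mul _) fun x => ?_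
    simp only
    rw [← mul_assoc]
    refine mul_le_mul_of_nonneg_right ?_ (sq_nonneg _)
    calc deriv D.ρ x ≤ B + 1 := by linarith [le_abs_self (deriv D.ρ x), hB x]
      _ = (B + 1) / c * c := by field_simp
      _ ≤ (B + 1) / c * D.ρ x := by gcongr; exact hc' x
  have h2 : 0 ≤ ∫ x, D.ρ x * ψ.d1 x ^ 2 := integral_nonneg fun x => by
    have := hc.trans_le (hc' x)
    positivity
  rw [hD.E0_eq, hD.J_eq]
  have p0 := mul_nonneg (D.e0_nonneg ξ) (integral_sq_nonneg ψ.f)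
  have p1 := mul_nonneg (D.e1_nonneg ξ) (integral_sq_nonneg ψ.d1)
  have p2 := mul_nonneg (D.e2_nonneg ξ) (integral_sq_nonneg ψ.d2)
  have p3 : D.g * ∫ x, deriv D.ρ x * ψ.f x ^ 2 ≤ D.g * ((B + 1) / c * ∫ x, D.ρ x * ψ.f x ^ 2) := by
    gcongr
  have p4 : 0 ≤ D.g * (B + 1) / c * ∫ x, D.ρ x * ψ.d1 x ^ 2 := by positivity
  have p5 : -(D.g * ((B + 1) / c * ∫ x, D.ρ x * ψ.f x ^ 2)) ≤ D.e0 ξ * (∫ x, ψ.f x ^ 2)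
    + D.e1 ξ * (∫ x, ψ.d1 x ^ 2) + D.e2 ξ * (∫ x, ψ.d2 x ^ 2)
    - D.g * ∫ x, deriv D.ρ x * ψ.f x ^ 2 := by linarith
  have p6 := mul_le_mul_of_nonneg_left p5 (sq_nonneg ‖ξ‖)
  have e : D.g * (B + 1) / c * (‖ξ‖ ^ 2 * ∫ x, D.ρ x * ψ.f x ^ 2)
      = ‖ξ‖ ^ 2 * (D.g * ((B + 1) / c * ∫ x, D.ρ x * ψ.f x ^ 2)) := by ring
  linarith

lemma J_smul (ξ : Freq) (a : ℝ) (ψ : H2R) : D.J ξ (ψ.smul a) = a ^ 2 * D.J ξ ψ := by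
  rw [J, J, ← integral_const_mul]
  exact integral_congr_ae (Eventually.of_forall fun x => by simp only [H2R.smul]; ring)

lemma E_smul (ξ : Freq) (s a : ℝ) (ψ : H2R) : D.E ξ s (ψ.smul a) = a ^ 2 * D.E ξ s ψ := by
  have h0 : D.E0 ξ (ψ.smul a) = a ^ 2 * D.E0 ξ ψ := by
    unfold E0
    cases D.dir <;>
    · simp only
      rw [← integral_const_mul]
      exact integral_congr_ae (Eventually.of_forall fun x => by simp only [H2R.smul]; ring)
  have h1 : D.E1 ξ (ψ.smul a) = a ^ 2 * D.E1 ξ ψ := by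
    rw [E1, E1, mul_left_comm, ← integral_const_mul (a ^ 2)]
    congr 1
    exact integral_congr_ae (Eventually.of_forall fun x => by simp only [H2R.smul]; ring)
  rw [E, E, h0, h1]
  ring

/-- There is a test function on which the gravity term is positive. -/
lemma exists_integral_ρ'_pos (hD : D.Admissible) : ∃ ψ : H2R, 0 < ∫ x, deriv D.ρ x * ψ.f x ^ 2 := by
  obtain ⟨x₀, hx₀⟩ := hD.ρ'_pos
  have hop : IsOpen {x | 0 < deriv D.ρ x} := isOpen_lt continuous_const hD.contDiff_ρ'.continuous
  obtain ⟨r, hr, hball⟩ := Metric.isOpen_iff.1 hop x₀ hx₀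
  let b : ContDiffBump x₀ := ⟨r / 2, r, by positivity, by linarith⟩
  refine ⟨TestFun.toH2R ⟨b, b.contDiff, b.hasCompactSupport⟩, ?_⟩
  refine Continuous.integral_pos_of_hasCompactSupport_nonneg_nonzero (x := x₀)
    (hD.contDiff_ρ'.continuous.mul (b.continuous.pow 2)) ?_ ?_ ?_
  · exact HasCompactSupport.mul_right hD.ρ'_supp
  · intro x
    by_cases hx : x ∈ Metric.ball x₀ r
    · have := hball hx
      exact mul_nonneg (le_of_lt this) (sq_nonneg _)
    · have : b x = 0 := b.zero_of_le_dist (by simpa using hx)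
      simp [TestFun.toH2R, this]
  · have : b x₀ = 1 := b.one_of_mem_closedBall (Metric.mem_closedBall_self (by positivity))
    simp [TestFun.toH2R, this, hx₀.ne']

end Admissible

end RTData

/-! ### The growth rate -/

namespace RTData.Admissible

variable {D : RTData}

/-- The energy is bounded below by a multiple of `-J`, so it cannot be negative where `J` vanishes.
-/
lemma J_pos_of_E0_neg (hD : D.Admissible) {ξ : Freq} (hξ : ξ ≠ 0) {ψ : H2R} (h : D.E0 ξ ψ < 0) :
    0 < D.J ξ ψ := by
  obtain ⟨C, hC, hC'⟩ := hD.exists_le_E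
  have h1 := hC' ξ ψ
  have h2 : ‖ξ‖ ^ 2 * D.E0 ξ ψ < 0 := mul_neg_of_pos_of_neg (by positivity) h
  by_contra h3
  have : D.J ξ ψ = 0 := le_antisymm (not_lt.1 h3) (hD.J_nonneg ξ ψ)
  rw [this] at h1
  linarith

lemma exists_J_eq_one (hD : D.Admissible) {ξ : Freq} (hξ : ξ ≠ 0) : ∃ ψ : H2R, D.J ξ ψ = 1 := by
  obtain ⟨ψ, hψ⟩ := hD.exists_integral_ρ'_pos
  have hJ : 0 < D.J ξ ψ := by
    refine lt_of_le_of_ne (hD.J_nonneg ξ ψ) fun h0 => ?_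
    obtain ⟨c, hc, hc'⟩ := hD.ρ_pos
    obtain ⟨B, hB⟩ := (hD.bddSmooth_ρ.deriv 0).2
    have h1 : 0 ≤ ∫ x, D.ρ x * ψ.d1 x ^ 2 := integral_nonneg fun x => by
      have := hc.trans_le (hc' x)
      positivity
    have h2 : 0 ≤ ∫ x, D.ρ x * ψ.f x ^ 2 := integral_nonneg fun x => by
      have := hc.trans_le (hc' x)
      positivity
    have h3 : ∫ x, D.ρ x * ψ.f x ^ 2 = 0 := by
      rw [hD.J_eq] at h0
      have h4 : 0 < ‖ξ‖ ^ 2 := by positivity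
      nlinarith
    rw [integral_eq_zero_iff_of_nonneg (fun x => by
      have := hc.trans_le (hc' x)
      positivity) (hD.integrable_ρ_mul_sq ψ.memLp_f)] at h3
    have h5 : ∫ x, deriv D.ρ x * ψ.f x ^ 2 = 0 := by
      refine integral_eq_zero_of_ae ?_
      filter_upwards [h3] with x hx
      have : D.ρ x ≠ 0 := (hc.trans_le (hc' x)).ne'
      have hf : ψ.f x ^ 2 = 0 := by simpa [this] using hx
      rw [hf, mul_zero, Pi.zero_apply]
    exact hψ.ne' h5
  refine ⟨ψ.smul (√(D.J ξ ψ))⁻¹, ?_⟩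
  rw [J_smul, inv_pow, Real.sq_sqrt hJ.le, inv_mul_cancel₀ hJ.ne']

/-- The values of the energy on the constraint set are bounded below. -/
lemma exists_bound (hD : D.Admissible) : ∃ C : ℝ, 0 < C ∧ ∀ (ξ : Freq) (s : ℝ), 0 ≤ s →
    ∀ ψ : H2R, -(C * D.J ξ ψ) ≤ D.E ξ s ψ := by
  obtain ⟨C, hC, hC'⟩ := hD.exists_le_E
  refine ⟨C, hC, fun ξ s hs ψ => ?_⟩
  rw [E]
  have := mul_nonneg hs (hD.E1_nonneg ξ ψ)
  linarith [hC' ξ ψ]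

lemma bddBelow (hD : D.Admissible) (ξ : Freq) {s : ℝ} (hs : 0 ≤ s) :
    BddBelow {r : ℝ | ∃ ψ : H2R, D.J ξ ψ = 1 ∧ r = D.E ξ s ψ} := by
  obtain ⟨C, hC, hC'⟩ := hD.exists_bound
  refine ⟨-C, ?_⟩
  rintro r ⟨ψ, h1, rfl⟩
  have := hC' ξ s hs ψ
  rwa [h1, mul_one] at this

/-- Both sides are quadratic, so normalising to `J = 1` suffices. The degenerate case `J = 0`
follows from the lower bound of the energy by a multiple of `-J`. -/
lemma α_mul_J_le (hD : D.Admissible) (ξ : Freq) {s : ℝ} (hs : 0 ≤ s) (ψ : H2R) :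
    D.α ξ s * D.J ξ ψ ≤ D.E ξ s ψ := by
  rcases (hD.J_nonneg ξ ψ).eq_or_lt with h0 | h0
  · obtain ⟨C, hC, hC'⟩ := hD.exists_bound
    have := hC' ξ s hs ψ
    rw [← h0] at this ⊢
    linarith
  · have h1 : D.J ξ (ψ.smul (√(D.J ξ ψ))⁻¹) = 1 := by
      rw [J_smul, inv_pow, Real.sq_sqrt h0.le, inv_mul_cancel₀ h0.ne']
    have h2 : D.α ξ s ≤ D.E ξ s (ψ.smul (√(D.J ξ ψ))⁻¹) :=
      csInf_le (hD.bddBelow ξ hs) ⟨_, h1, rfl⟩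
    rw [E_smul, inv_pow, Real.sq_sqrt h0.le, inv_mul_eq_div, le_div_iff₀ h0] at h2
    exact h2

lemma le_α (hD : D.Admissible) {ξ : Freq} (hξ : ξ ≠ 0) {s a : ℝ}
    (h : ∀ ψ : H2R, D.J ξ ψ = 1 → a ≤ D.E ξ s ψ) : a ≤ D.α ξ s := by
  obtain ⟨ψ, hψ⟩ := hD.exists_J_eq_one hξ
  refine le_csInf ⟨_, ψ, hψ, rfl⟩ ?_
  rintro r ⟨φ, h1, rfl⟩
  exact h φ h1

lemma α_mono (hD : D.Admissible) {ξ : Freq} (hξ : ξ ≠ 0) {s t : ℝ} (hs : 0 ≤ s) (hst : s ≤ t) :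
    D.α ξ s ≤ D.α ξ t := by
  refine hD.le_α hξ fun ψ hψ => ?_
  have h1 := hD.α_mul_J_le ξ hs ψ
  rw [hψ, mul_one] at h1
  refine h1.trans ?_
  rw [E, E]
  gcongr
  exact hD.E1_nonneg ξ ψ

/-- For fixed `ψ` the energy is affine in `s`; an infimum of affine functions is concave, and a
finite concave function on an open interval is continuous. -/
lemma continuousOn_α (hD : D.Admissible) {ξ : Freq} (hξ : ξ ≠ 0) :
    ContinuousOn (D.α ξ) (Set.Ioi 0) := by
  refine ConcaveOn.continuousOn isOpen_Ioi ⟨convex_Ioi 0, ?_⟩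
  intro s hs t ht a b ha hb hab
  refine hD.le_α hξ fun ψ hψ => ?_
  have h1 := hD.α_mul_J_le ξ (le_of_lt hs) ψ
  have h2 := hD.α_mul_J_le ξ (le_of_lt ht) ψ
  rw [hψ, mul_one] at h1 h2
  have h3 : D.E ξ (a • s + b • t) ψ = a * D.E ξ s ψ + b * D.E ξ t ψ := by
    simp only [E, smul_eq_mul]
    linear_combination (-(‖ξ‖ ^ 2 * D.E0 ξ ψ)) * hab
  rw [h3]
  simp only [smul_eq_mul]
  gcongr

lemma exists_neg_le_α (hD : D.Admissible) : ∃ C : ℝ, 0 < C ∧ ∀ ξ : Freq, ξ ≠ 0 → ∀ s, 0 ≤ s →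
    -C ≤ D.α ξ s := by
  obtain ⟨C, hC, hC'⟩ := hD.exists_bound
  refine ⟨C, hC, fun ξ hξ s hs => hD.le_α hξ fun ψ hψ => ?_⟩
  have := hC' ξ s hs ψ
  rwa [hψ, mul_one] at this

lemma isGrowthRate_sq {ξ : Freq} {s : ℝ} (h : D.IsGrowthRate ξ s) :
    0 < s ∧ s ^ 2 = -D.α ξ s := by
  refine ⟨h.1.1, ?_⟩
  have h1 : 0 < √(-D.α ξ s) := h.2 ▸ h.1.1
  nth_rw 1 [h.2]
  exact Real.sq_sqrt (Real.sqrt_pos.1 h1).le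

lemma existsUnique_growthRate (hD : D.Admissible) {ξ : Freq} (hξ : ξ ≠ 0) {ψ : H2R}
    (hψ : D.E0 ξ ψ < 0) : ∃! s : ℝ, D.IsGrowthRate ξ s := by
  have hk : 0 < ‖ξ‖ ^ 2 := by positivity
  have hJ := hD.J_pos_of_E0_neg hξ hψ
  have hE1 := hD.E1_nonneg ξ ψ
  -- the infimum is negative for small `s`
  obtain ⟨s₀, hs₀, hα₀⟩ : ∃ s₀ : ℝ, 0 < s₀ ∧ D.α ξ s₀ < 0 := by
    -- With this `s₀` the energy of `ψ` equals exactly `-s₀`; the `+ 1` keeps the denominator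
    -- positive.
    refine ⟨-(‖ξ‖ ^ 2 * D.E0 ξ ψ) / (D.E1 ξ ψ + 1), ?_, ?_⟩
    · have : ‖ξ‖ ^ 2 * D.E0 ξ ψ < 0 := mul_neg_of_pos_of_neg hk hψ
      apply div_pos <;> linarith
    · set s₀ := -(‖ξ‖ ^ 2 * D.E0 ξ ψ) / (D.E1 ξ ψ + 1) with hs
      have hneg : ‖ξ‖ ^ 2 * D.E0 ξ ψ < 0 := mul_neg_of_pos_of_neg hk hψ
      have hs0 : 0 < s₀ := by apply div_pos <;> linarith
      have e : s₀ * (D.E1 ξ ψ + 1) = -(‖ξ‖ ^ 2 * D.E0 ξ ψ) := by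
        rw [hs]; field_simp
      have h1 := hD.α_mul_J_le ξ hs0.le ψ
      rw [E] at h1
      have h2 : D.α ξ s₀ * D.J ξ ψ < 0 := by linarith
      by_contra h3
      exact absurd (mul_nonneg (not_lt.1 h3) hJ.le) (not_le.2 h2)
  obtain ⟨C, hC, hC'⟩ := hD.exists_neg_le_α
  set F : ℝ → ℝ := fun s => s ^ 2 + D.α ξ s with hF
  have hFc : ContinuousOn F (Set.Ioi 0) :=
    (continuous_pow 2).continuousOn.add (hD.continuousOn_α hξ)
  obtain ⟨s₁, hs₁, hs₁₀, hF₁⟩ : ∃ s₁ : ℝ, 0 < s₁ ∧ s₁ ≤ s₀ ∧ F s₁ < 0 := by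
    have hq : 0 < √(-D.α ξ s₀) := Real.sqrt_pos.2 (by linarith)
    -- Below `s₀` monotonicity gives `α ≤ α(s₀)`, and the second entry forces `s₁² ≤ -α(s₀)/4`, so
    -- `F s₁ < 0`.
    refine ⟨min s₀ (√(-D.α ξ s₀) / 2), lt_min hs₀ (by positivity), min_le_left _ _, ?_⟩
    have hm0 : 0 < min s₀ (√(-D.α ξ s₀) / 2) := lt_min hs₀ (by positivity)
    have h1 := hD.α_mono hξ hm0.le (min_le_left s₀ (√(-D.α ξ s₀) / 2))
    have h2 : (min s₀ (√(-D.α ξ s₀) / 2)) ^ 2 ≤ (√(-D.α ξ s₀) / 2) ^ 2 := by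
      gcongr
      exact min_le_right _ _
    rw [div_pow, Real.sq_sqrt (by linarith)] at h2
    simp only [hF]
    linarith
  have hs₂ : 0 ≤ F (s₁ + (C + 1)) := by
    have h1 := hC' ξ hξ (s₁ + (C + 1)) (by positivity)
    simp only [hF]
    nlinarith
  -- At the right end `(s₁ + C + 1)² ≥ C ≥ -α`. Uniqueness below holds because `s²` increases
  -- strictly and `α` does not decrease.
  obtain ⟨s, ⟨hs1, -⟩, hs⟩ := intermediate_value_Icc (by linarith : s₁ ≤ s₁ + (C + 1))
    (hFc.mono fun x hx => lt_of_lt_of_le hs₁ hx.1) (show (0 : ℝ) ∈ _ from ⟨hF₁.le, hs₂⟩)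
  have hs0 : 0 < s := lt_of_lt_of_le hs₁ hs1
  have hα : D.α ξ s = -s ^ 2 := by
    simp only [hF] at hs
    linarith
  refine ⟨s, ⟨⟨hs0, ?_⟩, ?_⟩, fun t ht => ?_⟩
  · have hca := (hD.continuousOn_α hξ).continuousAt (Ioi_mem_nhds hs0)
    have hneg : D.α ξ s < 0 := by rw [hα]; nlinarith
    -- Continuity makes `α` negative slightly beyond `s`, and monotonicity makes it negative at all
    -- smaller parameters, so `s` lies strictly inside the interval.
    obtain ⟨s', hs', h'⟩ := (hca.eventually_lt continuousAt_const hneg).exists_gt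
    exact ⟨s', hs', fun τ hτ => (hD.α_mono hξ hτ.1.le hτ.2.le).trans_lt h'⟩
  · rw [hα, neg_neg, Real.sqrt_sq hs0.le]
  · obtain ⟨ht0, ht2⟩ := isGrowthRate_sq ht
    rcases lt_trichotomy t s with h | h | h
    · have := hD.α_mono hξ ht0.le h.le
      nlinarith
    · exact h
    · have := hD.α_mono hξ hs0.le h.le
      nlinarith

lemma exists_growthRate_le (hD : D.Admissible) : ∃ C : ℝ, ∀ ξ : Freq, ξ ≠ 0 → ∀ s,
    D.IsGrowthRate ξ s → s ≤ C := by
  obtain ⟨C, hC, hC'⟩ := hD.exists_neg_le_α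
  refine ⟨C + 1, fun ξ hξ s hs => ?_⟩
  obtain ⟨h0, h2⟩ := isGrowthRate_sq hs
  have := hC' ξ hξ s h0.le
  nlinarith

/-! ### Negative energies on the solvable domain -/

lemma vcDenom_eq (hD : D.Admissible) (ψ : H2R) : D.vcDenom ψ
    = D.g * (∫ x, deriv D.ρ x * ψ.f x ^ 2) - D.M ^ 2 * ∫ x, ψ.d1 x ^ 2 := by
  have h := integral_comb₂ (hD.integrable_ρ'_mul_sq ψ.memLp_f)
    (integrable_sq_of_memLp_two ψ.memLp_d1) D.g (-D.M ^ 2)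
  rw [vcDenom, sub_eq_add_neg, ← neg_mul, ← h]
  exact integral_congr_ae (Eventually.of_forall fun x => by ring)

/-- Squaring `|M| < M_c` produces an `H¹` function with `M² ∫ ψ'² < ∫ g ρ' ψ²`; density of `H²` then
replaces it by an `H²` function. -/
lemma exists_vcDenom_pos (hD : D.Admissible) (hdir : D.dir = .vertical) :
    ∃ ψ : H2R, 0 < D.vcDenom ψ := by
  have hM := hD.M_lt hdir
  rw [Mc, one_div, ENNReal.lt_rpow_inv_iff (by norm_num), lt_iSup_iff] at hM
  obtain ⟨u, hu⟩ := hM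
  obtain ⟨-, hu⟩ := lt_iSup_iff.1 hu
  rw [ENNReal.ofReal_rpow_of_nonneg (abs_nonneg _) (by norm_num), ENNReal.ofReal_lt_ofReal_iff'] at hu
  have h2 : |D.M| ^ (2 : ℝ) = D.M ^ 2 := by
    rw [Real.rpow_two, sq_abs]
  rw [h2] at hu
  -- A vanishing denominator would make the quotient `0` by convention, while it exceeds `M²`.
  have hd : 0 < ∫ x, u.d1 x ^ 2 := by
    refine lt_of_le_of_ne (integral_sq_nonneg _) fun h0 => ?_
    rw [← h0, div_zero] at hu
    exact lt_irrefl _ hu.2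
  have h3 := (lt_div_iff₀ hd).1 hu.1
  obtain ⟨v, hv⟩ := exists_H2R_form_pos (c := fun x => D.g * deriv D.ρ x)
    (BddSmooth.memLp_top fun n => (hD.bddSmooth_ρ.deriv n).const_mul _) (D.M ^ 2) u (by linarith)
  refine ⟨v, ?_⟩
  rw [hD.vcDenom_eq]
  simpa only [mul_assoc, integral_const_mul] using hv

lemma _root_.RTMHD.RTData.solvable_ne_zero {ξ : Freq} (h : ξ ∈ D.solvable) : ξ ≠ 0 := by
  unfold solvable at h
  cases hdir : D.dir with
  | horizontal =>
    rw [hdir] at h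
    exact h.2
  | vertical =>
    rw [hdir] at h
    rintro rfl
    have h1 : D.xiVc < ‖(0 : Freq)‖ := h
    rw [norm_zero] at h1
    exact absurd (Real.sqrt_nonneg _) (not_le.2 h1)

/-- The critical frequencies are thresholds for this sign. In the horizontal case with `ξ₁ ≠ 0`,
`|ξ| < S(ξ)` is negativity of `E₀` up to the factor `-(M ξ₁)²/|ξ|²`. With `ξ₁ = 0` the magnetic term
disappears and gravity alone decides. In the vertical case `|ξ| > |ξ|_vc` bounds the `ψ''` term by
`vcDenom`. -/
lemma exists_E0_neg (hD : D.Admissible) {ξ : Freq} (h : ξ ∈ D.solvable) :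
    ∃ ψ : H2R, D.E0 ξ ψ < 0 := by
  have hξ := solvable_ne_zero h
  have hk : 0 < ‖ξ‖ := norm_pos_iff.2 hξ
  have hg := hD.g_pos
  unfold solvable at h
  cases hdir : D.dir with
  | horizontal =>
    rw [hdir] at h
    rcases h.1 with h1 | h1
    · obtain ⟨h1, -, h3⟩ := h1
      have hx : D.M * ξ 0 ≠ 0 := by
        intro h0
        rw [mul_comm, h0] at h1
        simp at h1
      have h4 : ‖ξ‖ ^ 2 < _ := (Real.lt_sqrt hk.le).1 h3
      -- The set is nonempty because the supremum of the empty set is `0` by convention, which is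
      -- not above `|ξ|²`.
      obtain ⟨r, ⟨u, hu0, rfl⟩, hr⟩ := exists_lt_of_lt_csSup (by
        rw [Set.nonempty_iff_ne_empty]
        intro he
        rw [he, Real.sSup_empty] at h4
        exact absurd (sq_nonneg _) (not_le.2 h4)) h4
      have hu : 0 < ∫ x, u.f x ^ 2 := by
        refine lt_of_le_of_ne (integral_sq_nonneg _) fun h0 => ?_
        rw [← h0, div_zero] at hr
        exact absurd (sq_nonneg _) (not_le.2 hr)
      rw [lt_div_iff₀ hu] at hr
      have hx2 : 0 < (D.M * ξ 0) ^ 2 := by positivity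
      have form : ∀ w : H1R, ∫ x, (D.g * ‖ξ‖ ^ 2 / (D.M * ξ 0) ^ 2 * deriv D.ρ x + -‖ξ‖ ^ 2)
            * w.f x ^ 2
          = D.g * ‖ξ‖ ^ 2 / (D.M * ξ 0) ^ 2 * (∫ x, deriv D.ρ x * w.f x ^ 2)
            + -‖ξ‖ ^ 2 * ∫ x, w.f x ^ 2 := fun w => by
        rw [← integral_comb₂ (hD.integrable_ρ'_mul_sq w.memLp_f)
          (integrable_sq_of_memLp_two w.memLp_f)]
        exact integral_congr_ae (Eventually.of_forall fun x => by ring)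
      obtain ⟨v, hv⟩ := exists_H2R_form_pos
        (c := fun x => D.g * ‖ξ‖ ^ 2 / (D.M * ξ 0) ^ 2 * deriv D.ρ x + -‖ξ‖ ^ 2)
        (BddSmooth.memLp_top fun n => ((hD.bddSmooth_ρ.deriv n).const_mul _).add (Bdd.const _)) 1 u
        (by
          rw [form]
          have e : D.g * ‖ξ‖ ^ 2 / (D.M * ξ 0) ^ 2 * (∫ x, deriv D.ρ x * u.f x ^ 2)
            = D.g * ‖ξ‖ ^ 2 * (∫ x, deriv D.ρ x * u.f x ^ 2) / (D.M * ξ 0) ^ 2 := by ring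
          rw [e]
          linarith)
      refine ⟨v, ?_⟩
      rw [form] at hv
      rw [hD.E0_eq]
      simp only [e0, e1, e2, hdir]
      have e : D.M ^ 2 * ξ 0 ^ 2 * (∫ x, v.f x ^ 2)
          + D.M ^ 2 * ξ 0 ^ 2 / ‖ξ‖ ^ 2 * (∫ x, v.d1 x ^ 2) + 0 * (∫ x, v.d2 x ^ 2)
          - D.g * (∫ x, deriv D.ρ x * v.f x ^ 2)
          = -((D.M * ξ 0) ^ 2 / ‖ξ‖ ^ 2 * (D.g * ‖ξ‖ ^ 2 / (D.M * ξ 0) ^ 2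
            * (∫ x, deriv D.ρ x * v.f x ^ 2) + -‖ξ‖ ^ 2 * (∫ x, v.f x ^ 2)
            - 1 * ∫ x, v.d1 x ^ 2)) := by
        have hM : D.M ≠ 0 := left_ne_zero_of_mul hx
        have hx0 : ξ 0 ≠ 0 := right_ne_zero_of_mul hx
        field_simp
        ring
      rw [e, neg_lt_zero]
      positivity
    · have h1' : ξ 0 = 0 := h1
      obtain ⟨ψ, hψ⟩ := hD.exists_integral_ρ'_pos
      refine ⟨ψ, ?_⟩
      rw [hD.E0_eq]
      simp only [e0, e1, e2, hdir, h1']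
      have := mul_pos hg hψ
      simp only [ne_eq, OfNat.ofNat_ne_zero, not_false_eq_true, zero_pow, mul_zero, zero_div, zero_mul]
      linarith
  | vertical =>
    rw [hdir] at h
    have h1 : D.xiVc < ‖ξ‖ := h
    rw [xiVc, Real.sqrt_lt' hk] at h1
    obtain ⟨ψ₀, hψ₀⟩ := hD.exists_vcDenom_pos hdir
    obtain ⟨r, ⟨ψ, hψ, rfl⟩, hr⟩ := exists_lt_of_csInf_lt
      (Set.nonempty_of_mem (show _ ∈ {r : ℝ | ∃ ψ : H2R, 0 < D.vcDenom ψ ∧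
        r = D.M ^ 2 * (∫ x, ψ.d2 x ^ 2) / D.vcDenom ψ} from ⟨ψ₀, hψ₀, rfl⟩)) h1
    refine ⟨ψ, ?_⟩
    rw [div_lt_iff₀ hψ, hD.vcDenom_eq] at hr
    rw [hD.E0_eq]
    simp only [e0, e1, e2, hdir]
    have h2 : D.M ^ 2 / ‖ξ‖ ^ 2 * (∫ x, ψ.d2 x ^ 2) < D.g * (∫ x, deriv D.ρ x * ψ.f x ^ 2)
        - D.M ^ 2 * ∫ x, ψ.d1 x ^ 2 := by
      rw [div_mul_eq_mul_div, div_lt_iff₀ (by positivity)]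
      linarith
    linarith

/-! ### The eigenfunction -/

/-- At the growth rate, the Euler-Lagrange equation of the variational problem has a nonzero smooth
solution. -/
lemma exists_eigenfunction (hD : D.Admissible) {ξ : Freq} (hξ : ξ ≠ 0) {s : ℝ}
    (hs : D.IsGrowthRate ξ s) : ∃ y, SobSmooth y ∧ y ≠ 0 ∧ ∀ x,
      (‖ξ‖ ^ 2 * D.e2 ξ + s * D.μ) * deriv (deriv (deriv (deriv y))) x
        = s ^ 2 * deriv D.ρ x * deriv y x
          + (‖ξ‖ ^ 2 * D.e1 ξ + 2 * s * D.μ * ‖ξ‖ ^ 2 + s ^ 2 * D.ρ x) * deriv (deriv y) x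
          - (‖ξ‖ ^ 2 * D.e0 ξ + s * D.μ * ‖ξ‖ ^ 4 + s ^ 2 * ‖ξ‖ ^ 2 * D.ρ x
            - D.g * ‖ξ‖ ^ 2 * deriv D.ρ x) * y x := by
  obtain ⟨hs0, hs2⟩ := isGrowthRate_sq hs
  have hμ := hD.μ_pos
  have hk : 0 < ‖ξ‖ := norm_pos_iff.2 hξ
  obtain ⟨c, hc, hc'⟩ := hD.ρ_pos
  obtain ⟨B, hB⟩ := hD.ρ_bdd
  have hB0 : 0 < B := hc.trans_le ((hc' 0).trans ((le_abs_self _).trans (hB 0)))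
  have p0 := D.e0_nonneg ξ
  have p1 := D.e1_nonneg ξ
  have p2 := D.e2_nonneg ξ
  have hρ : ∀ x, 0 < D.ρ x := fun x => hc.trans_le (hc' x)
  have b1 : BddSmooth fun x => (‖ξ‖ ^ 2 * D.e1 ξ + 2 * s * D.μ * ‖ξ‖ ^ 2) + s ^ 2 * D.ρ x :=
    fun n => (Bdd.const _).add ((hD.bddSmooth_ρ n).const_mul _)
  have b0 : BddSmooth fun x => (‖ξ‖ ^ 2 * D.e0 ξ + s * D.μ * ‖ξ‖ ^ 4) + s ^ 2 * ‖ξ‖ ^ 2 * D.ρ x :=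
    fun n => (Bdd.const _).add ((hD.bddSmooth_ρ n).const_mul _)
  -- A common lower bound of the viscous contributions to the three coefficients; the magnetic and
  -- density contributions are nonnegative.
  set m := min (s * D.μ) (min (2 * s * D.μ * ‖ξ‖ ^ 2) (s * D.μ * ‖ξ‖ ^ 4)) with hm
  have hm0 : 0 < m := lt_min (by positivity) (lt_min (by positivity) (by positivity))
  have hm1 : m ≤ s * D.μ := min_le_left _ _
  have hm2 : m ≤ 2 * s * D.μ * ‖ξ‖ ^ 2 := (min_le_right _ _).trans (min_le_left _ _)
  have hm3 : m ≤ s * D.μ * ‖ξ‖ ^ 4 := (min_le_right _ _).trans (min_le_right _ _)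
  obtain ⟨y, hy, hy0, hode⟩ := exists_smooth_kernel (c₂ := ‖ξ‖ ^ 2 * D.e2 ξ + s * D.μ)
    (V := fun x => D.g * ‖ξ‖ ^ 2 * deriv D.ρ x) hm0 b1 b0
    (contDiff_const.mul hD.contDiff_ρ') hD.ρ'_supp.mul_left
    (by nlinarith [mul_nonneg (sq_nonneg ‖ξ‖) p2])
    (fun x => by
      have := mul_nonneg (sq_nonneg ‖ξ‖) p1
      have := mul_pos (pow_pos hs0 2) (hρ x)
      linarith)
    (fun x => by
      have := mul_nonneg (sq_nonneg ‖ξ‖) p0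
      have := mul_pos (mul_pos (pow_pos hs0 2) (pow_pos hk 2)) (hρ x)
      linarith)
    (fun ψ => by
      rw [← hD.E_add_mul_J]
      have := hD.α_mul_J_le ξ hs0.le ψ
      rw [hs2]
      linarith)
    (fun ε hε => by
      set N := B * (‖ξ‖ ^ 2 + 1) with hN
      have hN0 : 0 < N := by positivity
      obtain ⟨ψ₀, hψ₀⟩ := hD.exists_J_eq_one hξ
      -- A near-minimiser with `J = 1` has form value below `ε / N`. Since `J ≤ N ‖ψ‖²` in `H²`, the
      -- squared norm is at least `1 / N`, and the form is not coercive.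
      obtain ⟨r, ⟨ψ, hψ, rfl⟩, hr⟩ := exists_lt_of_csInf_lt
        (Set.nonempty_of_mem (show _ ∈ {r : ℝ | ∃ ψ : H2R, D.J ξ ψ = 1 ∧ r = D.E ξ s ψ} from
          ⟨ψ₀, hψ₀, rfl⟩)) (show D.α ξ s < D.α ξ s + ε / N by linarith [div_pos hε hN0])
      refine ⟨ψ, ?_⟩
      rw [← hD.E_add_mul_J, hψ]
      have hle : ∀ {f : ℝ → ℝ}, MemLp f 2 volume → ∫ x, D.ρ x * f x ^ 2 ≤ B * ∫ x, f x ^ 2 := by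
        intro f hf
        rw [← integral_const_mul]
        refine integral_mono (hD.integrable_ρ_mul_sq hf)
          ((integrable_sq_of_memLp_two hf).const_mul B) fun x => ?_
        exact mul_le_mul_of_nonneg_right ((le_abs_self _).trans (hB x)) (sq_nonneg _)
      have h0 := integral_sq_nonneg ψ.f
      have h1 := integral_sq_nonneg ψ.d1
      have h2 := integral_sq_nonneg ψ.d2
      set X := (∫ x, ψ.f x ^ 2) + (∫ x, ψ.d1 x ^ 2) + ∫ x, ψ.d2 x ^ 2 with hX
      have hJ : 1 ≤ N * X := by
        rw [hD.J_eq] at hψ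
        have q0 := mul_le_mul_of_nonneg_left (hle ψ.memLp_f) (sq_nonneg ‖ξ‖)
        have q1 := hle ψ.memLp_d1
        have q2 : 0 ≤ B * ‖ξ‖ ^ 2 * (∫ x, ψ.d1 x ^ 2) := by positivity
        have q3 : 0 ≤ N * (∫ x, ψ.d2 x ^ 2) := by positivity
        have q4 : 0 ≤ B * (∫ x, ψ.f x ^ 2) := by positivity
        have e : N * X = ‖ξ‖ ^ 2 * (B * ∫ x, ψ.f x ^ 2) + B * (∫ x, ψ.d1 x ^ 2)
            + B * ‖ξ‖ ^ 2 * (∫ x, ψ.d1 x ^ 2) + N * (∫ x, ψ.d2 x ^ 2)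
            + B * (∫ x, ψ.f x ^ 2) := by
          rw [hN, hX]
          ring
        linarith
      have h3 : ε / N ≤ ε * X := by
        rw [div_le_iff₀ hN0]
        nlinarith
      linarith)
  refine ⟨y, hy, hy0, fun x => ?_⟩
  have hd : deriv (fun x => (‖ξ‖ ^ 2 * D.e1 ξ + 2 * s * D.μ * ‖ξ‖ ^ 2) + s ^ 2 * D.ρ x) x
      = s ^ 2 * deriv D.ρ x := by
    rw [deriv_const_add, deriv_const_mul _ (hD.ρ_smooth.differentiable (by simp) x)]
  rw [hode x, hd]

end RTData.Admissible

/-! ### Normal modes -/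

/-- The function `f(x₃) cos(a x₁ + b x₂ + c)`. -/
def mode (a b c : ℝ) (f : ℝ → ℝ) (x : Fin 3 → ℝ) : ℝ :=
  f (x 2) * Real.cos (a * x 0 + b * x 1 + c)

section mode

variable {a b c : ℝ} {f : ℝ → ℝ}

lemma hasFDerivAt_mode (hf : Differentiable ℝ f) (x : Fin 3 → ℝ) :
    HasFDerivAt (mode a b c f)
      (f (x 2) • (-Real.sin (a * x 0 + b * x 1 + c)) •
        (a • ContinuousLinearMap.proj (R := ℝ) (φ := fun _ : Fin 3 => ℝ) 0
          + b • ContinuousLinearMap.proj (R := ℝ) (φ := fun _ : Fin 3 => ℝ) 1)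
        + Real.cos (a * x 0 + b * x 1 + c) •
          deriv f (x 2) • ContinuousLinearMap.proj (R := ℝ) (φ := fun _ : Fin 3 => ℝ) 2) x := by
  have p : ∀ i : Fin 3, HasFDerivAt (fun y : Fin 3 → ℝ => y i)
      (ContinuousLinearMap.proj (R := ℝ) (φ := fun _ : Fin 3 => ℝ) i) x :=
    fun i => hasFDerivAt_apply i x
  have h1 := (hf (x 2)).hasDerivAt.comp_hasFDerivAt x (p 2)
  have h2 : HasFDerivAt (fun y : Fin 3 → ℝ => a * y 0 + b * y 1 + c)
      (a • ContinuousLinearMap.proj (R := ℝ) (φ := fun _ : Fin 3 => ℝ) 0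
          + b • ContinuousLinearMap.proj (R := ℝ) (φ := fun _ : Fin 3 => ℝ) 1) x :=
    (((p 0).const_mul a).add ((p 1).const_mul b)).add_const c
  exact h1.mul h2.cos

lemma pd_mode_zero (hf : Differentiable ℝ f) :
    pd 0 (mode a b c f) = fun x => a * mode a b (c + Real.pi / 2) f x := by
  funext x
  rw [pd, (hasFDerivAt_mode hf x).fderiv, mode, ← add_assoc, Real.cos_add_pi_div_two]
  simp
  ring

lemma pd_mode_one (hf : Differentiable ℝ f) :
    pd 1 (mode a b c f) = fun x => b * mode a b (c + Real.pi / 2) f x := by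
  funext x
  rw [pd, (hasFDerivAt_mode hf x).fderiv, mode, ← add_assoc, Real.cos_add_pi_div_two]
  simp
  ring

lemma pd_mode_two (hf : Differentiable ℝ f) :
    pd 2 (mode a b c f) = mode a b c (deriv f) := by
  funext x
  rw [pd, (hasFDerivAt_mode hf x).fderiv, mode]
  simp
  ring

lemma contDiff_mode (hf : ContDiff ℝ ∞ f) : ContDiff ℝ ∞ (mode a b c f) := by
  have p : ∀ i : Fin 3, ContDiff ℝ ∞ (fun y : Fin 3 → ℝ => y i) := fun i => contDiff_apply ℝ ℝ i
  exact (hf.comp (p 2)).mul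
    (((contDiff_const.mul (p 0)).add (contDiff_const.mul (p 1))).add contDiff_const).cos

lemma horPeriodic_mode {L : ℝ} (hL : 0 < L) (ha : ∃ n : ℤ, a = n / L) (hb : ∃ n : ℤ, b = n / L) :
    HorPeriodic L (mode a b c f) := by
  obtain ⟨n, rfl⟩ := ha
  obtain ⟨m, rfl⟩ := hb
  intro x
  constructor
  · have h1 : (n / L : ℝ) * (x 0 + 2 * Real.pi * L) + m / L * x 1 + c
        = (n / L * x 0 + m / L * x 1 + c) + n * (2 * Real.pi) := by
      field_simp
      ring
    simp [mode, h1, Real.cos_add_int_mul_two_pi]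
  · have h1 : (n / L : ℝ) * x 0 + m / L * (x 1 + 2 * Real.pi * L) + c
        = (n / L * x 0 + m / L * x 1 + c) + m * (2 * Real.pi) := by
      field_simp
      ring
    simp [mode, h1, Real.cos_add_int_mul_two_pi]

lemma tendsto_mode (hf : SobSmooth f) (x₁ x₂ : ℝ) :
    Tendsto (fun x₃ => mode a b c f ![x₁, x₂, x₃]) (cocompact ℝ) (𝓝 0) := by
  have := hf.tendsto_zero.mul_const (Real.cos (a * x₁ + b * x₂ + c))
  simpa [mode] using this

end mode

/-- `F` is a mode of horizontal frequency `(a, b)` with a smooth decaying profile. -/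
def IsMode (a b : ℝ) (F : (Fin 3 → ℝ) → ℝ) : Prop := ∃ c f, SobSmooth f ∧ F = mode a b c f

namespace IsMode

variable {a b : ℝ} {F : (Fin 3 → ℝ) → ℝ}

lemma const_mul (r : ℝ) (h : IsMode a b F) : IsMode a b (fun x => r * F x) := by
  obtain ⟨c, f, hf, rfl⟩ := h
  exact ⟨c, _, hf.const_mul r, by funext x; simp only [mode]; ring⟩

/-- A horizontal derivative shifts the phase by `π/2`, the vertical one acts on the profile. Leaving
phase and profile free makes the class stable under all derivatives, so it controls every `Hᵏ` norm.
-/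
lemma pd (i : Fin 3) (h : IsMode a b F) : IsMode a b (pd i F) := by
  obtain ⟨c, f, hf, rfl⟩ := h
  have m : ∀ c' f', SobSmooth f' → IsMode a b (mode a b c' f') := fun c' f' h => ⟨c', f', h, rfl⟩
  fin_cases i
  · exact (pd_mode_zero (hf 1).1).symm ▸ (m _ _ hf).const_mul a
  · exact (pd_mode_one (hf 1).1).symm ▸ (m _ _ hf).const_mul b
  · exact (pd_mode_two (hf 1).1).symm ▸ m _ _ hf.deriv

lemma iterate_pd (i : Fin 3) (n : ℕ) (h : IsMode a b F) : IsMode a b ((RTMHD.pd i)^[n] F) := by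
  induction n generalizing F with
  | zero => exact h
  | succ n ih => exact ih (h.pd i)

lemma mpd (α : Fin 3 → ℕ) (h : IsMode a b F) : IsMode a b (mpd α F) :=
  ((h.iterate_pd 2 _).iterate_pd 1 _).iterate_pd 0 _

lemma contDiff (h : IsMode a b F) : ContDiff ℝ ∞ F := by
  obtain ⟨c, f, hf, rfl⟩ := h
  exact contDiff_mode hf.contDiff

lemma horPeriodic {L : ℝ} (hL : 0 < L) (ha : ∃ n : ℤ, a = n / L) (hb : ∃ n : ℤ, b = n / L)
    (h : IsMode a b F) : HorPeriodic L F := by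
  obtain ⟨c, f, hf, rfl⟩ := h
  exact horPeriodic_mode hL ha hb

lemma tendsto (h : IsMode a b F) (x₁ x₂ : ℝ) :
    Tendsto (fun x₃ => F ![x₁, x₂, x₃]) (cocompact ℝ) (𝓝 0) := by
  obtain ⟨c, f, hf, rfl⟩ := h
  exact tendsto_mode hf x₁ x₂

end IsMode

section mode

variable {a b c : ℝ} {f : ℝ → ℝ}

/-- Since `cos² ≤ 1`, the integrand on the cell is dominated by a product of one-variable integrable
functions. -/
lemma lintegral_mode_lt_top (L : ℝ) (hf : SobSmooth f) :
    ∫⁻ x in cell L, ENNReal.ofReal (mode a b c f x ^ 2) < ⊤ := by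
  let I : ℝ → ℝ := (Set.Ioo 0 (2 * Real.pi * L)).indicator fun _ => 1
  have hI : Integrable I :=
    (integrable_indicator_iff measurableSet_Ioo).2 (by simp [integrableOn_const_iff])
  let F : Fin 3 → ℝ → ℝ := ![I, I, fun z => f z ^ 2]
  have hF : Integrable (fun x : Fin 3 → ℝ => ∏ i, F i (x i)) volume := by
    refine Integrable.fintype_prod fun i => ?_
    fin_cases i
    · exact hI
    · exact hI
    · exact hf.memLp.integrable_sq
  have hcell : MeasurableSet (cell L) :=
    ((measurable_pi_apply 0) measurableSet_Ioo).inter ((measurable_pi_apply 1) measurableSet_Ioo)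
  rw [← lintegral_indicator hcell]
  refine lt_of_le_of_lt (lintegral_mono fun x => ?_) hF.lintegral_lt_top
  by_cases hx : x ∈ cell L
  · rw [Set.indicator_of_mem hx]
    refine ENNReal.ofReal_le_ofReal ?_
    have h0 : I (x 0) = 1 := Set.indicator_of_mem hx.1 _
    have h1 : I (x 1) = 1 := Set.indicator_of_mem hx.2 _
    simp only [Fin.prod_univ_three, F, Matrix.cons_val_zero, Matrix.cons_val_one, h0, h1, one_mul,
      Matrix.cons_val, mode, mul_pow]
    exact mul_le_of_le_one_right (sq_nonneg _) (Real.cos_sq_le_one _)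
  · rw [Set.indicator_of_notMem hx]
    exact bot_le

end mode

/-! ### Sobolev norms of modes -/

lemma hNorm_lt_top {L : ℝ} {k n : ℕ} {F : Fin n → (Fin 3 → ℝ) → ℝ} {a b : ℝ}
    (h : ∀ i, IsMode a b (F i)) : hNorm L k F < ⊤ := by
  refine ENNReal.rpow_lt_top_of_nonneg (by norm_num) ?_
  refine (ENNReal.sum_lt_top.2 fun i _ => ENNReal.sum_lt_top.2 fun j _ =>
    ENNReal.sum_lt_top.2 fun α _ => ?_).ne
  obtain ⟨c', f', hf', e'⟩ := (h i).mpd α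
  rw [e']
  exact lintegral_mode_lt_top L hf'

lemma pd_const_mul (r : ℝ) (i : Fin 3) (f : (Fin 3 → ℝ) → ℝ) :
    pd i (fun x => r * f x) = fun x => r * pd i f x := by
  funext x
  have : (fun x => r * f x) = r • f := rfl
  rw [pd, this, fderiv_const_smul_field]
  rfl

lemma iterate_pd_const_mul (r : ℝ) (i : Fin 3) (n : ℕ) (f : (Fin 3 → ℝ) → ℝ) :
    (pd i)^[n] (fun x => r * f x) = fun x => r * (pd i)^[n] f x := by
  induction n generalizing f with
  | zero => rfl
  | succ n ih => rw [Function.iterate_succ_apply, pd_const_mul, ih, Function.iterate_succ_apply]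

lemma mpd_const_mul (r : ℝ) (α : Fin 3 → ℕ) (f : (Fin 3 → ℝ) → ℝ) :
    mpd α (fun x => r * f x) = fun x => r * mpd α f x := by
  rw [mpd, iterate_pd_const_mul, iterate_pd_const_mul, iterate_pd_const_mul, mpd]

/-- This homogeneity is the whole growth law: time enters the solution only through a positive
scalar factor. -/
lemma hNorm_const_mul {L : ℝ} {k n : ℕ} {F G : Fin n → (Fin 3 → ℝ) → ℝ} {r : ℝ} (hr : 0 ≤ r)
    (h : ∀ i, F i = fun x => r * G i x) : hNorm L k F = ENNReal.ofReal r * hNorm L k G := by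
  have e : ∀ i α, ∫⁻ x in cell L, ENNReal.ofReal (mpd α (F i) x ^ 2)
      = ENNReal.ofReal (r ^ 2) * ∫⁻ x in cell L, ENNReal.ofReal (mpd α (G i) x ^ 2) := by
    intro i α
    rw [← lintegral_const_mul' _ _ ENNReal.ofReal_ne_top, h i, mpd_const_mul]
    simp only [mul_pow, ENNReal.ofReal_mul (sq_nonneg r)]
  simp only [hNorm, e, ← Finset.mul_sum]
  rw [ENNReal.mul_rpow_of_nonneg _ _ (by norm_num),
    ENNReal.ofReal_rpow_of_nonneg (sq_nonneg _) (by norm_num), ← Real.sqrt_eq_rpow,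
    Real.sqrt_sq hr]

lemma lintegral_cell_pos {L : ℝ} {f : (Fin 3 → ℝ) → ℝ} (hf : Continuous f) {x : Fin 3 → ℝ}
    (hx : x ∈ cell L) (h : f x ≠ 0) : 0 < ∫⁻ y in cell L, ENNReal.ofReal (f y ^ 2) := by
  have hop : IsOpen (cell L) :=
    (isOpen_Ioo.preimage (continuous_apply 0)).inter (isOpen_Ioo.preimage (continuous_apply 1))
  have hm : Measurable fun y => ENNReal.ofReal (f y ^ 2) :=
    ENNReal.measurable_ofReal.comp (hf.pow 2).measurable
  rw [setLIntegral_pos_iff hm]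
  have hs : Function.support (fun y => ENNReal.ofReal (f y ^ 2)) = {y | f y ≠ 0} := by
    ext y
    simp [Function.mem_support]
  rw [hs]
  exact ((isOpen_ne_fun hf continuous_const).inter hop).measure_pos volume ⟨x, h, hx⟩

lemma hNorm_zero_pos {L : ℝ} {n : ℕ} {F : Fin n → (Fin 3 → ℝ) → ℝ} (i : Fin n)
    (hf : Continuous (F i)) {x : Fin 3 → ℝ} (hx : x ∈ cell L) (h : F i x ≠ 0) :
    0 < hNorm L 0 F := by
  refine ENNReal.rpow_pos_of_nonneg ?_ (by norm_num)
  refine lt_of_lt_of_le (lintegral_cell_pos hf hx h) ?_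
  refine le_trans ?_ (Finset.single_le_sum (fun _ _ => bot_le) (Finset.mem_univ i))
  simp [mpd, Finset.Nat.antidiagonalTuple_zero_right]

/-! ### Exponentially growing solutions -/

/-- `e^{st} (R, U, N, Q)` solves the linearized equations. -/
structure IsEigenmode (D : RTData) (s : ℝ) (R : (Fin 3 → ℝ) → ℝ)
    (U N : Fin 3 → (Fin 3 → ℝ) → ℝ) (Q : (Fin 3 → ℝ) → ℝ) : Prop where
  continuity : ∀ x, s * R x + deriv D.ρ (x 2) * U 2 x = 0
  momentum : ∀ x, (fun i => D.ρ (x 2) * (s * U i x)) + grad Q x + (D.g * R x) • ![0, 0, 1]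
      = D.μ • (fun i => lap (U i) x) + curl (fun y i => N i y) x ⨯₃ D.Mbar
  induction : ∀ x, (fun i => s * N i x) = curl (fun y => (fun i => U i y) ⨯₃ D.Mbar) x
  div_u : ∀ x, div (fun y i => U i y) x = 0
  div_N : ∀ x, div (fun y i => N i y) x = 0

lemma lap_const_mul (r : ℝ) (f : (Fin 3 → ℝ) → ℝ) (x : Fin 3 → ℝ) :
    lap (fun y => r * f y) x = r * lap f x := by
  simp only [lap, pd_const_mul, Finset.mul_sum]

lemma div_const_mul (r : ℝ) (F : Fin 3 → (Fin 3 → ℝ) → ℝ) (x : Fin 3 → ℝ) :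
    div (fun y i => r * F i y) x = r * div (fun y i => F i y) x := by
  simp only [div, pd_const_mul, Finset.mul_sum]

lemma grad_const_mul (r : ℝ) (f : (Fin 3 → ℝ) → ℝ) (x : Fin 3 → ℝ) :
    grad (fun y => r * f y) x = r • grad f x := by
  funext i
  simp only [grad, pd_const_mul, Pi.smul_apply, smul_eq_mul]

lemma curl_const_mul (r : ℝ) (F : (Fin 3 → ℝ) → Fin 3 → ℝ) (x : Fin 3 → ℝ) :
    curl (fun y i => r * F y i) x = r • curl F x := by
  funext i
  fin_cases i <;> simp [curl, pd_const_mul, mul_sub]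

lemma deriv_exp_mul_const (s r t : ℝ) :
    deriv (fun τ => Real.exp (s * τ) * r) t = Real.exp (s * t) * (s * r) := by
  have h : HasDerivAt (fun τ => Real.exp (s * τ) * r) (Real.exp (s * t) * (s * 1) * r) t :=
    (((hasDerivAt_id t).const_mul s).exp).mul_const r
  rw [h.deriv]
  ring

lemma deriv_exp_mul_const_pi (s t : ℝ) (r : Fin 3 → ℝ) :
    deriv (fun τ i => Real.exp (s * τ) * r i) t = Real.exp (s * t) • fun i => s * r i := by
  have h : ∀ i, DifferentiableAt ℝ (fun τ => Real.exp (s * τ) * r i) t := fun i => by fun_prop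
  rw [deriv_pi h]
  funext i
  rw [deriv_exp_mul_const]
  rfl

/-- Every spatial operator in the system commutes with the factor `exp (s * t)`, and the time
derivative multiplies by `s`. -/
lemma IsEigenmode.isSolution {D : RTData} {s a b : ℝ} {R Q : (Fin 3 → ℝ) → ℝ}
    {U N : Fin 3 → (Fin 3 → ℝ) → ℝ} (h : IsEigenmode D s R U N Q) (hL : 0 < D.L)
    (ha : ∃ n : ℤ, a = n / D.L) (hb : ∃ n : ℤ, b = n / D.L)
    (hR : IsMode a b R) (hU : ∀ i, IsMode a b (U i)) (hN : ∀ i, IsMode a b (N i))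
    (hQ : IsMode a b Q) :
    IsSolution D (fun t x => Real.exp (s * t) * R x) (fun t x i => Real.exp (s * t) * U i x)
      (fun t x i => Real.exp (s * t) * N i x) (fun t x => Real.exp (s * t) * Q x) := by
  have smooth : ∀ F : (Fin 3 → ℝ) → ℝ, IsMode a b F →
      ContDiffOn ℝ ∞ (fun p : ℝ × (Fin 3 → ℝ) => Real.exp (s * p.1) * F p.2)
        (Set.Ici 0 ×ˢ Set.univ) := fun F hF =>
    ((contDiff_const.mul contDiff_fst).exp.mul (hF.contDiff.comp contDiff_snd)).contDiffOn
  have per : ∀ F : (Fin 3 → ℝ) → ℝ, IsMode a b F → ∀ t,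
      HorPeriodic D.L (fun x => Real.exp (s * t) * F x) := fun F hF t =>
    (hF.const_mul _).horPeriodic hL ha hb
  refine ⟨smooth R hR, contDiffOn_pi.2 fun i => smooth _ (hU i),
    contDiffOn_pi.2 fun i => smooth _ (hN i), smooth Q hQ, fun t _ => per R hR t,
    fun t _ i => per _ (hU i) t, fun t _ i => per _ (hN i) t, fun t _ => per Q hQ t,
    fun t _ x => ?_, fun t _ x => ?_, fun t _ x => ?_, fun t _ x => ?_, fun t _ x => ?_,
    fun t _ x₁ x₂ => (hR.const_mul _).tendsto x₁ x₂,
    fun t _ x₁ x₂ => tendsto_pi_nhds.2 fun i => ((hU i).const_mul _).tendsto x₁ x₂,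
    fun t _ x₁ x₂ => tendsto_pi_nhds.2 fun i => ((hN i).const_mul _).tendsto x₁ x₂⟩
  · simp only [deriv_exp_mul_const]
    linear_combination Real.exp (s * t) * h.continuity x
  · funext i
    have e := congrFun (h.momentum x) i
    simp only [deriv_exp_mul_const_pi s t (fun i => U i x), grad_const_mul, lap_const_mul,
      curl_const_mul (Real.exp (s * t)) (fun y i => N i y), map_smul, LinearMap.smul_apply,
      Pi.add_apply, Pi.smul_apply, smul_eq_mul] at e ⊢
    linear_combination Real.exp (s * t) * e
  · have e := congrArg (fun v => Real.exp (s * t) • v) (h.induction x)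
    simp only [deriv_exp_mul_const_pi s t (fun i => N i x)]
    refine e.trans ?_
    rw [← curl_const_mul]
    congr 1
    funext y
    have e' := LinearMap.congr_fun
      (map_smul crossProduct (Real.exp (s * t)) fun i => U i y) D.Mbar
    exact e'.symm
  · rw [div_const_mul, h.div_u, mul_zero]
  · rw [div_const_mul, h.div_N, mul_zero]

/-! ### Normal modes from solutions of the ordinary differential equation -/

/-- The velocity field with vertical profile `y`, `y' = y₁`; here `(A, B) = ξ / |ξ|²`. -/
def velocityMode (a b A B c : ℝ) (y y₁ : ℝ → ℝ) : Fin 3 → (Fin 3 → ℝ) → ℝ :=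
  ![fun x => A * mode a b (c + Real.pi / 2) y₁ x, fun x => B * mode a b (c + Real.pi / 2) y₁ x,
    mode a b c y]

/-- The perturbed magnetic field generated by `velocityMode`; here `m` is the field strength divided
by the growth rate. -/
def magneticMode (d : FieldDir) (a b A B c m : ℝ) (y y₁ y₂ : ℝ → ℝ) : Fin 3 → (Fin 3 → ℝ) → ℝ :=
  match d with
  | .horizontal => ![fun x => -(m * a * A) * mode a b c y₁ x, fun x => -(m * a * B) * mode a b c y₁ x,
      fun x => m * a * mode a b (c + Real.pi / 2) y x]
  | .vertical => ![fun x => m * A * mode a b (c + Real.pi / 2) y₂ x,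
      fun x => m * B * mode a b (c + Real.pi / 2) y₂ x, fun x => m * mode a b c y₁ x]

/-! ### Reduction of the linearized equations to one ordinary differential equation -/

lemma curl_cross_e1 (M : ℝ) (U : Fin 3 → (Fin 3 → ℝ) → ℝ) (x : Fin 3 → ℝ) :
    curl (fun y => (fun i => U i y) ⨯₃ ![M, 0, 0]) x
      = ![-M * (pd 1 (U 1) x + pd 2 (U 2) x), M * pd 0 (U 1) x, M * pd 0 (U 2) x] := by
  have h0 : ∀ i, pd i (fun _ => (0 : ℝ)) = fun _ => 0 := fun i => by
    simpa using pd_const_mul 0 i fun _ => 0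
  have h2 : ∀ i, pd i (fun y => -(M * U 1 y)) = fun y => -M * pd i (U 1) y := fun i => by
    rw [← pd_const_mul]
    congr 1
    funext y
    ring
  simp only [curl, cross_apply, Matrix.cons_val, mul_zero, sub_zero, zero_sub, h0, h2,
    mul_comm _ M, pd_const_mul]
  funext i
  fin_cases i <;> simp
  all_goals ring

lemma curl_cross_e3 (M : ℝ) (U : Fin 3 → (Fin 3 → ℝ) → ℝ) (x : Fin 3 → ℝ) :
    curl (fun y => (fun i => U i y) ⨯₃ ![0, 0, M]) x
      = ![M * pd 2 (U 0) x, M * pd 2 (U 1) x, -M * (pd 0 (U 0) x + pd 1 (U 1) x)] := by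
  have h0 : ∀ i, pd i (fun _ => (0 : ℝ)) = fun _ => 0 := fun i => by
    simpa using pd_const_mul 0 i fun _ => 0
  have h2 : ∀ i, pd i (fun y => -(M * U 0 y)) = fun y => -M * pd i (U 0) y := fun i => by
    rw [← pd_const_mul]
    congr 1
    funext y
    ring
  simp only [curl, cross_apply, Matrix.cons_val, mul_zero, sub_zero, zero_sub, h0, h2,
    mul_comm _ M, pd_const_mul]
  funext i
  fin_cases i <;> simp
  all_goals ring

section eigenmode

variable {D : RTData} {k A B c s m : ℝ} {y y₁ y₂ y₃ y₄ p p₁ r : ℝ → ℝ}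

set_option linter.unusedSimpArgs false in
-- Here `k = |ξ|²` and `ξ = k (A, B)`, so `hab` is the normalisation behind incompressibility. The
-- Lorentz force is vertical, because the third component of the curl of the magnetic mode cancels;
-- hence the pressure `hkp`, read off from horizontal momentum, has only viscous and inertial terms.
-- `hode` is vertical momentum with all other unknowns eliminated.
lemma isEigenmode_horizontal (hdir : D.dir = .horizontal) (hk : k ≠ 0) (hs : s ≠ 0)
    (hab : k * (A ^ 2 + B ^ 2) = 1) (hM : D.M = s * m)
    (hy : ∀ z, HasDerivAt y (y₁ z) z) (hy₁ : ∀ z, HasDerivAt y₁ (y₂ z) z)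
    (hy₂ : ∀ z, HasDerivAt y₂ (y₃ z) z) (hp : ∀ z, HasDerivAt p (p₁ z) z)
    (hr : ∀ z, s * r z = -(deriv D.ρ z * y z))
    (hkp : ∀ z, k * p z = -(s * D.ρ z * y₁ z) + D.μ * (y₃ z - k * y₁ z))
    (hkp₁ : ∀ z, k * p₁ z = -(s * (deriv D.ρ z * y₁ z + D.ρ z * y₂ z))
      + D.μ * (y₄ z - k * y₂ z))
    (hode : ∀ z, s * D.μ * y₄ z = s ^ 2 * deriv D.ρ z * y₁ z
      + (D.M ^ 2 * (k * A) ^ 2 + 2 * s * D.μ * k + s ^ 2 * D.ρ z) * y₂ z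
      - (k * (D.M ^ 2 * (k * A) ^ 2) + s * D.μ * k ^ 2 + s ^ 2 * k * D.ρ z
        - D.g * k * deriv D.ρ z) * y z) :
    IsEigenmode D s (mode (k * A) (k * B) c r) (velocityMode (k * A) (k * B) A B c y y₁)
      (magneticMode .horizontal (k * A) (k * B) A B c m y y₁ y₂) (mode (k * A) (k * B) c p) := by
  have d : ∀ {f f' : ℝ → ℝ}, (∀ z, HasDerivAt f (f' z) z) → Differentiable ℝ f ∧ deriv f = f' :=
    fun h => ⟨fun z => (h z).differentiableAt, funext fun z => (h z).deriv⟩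
  have hMb : D.Mbar = ![D.M, 0, 0] := by rw [RTData.Mbar, hdir]
  have P := fun e => pd_mode_zero (a := k * A) (b := k * B) (c := e) (d hy).1
  have P1 := fun e => pd_mode_zero (a := k * A) (b := k * B) (c := e) (d hy₁).1
  have P' := fun e => pd_mode_zero (a := k * A) (b := k * B) (c := e) (d hp).1
  have Q := fun e => pd_mode_one (a := k * A) (b := k * B) (c := e) (d hy).1
  have Q1 := fun e => pd_mode_one (a := k * A) (b := k * B) (c := e) (d hy₁).1
  have Q' := fun e => pd_mode_one (a := k * A) (b := k * B) (c := e) (d hp).1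
  have T := fun e => (pd_mode_two (a := k * A) (b := k * B) (c := e) (d hy).1)
  have T1 := fun e => (pd_mode_two (a := k * A) (b := k * B) (c := e) (d hy₁).1)
  have T2 := fun e => (pd_mode_two (a := k * A) (b := k * B) (c := e) (d hy₂).1)
  have T' := fun e => (pd_mode_two (a := k * A) (b := k * B) (c := e) (d hp).1)
  simp only [(d hy).2, (d hy₁).2, (d hy₂).2, (d hp).2] at T T1 T2 T'
  refine ⟨fun x => ?_, fun x => ?_, fun x => ?_, fun x => ?_, fun x => ?_⟩
  · simp only [velocityMode, Matrix.cons_val, mode]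
    linear_combination Real.cos (k * A * x 0 + k * B * x 1 + c) * hr (x 2)
  · rw [hMb]
    funext i
    fin_cases i
    · simp [-neg_mul, velocityMode, magneticMode, grad, lap, curl, cross_apply, Fin.sum_univ_three,
        pd_const_mul, P, P1, P', Q, Q1, Q', T, T1, T2, T']
      simp only [mode, ← add_assoc, Real.cos_add_pi_div_two, Real.sin_add_pi_div_two]
      generalize Real.cos (k * A * x 0 + k * B * x 1 + c) = C
      generalize Real.sin (k * A * x 0 + k * B * x 1 + c) = S
      linear_combination (-S * A) * hkp (x 2) - D.μ * A * S * y₁ (x 2) * k * hab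
    · simp [-neg_mul, velocityMode, magneticMode, grad, lap, curl, cross_apply, Fin.sum_univ_three,
        pd_const_mul, P, P1, P', Q, Q1, Q', T, T1, T2, T']
      simp only [mode, ← add_assoc, Real.cos_add_pi_div_two, Real.sin_add_pi_div_two]
      generalize Real.cos (k * A * x 0 + k * B * x 1 + c) = C
      generalize Real.sin (k * A * x 0 + k * B * x 1 + c) = S
      linear_combination (-S * B) * hkp (x 2) - D.μ * B * S * y₁ (x 2) * k * hab
    · simp [-neg_mul, velocityMode, magneticMode, grad, lap, curl, cross_apply, Fin.sum_univ_three,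
        pd_const_mul, P, P1, P', Q, Q1, Q', T, T1, T2, T']
      simp only [mode, ← add_assoc, Real.cos_add_pi_div_two, Real.sin_add_pi_div_two]
      have hode := hode (x 2)
      rw [hM] at hode ⊢
      generalize Real.cos (k * A * x 0 + k * B * x 1 + c) = C
      -- The pressure gradient is known only as `k p'` and the density only as `s r`; multiplying by
      -- `k s` brings in both relations.
      refine mul_left_cancel₀ (mul_ne_zero hk hs) ?_
      linear_combination C * (s * hkp₁ (x 2) + D.g * k * hr (x 2) + hode
        + s * D.μ * k ^ 2 * y (x 2) * hab)
  · rw [hMb, curl_cross_e1]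
    funext i
    fin_cases i
    · simp [-neg_mul, velocityMode, magneticMode, pd_const_mul, P, P1, Q, Q1, T, T1]
      simp only [mode, ← add_assoc, Real.cos_add_pi_div_two, Real.sin_add_pi_div_two]
      generalize Real.cos (k * A * x 0 + k * B * x 1 + c) = C
      rw [hM]
      linear_combination -C * s * m * y₁ (x 2) * hab
    · simp [-neg_mul, velocityMode, magneticMode, pd_const_mul, P, P1, Q, Q1, T, T1]
      simp only [mode, ← add_assoc, Real.cos_add_pi_div_two, Real.sin_add_pi_div_two]
      rw [hM]
      ring
    · simp [-neg_mul, velocityMode, magneticMode, pd_const_mul, P, P1, Q, Q1, T, T1]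
      simp only [mode, ← add_assoc, Real.cos_add_pi_div_two, Real.sin_add_pi_div_two]
      rw [hM]
      ring
  · simp [-neg_mul, div, velocityMode, Fin.sum_univ_three, pd_const_mul, P1, Q1, T]
    simp only [mode, ← add_assoc, Real.cos_add_pi_div_two, Real.sin_add_pi_div_two]
    generalize Real.cos (k * A * x 0 + k * B * x 1 + c) = C
    linear_combination -C * y₁ (x 2) * hab
  · simp [-neg_mul, div, magneticMode, Fin.sum_univ_three, pd_const_mul, P1, Q1, T]
    simp only [mode, ← add_assoc, Real.cos_add_pi_div_two, Real.sin_add_pi_div_two]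
    generalize Real.sin (k * A * x 0 + k * B * x 1 + c) = S
    linear_combination S * m * k * A * y₁ (x 2) * hab

set_option linter.unusedSimpArgs false in
-- Now the Lorentz force is horizontal, so it enters through the pressure: horizontally it acts like
-- extra viscosity `M m = M²/s`, whence the coefficient `μ + M m`.
lemma isEigenmode_vertical (hdir : D.dir = .vertical) (hk : k ≠ 0) (hs : s ≠ 0)
    (hab : k * (A ^ 2 + B ^ 2) = 1) (hM : D.M = s * m)
    (hy : ∀ z, HasDerivAt y (y₁ z) z) (hy₁ : ∀ z, HasDerivAt y₁ (y₂ z) z)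
    (hy₂ : ∀ z, HasDerivAt y₂ (y₃ z) z) (hp : ∀ z, HasDerivAt p (p₁ z) z)
    (hr : ∀ z, s * r z = -(deriv D.ρ z * y z))
    (hkp : ∀ z, k * p z = -(s * D.ρ z * y₁ z) + (D.μ + D.M * m) * (y₃ z - k * y₁ z))
    (hkp₁ : ∀ z, k * p₁ z = -(s * (deriv D.ρ z * y₁ z + D.ρ z * y₂ z))
      + (D.μ + D.M * m) * (y₄ z - k * y₂ z))
    (hode : ∀ z, (D.M ^ 2 + s * D.μ) * y₄ z = s ^ 2 * deriv D.ρ z * y₁ z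
      + (k * D.M ^ 2 + 2 * s * D.μ * k + s ^ 2 * D.ρ z) * y₂ z
      - (s * D.μ * k ^ 2 + s ^ 2 * k * D.ρ z - D.g * k * deriv D.ρ z) * y z) :
    IsEigenmode D s (mode (k * A) (k * B) c r) (velocityMode (k * A) (k * B) A B c y y₁)
      (magneticMode .vertical (k * A) (k * B) A B c m y y₁ y₂) (mode (k * A) (k * B) c p) := by
  have d : ∀ {f f' : ℝ → ℝ}, (∀ z, HasDerivAt f (f' z) z) → Differentiable ℝ f ∧ deriv f = f' :=
    fun h => ⟨fun z => (h z).differentiableAt, funext fun z => (h z).deriv⟩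
  have hMb : D.Mbar = ![0, 0, D.M] := by rw [RTData.Mbar, hdir]
  have P := fun e => pd_mode_zero (a := k * A) (b := k * B) (c := e) (d hy).1
  have P1 := fun e => pd_mode_zero (a := k * A) (b := k * B) (c := e) (d hy₁).1
  have P' := fun e => pd_mode_zero (a := k * A) (b := k * B) (c := e) (d hp).1
  have P2 := fun e => pd_mode_zero (a := k * A) (b := k * B) (c := e) (d hy₂).1
  have Q2 := fun e => pd_mode_one (a := k * A) (b := k * B) (c := e) (d hy₂).1
  have Q := fun e => pd_mode_one (a := k * A) (b := k * B) (c := e) (d hy).1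
  have Q1 := fun e => pd_mode_one (a := k * A) (b := k * B) (c := e) (d hy₁).1
  have Q' := fun e => pd_mode_one (a := k * A) (b := k * B) (c := e) (d hp).1
  have T := fun e => (pd_mode_two (a := k * A) (b := k * B) (c := e) (d hy).1)
  have T1 := fun e => (pd_mode_two (a := k * A) (b := k * B) (c := e) (d hy₁).1)
  have T2 := fun e => (pd_mode_two (a := k * A) (b := k * B) (c := e) (d hy₂).1)
  have T' := fun e => (pd_mode_two (a := k * A) (b := k * B) (c := e) (d hp).1)
  simp only [(d hy).2, (d hy₁).2, (d hy₂).2, (d hp).2] at T T1 T2 T'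
  refine ⟨fun x => ?_, fun x => ?_, fun x => ?_, fun x => ?_, fun x => ?_⟩
  · simp only [velocityMode, Matrix.cons_val, mode]
    linear_combination Real.cos (k * A * x 0 + k * B * x 1 + c) * hr (x 2)
  · rw [hMb]
    funext i
    fin_cases i
    · simp [-neg_mul, velocityMode, magneticMode, grad, lap, curl, cross_apply, Fin.sum_univ_three,
        pd_const_mul, P, P1, P2, Q2, P', Q, Q1, Q', T, T1, T2, T']
      simp only [mode, ← add_assoc, Real.cos_add_pi_div_two, Real.sin_add_pi_div_two]
      generalize Real.cos (k * A * x 0 + k * B * x 1 + c) = C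
      generalize Real.sin (k * A * x 0 + k * B * x 1 + c) = S
      linear_combination (-S * A) * hkp (x 2) - D.μ * A * S * y₁ (x 2) * k * hab
    · simp [-neg_mul, velocityMode, magneticMode, grad, lap, curl, cross_apply, Fin.sum_univ_three,
        pd_const_mul, P, P1, P2, Q2, P', Q, Q1, Q', T, T1, T2, T']
      simp only [mode, ← add_assoc, Real.cos_add_pi_div_two, Real.sin_add_pi_div_two]
      generalize Real.cos (k * A * x 0 + k * B * x 1 + c) = C
      generalize Real.sin (k * A * x 0 + k * B * x 1 + c) = S
      linear_combination (-S * B) * hkp (x 2) - D.μ * B * S * y₁ (x 2) * k * hab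
    · simp [-neg_mul, velocityMode, magneticMode, grad, lap, curl, cross_apply, Fin.sum_univ_three,
        pd_const_mul, P, P1, P2, Q2, P', Q, Q1, Q', T, T1, T2, T']
      simp only [mode, ← add_assoc, Real.cos_add_pi_div_two, Real.sin_add_pi_div_two]
      have hode := hode (x 2)
      have hkp₁ := hkp₁ (x 2)
      rw [hM] at hode hkp₁
      generalize Real.cos (k * A * x 0 + k * B * x 1 + c) = C
      refine mul_left_cancel₀ (mul_ne_zero hk hs) ?_
      linear_combination C * (s * hkp₁ + D.g * k * hr (x 2) + hode
        + s * D.μ * k ^ 2 * y (x 2) * hab)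
  · rw [hMb, curl_cross_e3]
    funext i
    fin_cases i
    · simp [-neg_mul, velocityMode, magneticMode, pd_const_mul, T1]
      rw [hM]
      ring
    · simp [-neg_mul, velocityMode, magneticMode, pd_const_mul, T1]
      rw [hM]
      ring
    · simp [-neg_mul, velocityMode, magneticMode, pd_const_mul, P1, Q1]
      simp only [mode, ← add_assoc, Real.cos_add_pi_div_two, Real.sin_add_pi_div_two]
      generalize Real.cos (k * A * x 0 + k * B * x 1 + c) = C
      rw [hM]
      linear_combination -C * s * m * y₁ (x 2) * hab
  · simp [-neg_mul, div, velocityMode, Fin.sum_univ_three, pd_const_mul, P1, Q1, T]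
    simp only [mode, ← add_assoc, Real.cos_add_pi_div_two, Real.sin_add_pi_div_two]
    generalize Real.cos (k * A * x 0 + k * B * x 1 + c) = C
    linear_combination -C * y₁ (x 2) * hab
  · simp [-neg_mul, div, magneticMode, Fin.sum_univ_three, pd_const_mul, P2, Q2, T1]
    simp only [mode, ← add_assoc, Real.cos_add_pi_div_two, Real.sin_add_pi_div_two]
    generalize Real.cos (k * A * x 0 + k * B * x 1 + c) = C
    linear_combination -C * m * y₂ (x 2) * hab

end eigenmode

/-! ### Existence of a growing normal mode -/

namespace RTData

/-- A growth rate at a lattice frequency is realized by a normal mode. -/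
lemma Admissible.exists_eigenmode {D : RTData} (hD : D.Admissible) {ξ : Freq} (hξ : ξ ≠ 0) {s : ℝ}
    (hs : D.IsGrowthRate ξ s) :
    ∃ R U N Q, IsEigenmode D s R U N Q ∧ IsMode (ξ 0) (ξ 1) R ∧ (∀ i, IsMode (ξ 0) (ξ 1) (U i)) ∧
      (∀ i, IsMode (ξ 0) (ξ 1) (N i)) ∧ IsMode (ξ 0) (ξ 1) Q ∧
      (∃ i : Fin 2, ∃ x ∈ cell D.L, U i.castSucc x ≠ 0) ∧ (∃ x ∈ cell D.L, U 2 x ≠ 0) ∧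
      (D.dir = .vertical → ∃ x ∈ cell D.L, N 2 x ≠ 0) := by
  obtain ⟨hs0, -⟩ := isGrowthRate_sq hs
  obtain ⟨y, hy, hy0, hode⟩ := hD.exists_eigenfunction hξ hs
  have hy₁ := hy.deriv
  have hy₂ := hy₁.deriv
  have hy₃ := hy₂.deriv
  have hρ := hD.bddSmooth_ρ
  have hnorm : 0 < ‖ξ‖ := norm_pos_iff.2 hξ
  have hξ2 : ‖ξ‖ ^ 2 = ξ 0 ^ 2 + ξ 1 ^ 2 := by
    rw [EuclideanSpace.real_norm_sq_eq, Fin.sum_univ_two]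
  obtain ⟨k, hk⟩ : ∃ k, k = ‖ξ‖ ^ 2 := ⟨_, rfl⟩
  have hk0 : k ≠ 0 := by rw [hk]; positivity
  obtain ⟨A, hA⟩ : ∃ A, ξ 0 = k * A := ⟨ξ 0 / k, by field_simp⟩
  obtain ⟨B, hB⟩ : ∃ B, ξ 1 = k * B := ⟨ξ 1 / k, by field_simp⟩
  have hab : k * (A ^ 2 + B ^ 2) = 1 := by
    refine mul_left_cancel₀ hk0 ?_
    rw [hA, hB, ← hk] at hξ2
    linear_combination -hξ2
  obtain ⟨m, hm⟩ : ∃ m, D.M = s * m := ⟨D.M / s, by field_simp⟩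
  have hm0 : m ≠ 0 := fun h => hD.M_ne (by rw [hm, h, mul_zero])
  -- The phase equals `π/4` above the centre `(πL, πL)` of the period square, where sine and cosine
  -- are both nonzero; each component can then be tested at such a point.
  let c : ℝ := Real.pi / 4 - ξ 0 * (Real.pi * D.L) - ξ 1 * (Real.pi * D.L)
  -- Effective viscosity in the horizontal momentum balance that defines the pressure profile `p`.
  let ν : ℝ := match D.dir with
    | .horizontal => D.μ
    | .vertical => D.μ + D.M * m
  let r : ℝ → ℝ := fun z => -s⁻¹ * (deriv D.ρ z * y z)
  have hr : SobSmooth r := (SobSmooth.mul hρ.deriv hy).const_mul _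
  let p : ℝ → ℝ := fun z => (-s / k) * (D.ρ z * deriv y z)
    + (ν / k * deriv (deriv (deriv y)) z + (-ν) * deriv y z)
  have hp : SobSmooth p :=
    ((SobSmooth.mul hρ hy₁).const_mul _).add ((hy₃.const_mul _).add (hy₁.const_mul _))
  have hp' : ∀ z, HasDerivAt p ((-s / k) * (deriv D.ρ z * deriv y z + D.ρ z * deriv (deriv y) z)
    + (ν / k * deriv (deriv (deriv (deriv y))) z + (-ν) * deriv (deriv y) z)) z := fun z =>
    ((((hρ 1).1 z).hasDerivAt.mul (hy₁.hasDerivAt z)).const_mul _).add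
      (((hy₃.hasDerivAt z).const_mul _).add ((hy₁.hasDerivAt z).const_mul _))
  let U := velocityMode (ξ 0) (ξ 1) A B c y (deriv y)
  let N := magneticMode D.dir (ξ 0) (ξ 1) A B c m y (deriv y) (deriv (deriv y))
  have mm : ∀ e f, SobSmooth f → IsMode (ξ 0) (ξ 1) (mode (ξ 0) (ξ 1) e f) :=
    fun e f h => ⟨e, f, h, rfl⟩
  have hU : ∀ i, IsMode (ξ 0) (ξ 1) (U i) := by
    intro i
    fin_cases i
    · exact (mm _ _ hy₁).const_mul _
    · exact (mm _ _ hy₁).const_mul _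
    · exact mm _ _ hy
  have hN : ∀ i, IsMode (ξ 0) (ξ 1) (N i) := by
    intro i
    simp only [N, magneticMode]
    cases D.dir
    · fin_cases i
      · exact (mm _ _ hy₁).const_mul _
      · exact (mm _ _ hy₁).const_mul _
      · exact (mm _ _ hy).const_mul _
    · fin_cases i
      · exact (mm _ _ hy₂).const_mul _
      · exact (mm _ _ hy₂).const_mul _
      · exact (mm _ _ hy₁).const_mul _
  obtain ⟨z₀, hz₀⟩ : ∃ z, y z ≠ 0 := by
    by_contra! h
    exact hy0 (funext h)
  -- Otherwise `y` would be a nonzero constant, contradicting its decay at infinity.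
  obtain ⟨z₁, hz₁⟩ : ∃ z, deriv y z ≠ 0 := by
    by_contra! h
    refine hz₀ (tendsto_nhds_unique ?_ hy.tendsto_zero)
    exact tendsto_const_nhds.congr fun z => is_const_of_deriv_eq_zero (hy 1).1 h z₀ z
  have hx : ∀ z, ![Real.pi * D.L, Real.pi * D.L, z] ∈ cell D.L := by
    intro z
    have : 0 < Real.pi * D.L := mul_pos Real.pi_pos hD.L_pos
    refine ⟨⟨?_, ?_⟩, ⟨?_, ?_⟩⟩ <;> simp <;> linarith
  have hcos : ∀ f z, mode (ξ 0) (ξ 1) c f ![Real.pi * D.L, Real.pi * D.L, z] = f z * (√2 / 2) := by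
    intro f z
    have : ξ 0 * (Real.pi * D.L) + ξ 1 * (Real.pi * D.L) + c = Real.pi / 4 := by
      simp only [c]; ring
    simp [mode, this]
  have hsin : ∀ f z, mode (ξ 0) (ξ 1) (c + Real.pi / 2) f ![Real.pi * D.L, Real.pi * D.L, z]
      = f z * -(√2 / 2) := by
    intro f z
    have : ξ 0 * (Real.pi * D.L) + ξ 1 * (Real.pi * D.L) + c = Real.pi / 4 := by
      simp only [c]; ring
    simp [mode, ← add_assoc, this, Real.cos_add_pi_div_two]
  have h2 : √2 / 2 ≠ 0 := by positivity
  refine ⟨mode (ξ 0) (ξ 1) c r, U, N, mode (ξ 0) (ξ 1) c p, ?_, mm _ _ hr, hU, hN, mm _ _ hp,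
    ?_, ⟨_, hx z₀, ?_⟩, fun hdir => ⟨_, hx z₁, ?_⟩⟩
  · have hr' : ∀ z, s * r z = -(deriv D.ρ z * y z) := fun z => by
      simp only [r]
      field_simp
    cases hdir : D.dir with
    | horizontal =>
      have hν : ν = D.μ := by simp only [ν, hdir]
      have h0 : D.e0 ξ = D.M ^ 2 * (k * A) ^ 2 := by rw [e0, hdir, hA]
      have h1 : k * D.e1 ξ = D.M ^ 2 * (k * A) ^ 2 := by
        rw [e1, hdir, hA, ← hk]
        field_simp
      have h2 : D.e2 ξ = 0 := by rw [e2, hdir]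
      simp only [U, N, hdir, hA, hB]
      refine isEigenmode_horizontal hdir hk0 hs0.ne' hab hm hy.hasDerivAt hy₁.hasDerivAt
        hy₂.hasDerivAt hp' hr' (y₄ := deriv (deriv (deriv (deriv y)))) (fun z => ?_) (fun z => ?_)
        (fun z => ?_)
      · simp only [p, hν]
        field_simp
        ring
      · simp only [hν]
        field_simp
        ring
      · have := hode z
        rw [show ‖ξ‖ ^ 4 = k ^ 2 by rw [hk]; ring, ← hk, h1, h0, h2] at this
        linear_combination this
    | vertical =>
      have hν : ν = D.μ + D.M * m := by simp only [ν, hdir]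
      have h0 : D.e0 ξ = 0 := by rw [e0, hdir]
      have h1 : D.e1 ξ = D.M ^ 2 := by rw [e1, hdir]
      have h2 : k * D.e2 ξ = D.M ^ 2 := by
        rw [e2, hdir, ← hk]
        field_simp
      simp only [U, N, hdir, hA, hB]
      refine isEigenmode_vertical hdir hk0 hs0.ne' hab hm hy.hasDerivAt hy₁.hasDerivAt
        hy₂.hasDerivAt hp' hr' (y₄ := deriv (deriv (deriv (deriv y)))) (fun z => ?_) (fun z => ?_)
        (fun z => ?_)
      · simp only [p, hν]
        field_simp
        ring
      · simp only [hν]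
        field_simp
        ring
      · have := hode z
        rw [show ‖ξ‖ ^ 4 = k ^ 2 by rw [hk]; ring, ← hk, h2, h1, h0] at this
        linear_combination this
  · have : A ≠ 0 ∨ B ≠ 0 := by
      by_contra! h
      simp [h.1, h.2] at hab
    rcases this with h | h
    · refine ⟨0, _, hx z₁, ?_⟩
      change A * mode (ξ 0) (ξ 1) (c + Real.pi / 2) (deriv y) _ ≠ 0
      rw [hsin]
      exact mul_ne_zero h (mul_ne_zero hz₁ (neg_ne_zero.2 h2))
    · refine ⟨1, _, hx z₁, ?_⟩
      change B * mode (ξ 0) (ξ 1) (c + Real.pi / 2) (deriv y) _ ≠ 0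
      rw [hsin]
      exact mul_ne_zero h (mul_ne_zero hz₁ (neg_ne_zero.2 h2))
  · change mode (ξ 0) (ξ 1) c y _ ≠ 0
    rw [hcos]
    exact mul_ne_zero hz₀ h2
  · simp only [N, hdir]
    change m * mode (ξ 0) (ξ 1) c (deriv y) _ ≠ 0
    rw [hcos]
    exact mul_ne_zero hm0 (mul_ne_zero hz₁ h2)

/-! ### Growth rates at lattice frequencies and their supremum -/

lemma Admissible.existsUnique_isGrowthRate {D : RTData} (hD : D.Admissible) {ξ : Freq}
    (h : ξ ∈ D.solvable) : ∃! s, D.IsGrowthRate ξ s :=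
  let ⟨_, hψ⟩ := hD.exists_E0_neg h
  hD.existsUnique_growthRate (solvable_ne_zero h) hψ

lemma Admissible.isGrowthRate_growthRate {D : RTData} (hD : D.Admissible) {ξ : Freq}
    (h : ξ ∈ D.solvable) : D.IsGrowthRate ξ (D.growthRate ξ) :=
  Classical.epsilon_spec (hD.existsUnique_isGrowthRate h).exists

/-- For the horizontal field `(0, 1/L)` qualifies, since `ξ₁ = 0`; for the vertical field any `(n/L,
0)` with `n` large does. -/
lemma Admissible.latticeRates_nonempty {D : RTData} (hD : D.Admissible) :
    D.latticeRates.Nonempty := by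
  have hL := hD.L_pos
  refine Set.Nonempty.image _ ?_
  cases hdir : D.dir with
  | horizontal =>
    refine ⟨!₂[0, 1 / D.L], ?_, fun i => ?_⟩
    · rw [solvable, hdir]
      refine ⟨Or.inr rfl, fun h => ?_⟩
      have := congrArg (fun v : Freq => v 1) (Set.mem_singleton_iff.1 h)
      simp only [PiLp.zero_apply] at this
      exact (one_div_pos.2 hL).ne' this
    · fin_cases i
      · exact ⟨0, by simp⟩
      · exact ⟨1, by simp⟩
  | vertical =>
    obtain ⟨n, hn⟩ := exists_nat_gt (D.xiVc * D.L)
    refine ⟨!₂[n / D.L, 0], ?_, fun i => ?_⟩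
    · rw [solvable, hdir]
      change D.xiVc < ‖(!₂[n / D.L, 0] : Freq)‖
      refine lt_of_lt_of_le ((lt_div_iff₀ hL).2 hn) ?_
      have h := PiLp.norm_apply_le (!₂[n / D.L, 0] : Freq) 0
      exact (le_abs_self _).trans h
    · fin_cases i
      · exact ⟨n, by simp⟩
      · exact ⟨0, by simp⟩

lemma Admissible.bddAbove_latticeRates {D : RTData} (hD : D.Admissible) :
    BddAbove D.latticeRates := by
  obtain ⟨C, hC⟩ := hD.exists_growthRate_le
  refine ⟨C, ?_⟩
  rintro _ ⟨ξ, hξ, rfl⟩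
  exact hC ξ (solvable_ne_zero hξ.1) _ (hD.isGrowthRate_growthRate hξ.1)

lemma Admissible.Lam_pos {D : RTData} (hD : D.Admissible) : 0 < D.Lam := by
  obtain ⟨s, hs⟩ := hD.latticeRates_nonempty
  refine lt_of_lt_of_le ?_ (le_csSup hD.bddAbove_latticeRates hs)
  obtain ⟨ξ, hξ, rfl⟩ := hs
  exact (isGrowthRate_sq (hD.isGrowthRate_growthRate hξ.1)).1

end RTData

end RTMHD
end

/-! ### A growing solution with rate close to the supremum -/

open RTMHD in
theorem theorem2p3 (D : RTData) (hD : D.Admissible) :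
    -- `λ(ξ)` is well defined on the solvable domain, and `Λ` is a genuine, positive supremum
    (∀ ξ ∈ D.solvable, ∃! s : ℝ, D.IsGrowthRate ξ s) ∧
    D.latticeRates.Nonempty ∧ IsLUB D.latticeRates D.Lam ∧ 0 < D.Lam ∧
    ∃ Λs : ℝ, 0 < Λs ∧ 2 * D.Lam / 3 < Λs ∧ Λs ≤ D.Lam ∧
      ∃ (ϱ : ℝ → (Fin 3 → ℝ) → ℝ) (u N : ℝ → (Fin 3 → ℝ) → Fin 3 → ℝ)
        (q : ℝ → (Fin 3 → ℝ) → ℝ),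
        IsSolution D ϱ u N q ∧
        (∀ k : ℕ, hNorm D.L k (allComp (ϱ 0) (u 0) (N 0) (q 0)) < ⊤) ∧
        (∀ k : ℕ, ∀ t : ℝ, 0 < t →
          hNorm D.L k (allComp (ϱ t) (u t) (N t) (q t)) < ⊤ ∧
          hNorm D.L k (rhoNq (ϱ t) (N t) (q t)) =
            ENNReal.ofReal (Real.exp (Λs * t)) * hNorm D.L k (rhoNq (ϱ 0) (N 0) (q 0)) ∧
          ∀ i : Fin 8, hNorm D.L k ![allComp (ϱ t) (u t) (N t) (q t) i] =
            ENNReal.ofReal (Real.exp (Λs * t)) *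
              hNorm D.L k ![allComp (ϱ 0) (u 0) (N 0) (q 0) i]) ∧
        (∀ x, div (u 0) x = 0 ∧ div (N 0) x = 0) ∧
        0 < hNorm D.L 0 ![fun x => u 0 x 0, fun x => u 0 x 1] *
          hNorm D.L 0 ![fun x => u 0 x 2] ∧
        (D.dir = .vertical → 0 < hNorm D.L 0 ![fun x => N 0 x 2]) := by
  have hL := hD.L_pos
  refine ⟨fun ξ => hD.existsUnique_isGrowthRate, hD.latticeRates_nonempty,
    isLUB_csSup hD.latticeRates_nonempty hD.bddAbove_latticeRates, hD.Lam_pos, ?_⟩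
  have hlt : 2 * D.Lam / 3 < D.Lam := by linarith [hD.Lam_pos]
  -- The supremum need not be attained; a lattice frequency whose rate exceeds `2Λ/3` is enough, and
  -- that rate serves as `Λs`.
  obtain ⟨_, ⟨ξ, ⟨hsol, hlat⟩, rfl⟩, hgt⟩ := exists_lt_of_lt_csSup hD.latticeRates_nonempty hlt
  have hgr := hD.isGrowthRate_growthRate hsol
  have hle : D.growthRate ξ ≤ D.Lam :=
    le_csSup hD.bddAbove_latticeRates ⟨ξ, ⟨hsol, hlat⟩, rfl⟩
  have hpos := (RTData.Admissible.isGrowthRate_sq hgr).1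
  obtain ⟨R, U, N, Q, hE, hR, hU, hN, hQ, ⟨i, x, hx, hUi⟩, ⟨x', hx', hU2⟩, hN2⟩ :=
    hD.exists_eigenmode (RTData.solvable_ne_zero hsol) hgr
  generalize D.growthRate ξ = s at *
  have hall : ∀ t i, allComp (fun x => Real.exp (s * t) * R x) (fun x i => Real.exp (s * t) * U i x)
      (fun x i => Real.exp (s * t) * N i x) (fun x => Real.exp (s * t) * Q x) i
      = fun x => Real.exp (s * t) * ![R, U 0, U 1, U 2, N 0, N 1, N 2, Q] i x := by
    intro t i
    fin_cases i <;> rfl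
  -- The factor at time zero is `exp (s * 0) = 1`, so the spatial profiles are exactly the initial
  -- data in the norm identities.
  have hall0 : ∀ i, ![R, U 0, U 1, U 2, N 0, N 1, N 2, Q] i
      = allComp (fun x => Real.exp (s * 0) * R x) (fun x i => Real.exp (s * 0) * U i x)
      (fun x i => Real.exp (s * 0) * N i x) (fun x => Real.exp (s * 0) * Q x) i := by
    intro i
    rw [hall]
    simp only [mul_zero, Real.exp_zero, one_mul]
  have hmode : ∀ i, IsMode (ξ 0) (ξ 1) (![R, U 0, U 1, U 2, N 0, N 1, N 2, Q] i) := by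
    intro i
    fin_cases i
    exacts [hR, hU 0, hU 1, hU 2, hN 0, hN 1, hN 2, hQ]
  have hfin : ∀ k t, hNorm D.L k (allComp (fun x => Real.exp (s * t) * R x)
      (fun x i => Real.exp (s * t) * U i x) (fun x i => Real.exp (s * t) * N i x)
      (fun x => Real.exp (s * t) * Q x)) < ⊤ := fun k t =>
    hNorm_lt_top fun i => by rw [hall]; exact (hmode i).const_mul _
  have hcont : ∀ F, IsMode (ξ 0) (ξ 1) F → Continuous fun x => Real.exp (s * 0) * F x :=
    fun F hF => (hF.const_mul _).contDiff.continuous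
  refine ⟨s, hpos, hgt, hle, fun t x => Real.exp (s * t) * R x,
    fun t x i => Real.exp (s * t) * U i x, fun t x i => Real.exp (s * t) * N i x,
    fun t x => Real.exp (s * t) * Q x, hE.isSolution hL (hlat 0) (hlat 1) hR hU hN hQ,
    fun k => hfin k 0, fun k t _ => ⟨hfin k t, ?_, fun j => ?_⟩, fun x => ⟨?_, ?_⟩, ?_, fun hd => ?_⟩
  · refine hNorm_const_mul (Real.exp_pos _).le fun j => ?_
    fin_cases j <;> simp [rhoNq]
  · refine hNorm_const_mul (Real.exp_pos _).le fun l => ?_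
    rw [Subsingleton.elim l 0]
    simp only [Matrix.cons_val_zero]
    rw [← hall0, hall]
  · rw [div_const_mul, hE.div_u, mul_zero]
  · rw [div_const_mul, hE.div_N, mul_zero]
  · refine ENNReal.mul_pos (hNorm_zero_pos i ?_ hx ?_).ne' (hNorm_zero_pos 0 (hcont _ (hU 2)) hx' ?_).ne'
    · fin_cases i
      exacts [hcont _ (hU 0), hcont _ (hU 1)]
    · fin_cases i
      all_goals exact mul_ne_zero (Real.exp_pos _).ne' hUi
    · exact mul_ne_zero (Real.exp_pos _).ne' hU2
  · obtain ⟨z, hz, h⟩ := hN2 hd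
    exact hNorm_zero_pos 0 (hcont _ (hN 2)) hz (mul_ne_zero (Real.exp_pos _).ne' h)
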